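/- **Model.** Base stations (BSs) $0,1,2,\dots$ are located in the plane; BS $k$ has $L$ antennas and serves a set $\mathcal M_k$ of $M\ge 1$ single-antenna mobiles, each at distance at most $R$ from it. Mobile $0$ (the typical mobile) is at the origin and is served by BS $0$; the BSs $k\ge 1$ form a homogeneous Poisson point process of density $\lambda_b>0$. Let $b_i$ be the BS serving mobile $i$, let $r_{i,k}$ be the distance between mobile $i$ and BS $k$ ($r_{0,0}>0$), and let $\mathbf h_{i,k}=r_{i,k}^{-\alpha/2}\mathbf g_{i,k}$ with $\alpha>2$, where the entries of all $\mathbf g_{i,k}\in\mathbb C^L$ are i.i.d. $\mathcal{CN}(0,1)$, independent of all positions. For a zero-forcing radius $D$ let $\mathcal D_k=\{i:r_{i,k}<D\}$, and let $a_k=1$ if $|\mathcal D_k|<L$ or $|\mathcal D_k\cup\mathcal M_k|\le L$, and $a_k=0$ otherwise. For a mobile $i$ with $b_i=k$ let $\mathbf w_i=\mathbf Q_{i,k}\mathbf g_{i,k}/\|\mathbf Q_{i,k}\mathbf g_{i,k}\|$, where $\mathbf Q_{i,k}=\mathbf I-\mathbf G(\mathbf G^{H}\mathbf G)^{-1}\mathbf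 G^{H}$ and $\mathbf G$ has the columns $\mathbf g_{\ell,k}$, $\ell\in\mathcal D_k\setminus\{i\}$. BS $b_i$ allocates power $\varphi_{i,b_i}^2$ to mobile $i$, with $\sum_{i\in\mathcal M_k}\varphi_{i,k}^2\le P$ for every $k$. The powers may depend on $L$, on the positions, on randomness independent of the fading, and on the channel state information of the BSs, i.e. on the vectors $\mathbf g_{i,k}$ with $i\in\mathcal D_k\cup\mathcal M_k$. The SINR of the typical mobile is $$\eta_0=\frac{|a_0\varphi_{0,0}\mathbf h_{0,0}^\dagger\mathbf w_0|^2}{\sum_{j\ne 0}|a_{b_j}\varphi_{j,b_j}\mathbf h_{0,b_j}^\dagger\mathbf w_j|^2+\sigma^2}.$$ **Assumptions.** $D=sL^\beta$ with $s>0$ and either $0\le\beta<1/2$, or $\beta=1/2$ and $s^2\pi\lambda_bM<1$; $\sigma^2=\mu L^{-\zeta}$ with $\mu\ge 0$ and $\zeta\in\mathbb R$. There are constants $\bar P>0$, $\delta$ and $\gamma>0$, not depending on $L$, such that for all $L$ and all BSs $k\ne\ell$, $k,\ell\ge1$, with mutual distance $\tilde r_{k,\ell}$, and with $\Phi_b$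 denoting the positions of all BSs, $$E\Big[\sum_{i\in\mathcal M_k}\varphi_{i,k}^2\,\Big|\,a_k=1,r_{0,k}\Big]=\bar P+\xi_{0,k},\qquad E\Big[\sum_{i\in\mathcal M_k}\varphi_{i,k}^2\sum_{j\in\mathcal M_\ell}\varphi_{j,\ell}^2\,\Big|\,\Phi_b,a_k=a_\ell=1\Big]=\bar P^2+\tilde\xi_{k,\ell},$$ where $|\xi_{0,k}|\le\delta r_{0,k}^{-\gamma}$ and $|\tilde\xi_{k,\ell}|\le\min\{P^2,\delta\tilde r_{k,\ell}^{-\gamma}\}$ (the first conditional expectation is taken with respect to the Campbell measure of the active BSs). **Theorem.** Let $\tilde s=s$ if $\beta=1/2$ and $\tilde s=0$ if $\beta<1/2$; let $\tilde\mu=\mu$ if $\zeta=\beta(\alpha-2)$ and $\tilde\mu=0$ otherwise. The following hold in probability. 1. If $\mu>0$ and $\zeta<\beta(\alpha-2)$, then $$\lim_{L\to\infty}\Big(L^{-1-\zeta}\eta_0-(1-\tilde s^2\pi\lambda_bM)\,\frac{\varphi_{0,0}^2\,r_{0,0}^{-\alpha}}{\mu}\Big)=0.$$ 2. If $\beta>0$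 and $\zeta\ge\beta(\alpha-2)$, then $$\lim_{L\to\infty}\Big(L^{-1-\beta(\alpha-2)}\eta_0-\frac{(1-\tilde s^2\pi\lambda_bM)\,\varphi_{0,0}^2\,r_{0,0}^{-\alpha}}{s^{2-\alpha}\,\frac{2\pi\bar P\lambda_b}{\alpha-2}+\tilde\mu}\Big)=0.$$ In particular, if $\varphi_{0,0}$ does not depend on $L$, then $L^{-1-\zeta}\eta_0$ and $L^{-1-\beta(\alpha-2)}\eta_0$, respectively, converge in probability to the expressions subtracted above. Apart from the power $\varphi_{0,0}^2$ of the typical mobile itself, the limit depends on the power allocation only through the average BS power $\bar P$. -/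

import Mathlib

open MeasureTheory ProbabilityTheory Filter Topology
open scoped ENNReal NNReal Matrix

/-- The plane in which base stations (BSs) and mobiles are located. -/
abbrev Plane := EuclideanSpace ℝ (Fin 2)

/-- Mobiles are indexed by pairs `(k, m)`: the `m`-th of the `M` mobiles served by BS `k`.
BS `0` is the BS that serves the typical mobile. -/
abbrev Mobile (M : ℕ) := ℕ × Fin M

/-! ### Deterministic part: the network for given positions, fading and powers

In this part `x k` is the position of BS `k`, `y i` the position of mobile `i`,
`g i k` the fading vector between mobile `i` and BS `k` (one entry for each of the `L` antennas),
`φ i ^ 2` the power which the serving BS allocates to mobile `i`, and `D` the ZF radius. -/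

section Deterministic

variable {M L : ℕ}

/-- The set `𝒟_k` of mobiles at distance less than `D` from BS `k`. -/
def nearMobiles (D : ℝ) (x : ℕ → Plane) (y : Mobile M → Plane) (k : ℕ) : Set (Mobile M) :=
  {i | dist (y i) (x k) < D}

/-- The set `ℳ_k` of mobiles served by BS `k`. -/
def servedMobiles (M : ℕ) (k : ℕ) : Set (Mobile M) := {i | i.1 = k}

/-- BS `k` transmits iff `|𝒟_k| < L` or `|𝒟_k ∪ ℳ_k| ≤ L`. -/
def IsActive (L : ℕ) (D : ℝ) (x : ℕ → Plane) (y : Mobile M → Plane) (k : ℕ) : Prop :=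
  (nearMobiles D x y k).encard < (L : ℕ∞) ∨
    (nearMobiles D x y k ∪ servedMobiles M k).encard ≤ (L : ℕ∞)

open Classical in
/-- The activity indicator `a_k ∈ {0, 1}`. -/
noncomputable def activity (L : ℕ) (D : ℝ) (x : ℕ → Plane) (y : Mobile M → Plane) (k : ℕ) : ℝ :=
  if IsActive L D x y k then 1 else 0

/-- The total power `∑_{i ∈ ℳ_k} φ_i²` allocated by BS `k`. -/
def bsPower (φ : Mobile M → ℝ) (k : ℕ) : ℝ := ∑ m : Fin M, φ (k, m) ^ 2

/-- The channel vector `h_{i,k} = r_{i,k}^{-α/2} g_{i,k}`. -/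
noncomputable def channel (α : ℝ) (x : ℕ → Plane) (y : Mobile M → Plane)
    (g : Mobile M → ℕ → Fin L → ℂ) (i : Mobile M) (k : ℕ) : Fin L → ℂ :=
  fun n => ((dist (y i) (x k) ^ (-(α / 2)) : ℝ) : ℂ) * g i k n

/-- The matrix whose columns are the fading vectors `g_{j,k}`, `j ∈ S`. -/
def fadingMatrix (g : Mobile M → ℕ → Fin L → ℂ) (k : ℕ) (S : Set (Mobile M)) :
    Matrix (Fin L) S ℂ :=
  Matrix.of fun n j => g j k n

open Classical in
/-- The matrix `I - G (Gᴴ G)⁻¹ Gᴴ`, where `G` has the columns `g_{j,k}`, `j ∈ S`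
(`S` is finite whenever it is used for an active BS). -/
noncomputable def nullProjection (g : Mobile M → ℕ → Fin L → ℂ) (k : ℕ) (S : Set (Mobile M)) :
    Matrix (Fin L) (Fin L) ℂ :=
  if hS : S.Finite then
    letI : Fintype S := hS.fintype
    1 - fadingMatrix g k S * ((fadingMatrix g k S)ᴴ * fadingMatrix g k S)⁻¹ * (fadingMatrix g k S)ᴴ
  else 0

/-- The vector `Q_{i,k} g_{i,k}` for the BS `k = i.1` that serves mobile `i`, where `Q_{i,k}`
nulls the mobiles in `𝒟_k \ {i}`. -/
noncomputable def nulledFading (D : ℝ) (x : ℕ → Plane) (y : Mobile M → Plane)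
    (g : Mobile M → ℕ → Fin L → ℂ) (i : Mobile M) : Fin L → ℂ :=
  nullProjection g i.1 (nearMobiles D x y i.1 \ {i}) *ᵥ g i i.1

/-- The precoding vector `w_i = Q_{i,k} g_{i,k} / ‖Q_{i,k} g_{i,k}‖`, `k = i.1`
(Euclidean norm). -/
noncomputable def precoder (D : ℝ) (x : ℕ → Plane) (y : Mobile M → Plane)
    (g : Mobile M → ℕ → Fin L → ℂ) (i : Mobile M) : Fin L → ℂ :=
  ((‖WithLp.toLp 2 (nulledFading D x y g i)‖⁻¹ : ℝ) : ℂ) • nulledFading D x y g i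

/-- The power `|a_k φ_i h_{j,k}† w_i|²`, `k = i.1`, with which mobile `j` receives the signal that
is intended for mobile `i`. -/
noncomputable def receivedPower (α D : ℝ) (x : ℕ → Plane) (y : Mobile M → Plane)
    (φ : Mobile M → ℝ) (g : Mobile M → ℕ → Fin L → ℂ) (j i : Mobile M) : ℝ :=
  ‖((activity L D x y i.1 * φ i : ℝ) : ℂ) *
    (star (channel α x y g j i.1) ⬝ᵥ precoder D x y g i)‖ ^ 2

/-- The SINR of mobile `j` with noise variance `σ2`. The interference is an infinite sum of
nonnegative terms; it is formed in `[0, ∞]`. -/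
noncomputable def sinr (α D σ2 : ℝ) (x : ℕ → Plane) (y : Mobile M → Plane)
    (φ : Mobile M → ℝ) (g : Mobile M → ℕ → Fin L → ℂ) (j : Mobile M) : ℝ≥0∞ :=
  ENNReal.ofReal (receivedPower α D x y φ g j j) /
    ((∑' i : {i : Mobile M // i ≠ j}, ENNReal.ofReal (receivedPower α D x y φ g j i)) +
      ENNReal.ofReal σ2)

open Classical in
/-- The fading vectors known to the network: BS `k` knows `g_{i,k}` for `i ∈ 𝒟_k ∪ ℳ_k`.
Unknown vectors are replaced by `0`. -/
noncomputable def knownFading (D : ℝ) (x : ℕ → Plane) (y : Mobile M → Plane)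
    (g : Mobile M → ℕ → Fin L → ℂ) : Mobile M → ℕ → Fin L → ℂ :=
  fun i k => if i ∈ nearMobiles D x y k ∪ servedMobiles M k then g i k else 0

end Deterministic

/-! ### Probabilistic part -/

section Probabilistic

variable {Ω : Type*} [mΩ : MeasurableSpace Ω]

/-- The random points `X ω 0, X ω 1, …` (listed with multiplicity) form a homogeneous Poisson point
process of density `lam` in the plane: the number of points in a measurable set of finite area is
Poisson distributed with mean `lam * area`, and the numbers of points in disjoint sets are
independent. -/
structure IsHomogeneousPoisson (μ : Measure Ω) (lam : ℝ) (X : Ω → ℕ → Plane) : Prop where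
  poisson : ∀ B : Set Plane, MeasurableSet B → volume B ≠ ∞ → ∀ n : ℕ,
    μ {ω | {k | X ω k ∈ B}.encard = (n : ℕ∞)} =
      poissonMeasure (lam * (volume B).toReal).toNNReal {n}
  indep : ∀ (N : ℕ) (B : Fin N → Set Plane), (∀ i, MeasurableSet (B i)) →
    (∀ i, volume (B i) ≠ ∞) → Pairwise (fun i j => Disjoint (B i) (B j)) →
    iIndepFun (fun (i : Fin N) ω => {k | X ω k ∈ B i}.encard) μ

/-- The random positions `X` of the BSs and `Y` of the mobiles: the typical mobile `(0, 0)` is at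
the origin, every mobile is within distance `R` of its serving BS, and the BSs other than the one
serving the typical mobile form a homogeneous Poisson process. Nothing else is assumed on the
position of BS `0` and on those of the mobiles. -/
structure IsCellularNetwork {M : ℕ} [NeZero M] (μ : Measure Ω) (lam R : ℝ)
    (X : Ω → ℕ → Plane) (Y : Ω → Mobile M → Plane) : Prop where
  measurable_bs : Measurable X
  measurable_mobile : Measurable Y
  poisson : IsHomogeneousPoisson μ lam (fun ω k => X ω (k + 1))
  typical_at_origin : ∀ᵐ ω ∂μ, Y ω (0, 0) = 0
  dist_typical_pos : ∀ᵐ ω ∂μ, 0 < dist (Y ω (0, 0)) (X ω 0)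
  dist_serving_le : ∀ᵐ ω ∂μ, ∀ i, dist (Y ω i) (X ω i.1) ≤ R

/-- The circularly symmetric complex Gaussian distribution `𝒞𝒩(0, 1)`: real and imaginary part are
independent, centred Gaussian with variance `1/2`. -/
noncomputable def stdComplexGaussian : Measure ℂ :=
  ((gaussianReal 0 (1 / 2)).prod (gaussianReal 0 (1 / 2))).map Complex.measurableEquivRealProd.symm

/-- All entries of all fading vectors are i.i.d. `𝒞𝒩(0, 1)`. -/
structure IsRayleighFading {M L : ℕ} (μ : Measure Ω) (g : Ω → Mobile M → ℕ → Fin L → ℂ) :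
    Prop where
  measurable : Measurable g
  law : ∀ i k n, μ.map (fun ω => g ω i k n) = stdComplexGaussian
  indep : iIndepFun (fun (p : Mobile M × ℕ × Fin L) ω => g ω p.1 p.2.1 p.2.2) μ

/-- The fading is independent of the positions of BSs and mobiles, and the power allocation
satisfies the BS power constraint `P` and uses only what the network knows. Here `𝓖` stands for
the information contained in the positions and possibly in additional randomness, all of it
independent of the fading; the powers are functions of this information and of the fading vectors
`g_{i,k}`, `i ∈ 𝒟_k ∪ ℳ_k`, known to the BSs. -/
structure IsPowerAllocation {M L : ℕ} (μ : Measure Ω) (D P : ℝ)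
    (X : Ω → ℕ → Plane) (Y : Ω → Mobile M → Plane)
    (g : Ω → Mobile M → ℕ → Fin L → ℂ) (φ : Ω → Mobile M → ℝ) : Prop where
  causal : ∃ 𝓖 : MeasurableSpace Ω, 𝓖 ≤ mΩ ∧ Measurable[𝓖] X ∧ Measurable[𝓖] Y ∧
    Indep 𝓖 (MeasurableSpace.comap g inferInstance) μ ∧
    Measurable[𝓖 ⊔ MeasurableSpace.comap (fun ω => knownFading D (X ω) (Y ω) (g ω))
      inferInstance] φ
  power_le : ∀ᵐ ω ∂μ, ∀ k, bsPower (φ ω) k ≤ P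

/-- `E[∑_{i ∈ ℳ_k} φ_i² | a_k = 1, r_{0,k} = r] = Pbar + ξ(r)` with `|ξ(r)| ≤ δ r^{-γ}`, for the BSs
`k ≠ 0`. Conditioning on a point of a point process having distance `r` from the origin is
understood in the usual sense, i.e. through the Campbell measure of the active BSs: for every
measurable set `B` of distances, the mean total power of the active BSs at distances in `B` does
not change when the power of each of them is replaced by `Pbar + ξ(r_{0,k})`. -/
def MeanPowerCondition {M : ℕ} (μ : Measure Ω) (L : ℕ) (D Pbar δ γ : ℝ)
    (X : Ω → ℕ → Plane) (Y : Ω → Mobile M → Plane) (φ : Ω → Mobile M → ℝ) : Prop :=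
  ∃ ξ : ℝ → ℝ, Measurable ξ ∧ (∀ r, 0 < r → |ξ r| ≤ δ * r ^ (-γ)) ∧
    ∀ B : Set ℝ, MeasurableSet B →
      ∫⁻ ω, ∑' k : ℕ, B.indicator (fun _ => ENNReal.ofReal
          (activity L D (X ω) (Y ω) (k + 1) * bsPower (φ ω) (k + 1))) (dist 0 (X ω (k + 1))) ∂μ =
      ∫⁻ ω, ∑' k : ℕ, B.indicator (fun r => ENNReal.ofReal
          (activity L D (X ω) (Y ω) (k + 1) * (Pbar + ξ r))) (dist 0 (X ω (k + 1))) ∂μ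

/-- `E[∑_{i ∈ ℳ_k} φ_i² ∑_{j ∈ ℳ_ℓ} φ_j² | Φ_b, a_k = a_ℓ = 1] = Pbar² + ξ_{k,ℓ}` with
`|ξ_{k,ℓ}| ≤ min(P², δ r_{k,ℓ}^{-γ})` for any two distinct BSs `k, ℓ ≠ 0`, where `r_{k,ℓ}` is their
distance and `Φ_b` stands for the positions of all BSs. -/
def PowerCorrelationCondition {M : ℕ} (μ : Measure Ω) (L : ℕ) (D P Pbar δ γ : ℝ)
    (X : Ω → ℕ → Plane) (Y : Ω → Mobile M → Plane) (φ : Ω → Mobile M → ℝ) : Prop :=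
  ∀ k l : ℕ, k ≠ 0 → l ≠ 0 → k ≠ l →
    ∀ᵐ ω ∂(ProbabilityTheory.cond μ
        {ω | IsActive L D (X ω) (Y ω) k ∧ IsActive L D (X ω) (Y ω) l}),
      |condExp (MeasurableSpace.comap X inferInstance)
          (ProbabilityTheory.cond μ
            {ω | IsActive L D (X ω) (Y ω) k ∧ IsActive L D (X ω) (Y ω) l})
          (fun ω => bsPower (φ ω) k * bsPower (φ ω) l) ω - Pbar ^ 2|
        ≤ min (P ^ 2) (δ * dist (X ω k) (X ω l) ^ (-γ))

end Probabilistic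

/-! After multiplying numerator and denominator by `L ^ ρ`, with `ρ = ζ` in the first claim and `ρ =
β (α - 2)` in the second, the scaled SINR is `φ₀₀² r₀₀^(-α)` times `S / (O + F + N)`. Here `S = a₀
|g₀₀† w₀|² / L` is the normalised gain, `O` and `F` are the scaled interference from BS `0` and from
the other BSs, and `N = ν L^(ρ - ζ)`. Each of these four tends in probability to a constant. The
prefactor need not converge, but it is at most `P r₀₀^(-α)`, which does not involve `L`; so the
product of the prefactor with the vanishing error of the quotient still vanishes.

The main tool is resampling (`IsRayleighFading.lintegral_resample`). One fading vector is
independent of the positions and of all other fading vectors, so it may be replaced by a fresh copy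
and integrated out. When the typical mobile lies outside the zero-forcing radius of BS `k ≠ 0`,
neither powers nor precoders depend on the vector `g_{0,k}`; averaging over it replaces `|g† w|²` by
`1`, and two different BSs can be averaged one after the other. When the typical mobile lies inside
the radius, an active BS causes it no interference because, almost surely, all relevant columns are
independent.

Signal: the gain is a quadratic form in a Gaussian vector, with a projection of rank `L - |𝒟₀ \
{0}|`; its variance is that rank, hence at most `L`. Up to a boundary layer of width proportional to
`R`, `|𝒟₀|` is `M` times a Poisson count, so `S` tends to `1 - s̃² π λ M`, and BS `0` is active with
probability tending to one.

Interference: `O` has mean of order `L^ρ D^(-α)` and vanishes. If noise dominates, Campbell's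
formula bounds the mean of `F` by a multiple of `L^ρ D^(2-α)`, which vanishes as well. Otherwise `F`
converges in mean square to a constant `c`, which follows from a lower bound on its mean tending to
`c` and an upper bound on its second moment tending to `c²` (`tendstoInMeasure_of_moments`). The
mean comes from the mean power condition and Campbell's formula, once the path loss of the inactive
BSs is shown to be negligible (`IsCellularNetwork.inactivePathLoss_le`). The second moment consists
of a negligible diagonal and of pairs of BSs, controlled by the correlation condition and the second
factorial moment measure (`IsRepresentation.lintegral_farInterference_sq_le`). -/

/-! ### Moments of the standard complex Gaussian law and of Gaussian vectors. -/

theorem stdComplexGaussian_eq_withDensity :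
    stdComplexGaussian =
      volume.withDensity (fun z : ℂ => ENNReal.ofReal (Real.pi⁻¹ * Real.exp (-‖z‖ ^ 2))) := by
  have h1 : (gaussianReal 0 (1 / 2)).prod (gaussianReal 0 (1 / 2)) =
      (volume : Measure (ℝ × ℝ)).withDensity
        (fun p => gaussianPDF 0 (1 / 2) p.1 * gaussianPDF 0 (1 / 2) p.2) := by
    rw [gaussianReal_of_var_ne_zero _ (by norm_num), prod_withDensity (measurable_gaussianPDF _ _)
      (measurable_gaussianPDF _ _)]
    rfl
  rw [stdComplexGaussian, h1]
  ext s hs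
  rw [Measure.map_apply (MeasurableEquiv.measurable _) hs, withDensity_apply _ hs,
    withDensity_apply _ (MeasurableEquiv.measurable _ hs),
    ← (Complex.volume_preserving_equiv_real_prod.symm).setLIntegral_comp_preimage_emb
      (MeasurableEquiv.measurableEmbedding _)]
  refine lintegral_congr fun p => ?_
  have h2 : ‖Complex.measurableEquivRealProd.symm p‖ ^ 2 = p.1 ^ 2 + p.2 ^ 2 := by
    rw [← Complex.normSq_eq_norm_sq, Complex.normSq_apply]
    simp [Complex.measurableEquivRealProd]
    ring
  rw [h2]
  simp only [gaussianPDF]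
  rw [← ENNReal.ofReal_mul (gaussianPDFReal_nonneg _ _ _)]
  congr 1
  simp only [gaussianPDFReal]
  have h3 : (2 * Real.pi * ((1 / 2 : ℝ≥0) : ℝ)) = Real.pi := by push_cast; ring
  have h4 : (2 * ((1 / 2 : ℝ≥0) : ℝ)) = 1 := by push_cast; ring
  rw [h3, h4, mul_mul_mul_comm, ← Real.exp_add, ← mul_inv, Real.mul_self_sqrt Real.pi_pos.le]
  congr 2
  ring

instance : IsProbabilityMeasure stdComplexGaussian :=
  Measure.isProbabilityMeasure_map (MeasurableEquiv.measurable _).aemeasurable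

instance : NullSingletonClass stdComplexGaussian := by
  rw [stdComplexGaussian_eq_withDensity]; infer_instance

theorem integral_stdComplexGaussian {E : Type*} [NormedAddCommGroup E] [NormedSpace ℝ E]
    (f : ℂ → E) :
    ∫ z, f z ∂stdComplexGaussian = ∫ z : ℂ, (Real.pi⁻¹ * Real.exp (-‖z‖ ^ 2)) • f z := by
  rw [stdComplexGaussian_eq_withDensity,
    integral_withDensity_eq_integral_toReal_smul (by fun_prop) (by simp)]
  refine integral_congr_ae (.of_forall fun z => ?_)
  simp only
  rw [ENNReal.toReal_ofReal (by positivity)]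

theorem integrable_norm_pow_stdComplexGaussian (q : ℕ) :
    Integrable (fun z : ℂ => ‖z‖ ^ q) stdComplexGaussian := by
  rw [stdComplexGaussian_eq_withDensity,
    integrable_withDensity_iff (by fun_prop) (by simp)]
  have h := integral_rpow_mul_exp_neg_rpow (p := 2) (q := q)
  have h2 : Integrable (fun x : ℂ => ‖x‖ ^ (q : ℝ) * Real.exp (-‖x‖ ^ (2 : ℝ))) := by
    by_contra hn
    have := Complex.integral_rpow_mul_exp_neg_rpow (p := 2) (q := q) (by norm_num)
      (by have : (0 : ℝ) ≤ q := by positivity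
          linarith)
    rw [integral_undef hn] at this
    have h3 := Real.Gamma_pos_of_pos (s := ((q : ℝ) + 2) / 2) (by positivity)
    have := Real.pi_pos
    have : 0 < 2 * Real.pi / 2 * Real.Gamma (((q : ℝ) + 2) / 2) := by positivity
    linarith
  refine (h2.const_mul Real.pi⁻¹).congr (.of_forall fun z => ?_)
  simp only
  rw [ENNReal.toReal_ofReal (by positivity)]
  simp only [Real.rpow_natCast, Real.rpow_ofNat]
  ring

theorem integral_norm_pow_stdComplexGaussian (q : ℕ) :
    ∫ z : ℂ, ‖z‖ ^ q ∂stdComplexGaussian = Real.Gamma ((q + 2) / 2) := by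
  have := Complex.integral_rpow_mul_exp_neg_rpow (p := 2) (q := q) (by norm_num)
      (by have : (0 : ℝ) ≤ q := by positivity
          linarith)
  rw [integral_stdComplexGaussian]
  simp only [smul_eq_mul, mul_assoc, integral_const_mul]
  simp only [Real.rpow_natCast, Real.rpow_ofNat] at this
  rw [show (fun z : ℂ => Real.exp (-‖z‖ ^ 2) * ‖z‖ ^ q) =
    fun z : ℂ => ‖z‖ ^ q * Real.exp (-‖z‖ ^ 2) from funext fun z => mul_comm _ _, this]
  field_simp

/-- The mixed moments of order at most `(2, 2)` of the standard complex Gaussian law. -/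
theorem integral_conj_pow_mul_pow_stdComplexGaussian {p q : ℕ} (hp : p ≤ 2) (hq : q ≤ 2) :
    ∫ z : ℂ, (starRingEnd ℂ z) ^ p * z ^ q ∂stdComplexGaussian =
      if p = q then (p.factorial : ℂ) else 0 := by
  split_ifs with hpq
  · subst hpq
    have h1 : ∀ z : ℂ, (starRingEnd ℂ z) ^ p * z ^ p = ((‖z‖ ^ (2 * p) : ℝ) : ℂ) := by
      intro z
      rw [← mul_pow, ← Complex.normSq_eq_conj_mul_self, Complex.normSq_eq_norm_sq]
      push_cast
      ring
    simp_rw [h1]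
    rw [integral_complex_ofReal, integral_norm_pow_stdComplexGaussian]
    push_cast
    rw [show ((2 * (p : ℝ) + 2) / 2) = p + 1 by ring, Real.Gamma_nat_eq_factorial]
    simp
  · set J := ∫ z : ℂ, (starRingEnd ℂ z) ^ p * z ^ q ∂stdComplexGaussian with hJ
    -- The law is invariant under rotation by `I`, which multiplies the integrand by `I ^ (q - p)`.
    -- For distinct `p, q ≤ 2` this factor is not `1`, so the integral vanishes.
    let cI : Circle := ⟨Complex.I, mem_sphere_zero_iff_norm.2 Complex.norm_I⟩
    have hrot : J = ((-Complex.I) ^ p * Complex.I ^ q) * J := by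
      have key := (LinearIsometryEquiv.measurePreserving (rotation cI)).integral_comp
          (rotation cI).toHomeomorph.measurableEmbedding
          (fun z : ℂ => (Real.pi⁻¹ * Real.exp (-‖z‖ ^ 2)) • ((starRingEnd ℂ z) ^ p * z ^ q))
      rw [← integral_stdComplexGaussian, ← hJ] at key
      refine key.symm.trans ?_
      rw [hJ, integral_stdComplexGaussian, ← integral_const_mul]
      refine integral_congr_ae (.of_forall fun z => ?_)
      have hz : rotation cI z = Complex.I * z := rfl
      simp only [hz]
      simp [mul_pow]
      ring
    have hne : ((-Complex.I) ^ p * Complex.I ^ q) ≠ 1 := by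
      intro h
      have hre := congrArg Complex.re h
      interval_cases p <;> interval_cases q <;> simp [pow_two] at * <;> norm_num at *
    have : (1 - ((-Complex.I) ^ p * Complex.I ^ q)) * J = 0 := by
      rw [sub_mul, one_mul, ← hrot, sub_self]
    rcases mul_eq_zero.1 this with h | h
    · exact absurd (sub_eq_zero.1 h).symm hne
    · exact h

/-- The law of a vector of `L` i.i.d. standard complex Gaussian entries. -/
noncomputable abbrev stdGaussianVector (L : ℕ) : Measure (Fin L → ℂ) :=
  Measure.pi fun _ => stdComplexGaussian

/-- Wick's formula: only pairings of a conjugated with an unconjugated factor survive. Collecting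
equal indices gives exponents `p n`, `q n` and a product of one-dimensional moments, nonzero exactly
if `p = q`. Both pairings occur when all four indices agree, which gives `E|z|⁴ = 2`. -/
theorem integral_stdGaussianVector_fourth {L : ℕ} (a b c d : Fin L) :
    ∫ v, (starRingEnd ℂ (v a)) * v b * ((starRingEnd ℂ (v c)) * v d) ∂(stdGaussianVector L) =
      (if a = b ∧ c = d then 1 else 0) + (if a = d ∧ c = b then 1 else 0) := by
  classical
  set p : Fin L → ℕ := fun n => (if n = a then 1 else 0) + (if n = c then 1 else 0) with hp
  set q : Fin L → ℕ := fun n => (if n = b then 1 else 0) + (if n = d then 1 else 0) with hq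
  have h1 : ∀ v : Fin L → ℂ, (starRingEnd ℂ (v a)) * v b * ((starRingEnd ℂ (v c)) * v d) =
      ∏ n, (starRingEnd ℂ (v n)) ^ p n * (v n) ^ q n := by
    intro v
    simp only [hp, hq, pow_add, Finset.prod_mul_distrib, pow_ite, pow_one, pow_zero,
      Finset.prod_ite_eq', Finset.mem_univ, if_true]
    ring
  simp_rw [h1]
  rw [stdGaussianVector, integral_fintype_prod_eq_prod (𝕜 := ℂ)
    (f := fun n (z : ℂ) => (starRingEnd ℂ z) ^ p n * z ^ q n)]
  have hp2 : ∀ n, p n ≤ 2 := fun n => by simp only [hp]; split_ifs <;> simp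
  have hq2 : ∀ n, q n ≤ 2 := fun n => by simp only [hq]; split_ifs <;> simp
  rw [Finset.prod_congr rfl fun n _ =>
    integral_conj_pow_mul_pow_stdComplexGaussian (hp2 n) (hq2 n)]
  by_cases hall : ∀ n, p n = q n
  · simp only [hall, if_true]
    have ha := hall a
    have hb := hall b
    have hc := hall c
    have hd := hall d
    by_cases hac : a = c
    · subst hac
      have hba : a = b ∧ a = d := by
        simp only [hp, hq] at ha
        split_ifs at ha <;> simp_all
      obtain ⟨rfl, rfl⟩ := hba
      rw [Finset.prod_eq_single a]
      · simp [hq]; norm_num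
      · intro n _ hn; simp [hq, hn]
      · simp
    · rw [Finset.prod_eq_one]
      · simp only [hp, hq] at ha hb hc hd
        by_cases h1 : a = b
        · by_cases h2 : a = d <;> by_cases h3 : c = d <;> by_cases h4 : c = b <;> simp_all
        · by_cases h2 : a = d <;> by_cases h3 : c = d <;> by_cases h4 : c = b <;> simp_all
      · intro n _
        rw [← hall n]
        simp only [hp]
        split_ifs with h1 h2 <;> simp_all
  · push Not at hall
    obtain ⟨n, hn⟩ := hall
    rw [Finset.prod_eq_zero (Finset.mem_univ n) (by simp [hn])]
    symm
    rw [if_neg, if_neg, add_zero]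
    · rintro ⟨rfl, rfl⟩; exact hn (by simp only [hp, hq, add_comm])
    · rintro ⟨rfl, rfl⟩; exact hn (by simp only [hp, hq])

theorem integral_stdGaussianVector_second {L : ℕ} (a b : Fin L) :
    ∫ v, (starRingEnd ℂ (v a)) * v b ∂(stdGaussianVector L) = if a = b then 1 else 0 := by
  classical
  set p : Fin L → ℕ := fun n => (if n = a then 1 else 0) with hp
  set q : Fin L → ℕ := fun n => (if n = b then 1 else 0) with hq
  have h1 : ∀ v : Fin L → ℂ, (starRingEnd ℂ (v a)) * v b =
      ∏ n, (starRingEnd ℂ (v n)) ^ p n * (v n) ^ q n := by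
    intro v
    simp only [hp, hq, Finset.prod_mul_distrib, pow_ite, pow_one, pow_zero,
      Finset.prod_ite_eq', Finset.mem_univ, if_true]
  simp_rw [h1]
  rw [stdGaussianVector, integral_fintype_prod_eq_prod (𝕜 := ℂ)
    (f := fun n (z : ℂ) => (starRingEnd ℂ z) ^ p n * z ^ q n)]
  have hp2 : ∀ n, p n ≤ 2 := fun n => by simp only [hp]; split_ifs <;> simp
  have hq2 : ∀ n, q n ≤ 2 := fun n => by simp only [hq]; split_ifs <;> simp
  rw [Finset.prod_congr rfl fun n _ =>
    integral_conj_pow_mul_pow_stdComplexGaussian (hp2 n) (hq2 n)]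
  split_ifs with hab
  · subst hab
    refine Finset.prod_eq_one fun n _ => ?_
    simp only [hp, hq]
    split_ifs <;> simp
  · exact Finset.prod_eq_zero (Finset.mem_univ a) (by simp [hp, hq, hab])

theorem integrable_stdGaussianVector_prod {L : ℕ} (p q : Fin L → ℕ) :
    Integrable (fun v : Fin L → ℂ => ∏ n, (starRingEnd ℂ (v n)) ^ p n * (v n) ^ q n)
      (stdGaussianVector L) := by
  refine Integrable.fintype_prod (f := fun n (z : ℂ) => (starRingEnd ℂ z) ^ p n * z ^ q n) ?_
  intro n
  refine (integrable_norm_pow_stdComplexGaussian (p n + q n)).mono' ?_ (.of_forall fun z => ?_)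
  · exact (by fun_prop : Continuous fun z : ℂ =>
      (starRingEnd ℂ z) ^ p n * z ^ q n).aestronglyMeasurable
  · simp [pow_add]

theorem integrable_stdGaussianVector_second {L : ℕ} (a b : Fin L) :
    Integrable (fun v : Fin L → ℂ => (starRingEnd ℂ (v a)) * v b) (stdGaussianVector L) := by
  classical
  refine (integrable_stdGaussianVector_prod (fun n => if n = a then 1 else 0)
    (fun n => if n = b then 1 else 0)).congr (.of_forall fun v => ?_)
  simp only [Finset.prod_mul_distrib, pow_ite, pow_one, pow_zero,
      Finset.prod_ite_eq', Finset.mem_univ, if_true]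

theorem integrable_stdGaussianVector_fourth {L : ℕ} (a b c d : Fin L) :
    Integrable (fun v : Fin L → ℂ =>
      (starRingEnd ℂ (v a)) * v b * ((starRingEnd ℂ (v c)) * v d)) (stdGaussianVector L) := by
  classical
  refine (integrable_stdGaussianVector_prod
    (fun n => (if n = a then 1 else 0) + (if n = c then 1 else 0))
    (fun n => (if n = b then 1 else 0) + (if n = d then 1 else 0))).congr (.of_forall fun v => ?_)
  simp only [pow_add, Finset.prod_mul_distrib, pow_ite, pow_one, pow_zero,
      Finset.prod_ite_eq', Finset.mem_univ, if_true]
  ring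

/-! ### Mean and variance of quadratic forms in a Gaussian vector. -/

section QuadraticForm

variable {L : ℕ} (Q : Matrix (Fin L) (Fin L) ℂ)

theorem star_dotProduct_mulVec_eq_sum (v : Fin L → ℂ) :
    star v ⬝ᵥ Q *ᵥ v = ∑ a, ∑ b, Q a b * ((starRingEnd ℂ (v a)) * v b) := by
  simp only [dotProduct, Matrix.mulVec, Finset.mul_sum, Pi.star_apply]
  refine Finset.sum_congr rfl fun a _ => Finset.sum_congr rfl fun b _ => ?_
  simp only [RCLike.star_def]
  ring

theorem star_dotProduct_mulVec_sq_eq_sum (v : Fin L → ℂ) :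
    (star v ⬝ᵥ Q *ᵥ v) ^ 2 = ∑ a, ∑ b, ∑ c, ∑ d,
      Q a b * Q c d * ((starRingEnd ℂ (v a)) * v b * ((starRingEnd ℂ (v c)) * v d)) := by
  rw [star_dotProduct_mulVec_eq_sum, sq, Finset.sum_mul]
  refine Finset.sum_congr rfl fun a _ => ?_
  rw [Finset.sum_mul]
  refine Finset.sum_congr rfl fun b _ => ?_
  rw [Finset.mul_sum]
  refine Finset.sum_congr rfl fun c _ => ?_
  rw [Finset.mul_sum]
  refine Finset.sum_congr rfl fun d _ => ?_
  ring

theorem integrable_quadraticForm :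
    Integrable (fun v : Fin L → ℂ => star v ⬝ᵥ Q *ᵥ v) (stdGaussianVector L) := by
  simp_rw [star_dotProduct_mulVec_eq_sum]
  exact integrable_finsetSum _ fun a _ => integrable_finsetSum _ fun b _ =>
    (integrable_stdGaussianVector_second a b).const_mul _

theorem integrable_quadraticForm_sq :
    Integrable (fun v : Fin L → ℂ => (star v ⬝ᵥ Q *ᵥ v) ^ 2) (stdGaussianVector L) := by
  simp_rw [star_dotProduct_mulVec_sq_eq_sum]
  exact integrable_finsetSum _ fun a _ => integrable_finsetSum _ fun b _ =>
    integrable_finsetSum _ fun c _ => integrable_finsetSum _ fun d _ =>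
    (integrable_stdGaussianVector_fourth a b c d).const_mul _

theorem integral_sum_sum_mul {ι V : Type*} [Fintype ι] [MeasurableSpace V] {m : Measure V}
    (c : ι → ι → ℂ) {F : ι → ι → V → ℂ} (hF : ∀ a b, Integrable (F a b) m) :
    ∫ v, ∑ a, ∑ b, c a b * F a b v ∂m = ∑ a, ∑ b, c a b * ∫ v, F a b v ∂m := by
  rw [integral_finsetSum _ fun a _ => integrable_finsetSum _ fun b _ => (hF a b).const_mul _]
  refine Finset.sum_congr rfl fun a _ => ?_
  rw [integral_finsetSum _ fun b _ => (hF a b).const_mul _]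
  exact Finset.sum_congr rfl fun b _ => integral_const_mul _ _

theorem integral_quadraticForm :
    ∫ v, star v ⬝ᵥ Q *ᵥ v ∂(stdGaussianVector L) = Q.trace := by
  simp_rw [star_dotProduct_mulVec_eq_sum]
  refine (integral_sum_sum_mul (fun a b => Q a b)
    fun a b => integrable_stdGaussianVector_second a b).trans ?_
  simp_rw [integral_stdGaussianVector_second]
  simp [Matrix.trace]

/-- The two Wick pairings contract the indices of `Q a b * Q c d` to `(tr Q)²` and to `tr (Q Q)`
respectively. -/
theorem integral_quadraticForm_sq :
    ∫ v, (star v ⬝ᵥ Q *ᵥ v) ^ 2 ∂(stdGaussianVector L) = Q.trace ^ 2 + (Q * Q).trace := by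
  simp_rw [star_dotProduct_mulVec_sq_eq_sum]
  rw [integral_finsetSum _ fun a _ => integrable_finsetSum _ fun b _ =>
    integrable_finsetSum _ fun c _ => integrable_finsetSum _ fun d _ =>
    (integrable_stdGaussianVector_fourth a b c d).const_mul _]
  simp_rw [integral_finsetSum _ fun b _ =>
    integrable_finsetSum _ fun c _ => integrable_finsetSum _ fun d _ =>
    (integrable_stdGaussianVector_fourth _ b c d).const_mul _,
    integral_finsetSum _ fun c _ => integrable_finsetSum _ fun d _ =>
    (integrable_stdGaussianVector_fourth _ _ c d).const_mul _,
    integral_finsetSum _ fun d _ =>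
    (integrable_stdGaussianVector_fourth _ _ _ d).const_mul _, integral_const_mul,
    integral_stdGaussianVector_fourth, mul_add, Finset.sum_add_distrib]
  congr 1
  · simp [Matrix.trace, sq, ite_and, Finset.sum_mul_sum, Finset.sum_ite_irrel]
  · simp [Matrix.trace, Matrix.mul_apply, ite_and]

end QuadraticForm

/-- The gain is the quadratic form of the rank-one matrix `w w†`, whose trace is the squared norm of
`w`. -/
theorem lintegral_norm_star_dotProduct_sq {L : ℕ} (w : Fin L → ℂ) :
    ∫⁻ v, ENNReal.ofReal (‖star v ⬝ᵥ w‖ ^ 2) ∂(stdGaussianVector L) =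
      ENNReal.ofReal (∑ n, ‖w n‖ ^ 2) := by
  have key (v : Fin L → ℂ) : star v ⬝ᵥ (Matrix.vecMulVec w (star w)) *ᵥ v =
      ((‖star v ⬝ᵥ w‖ ^ 2 : ℝ) : ℂ) := by
    rw [Matrix.vecMulVec_mulVec, dotProduct_smul, ← Complex.normSq_eq_norm_sq,
      ← Complex.mul_conj]
    simp only [MulOpposite.smul_eq_mul_unop, MulOpposite.unop_op, ← starRingEnd_apply]
    congr 1
    simp [dotProduct, mul_comm]
  have h1 := integrable_quadraticForm (Matrix.vecMulVec w (star w))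
  have h2 := integral_quadraticForm (Matrix.vecMulVec w (star w))
  simp_rw [key] at h1 h2
  have h1r : Integrable (fun v => ‖star v ⬝ᵥ w‖ ^ 2) (stdGaussianVector L) := h1.re
  rw [← ofReal_integral_eq_lintegral_ofReal h1r
    (.of_forall fun v => by positivity)]
  congr 1
  have h3 : (Matrix.vecMulVec w (star w)).trace = ((∑ n, ‖w n‖ ^ 2 : ℝ) : ℂ) := by
    simp [Matrix.trace_vecMulVec, dotProduct, Complex.mul_conj, Complex.normSq_eq_norm_sq]
  rw [integral_complex_ofReal, h3] at h2
  exact_mod_cast h2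

/-- For `Q = w w†` the two terms `(tr Q)²` and `tr (Q Q)` coincide, whence the factor `2`. This
controls the diagonal terms in the second moment of the interference. -/
theorem lintegral_norm_star_dotProduct_pow_four {L : ℕ} (w : Fin L → ℂ) :
    ∫⁻ v, ENNReal.ofReal (‖star v ⬝ᵥ w‖ ^ 4) ∂(stdGaussianVector L) =
      ENNReal.ofReal (2 * (∑ n, ‖w n‖ ^ 2) ^ 2) := by
  have key (v : Fin L → ℂ) : (star v ⬝ᵥ (Matrix.vecMulVec w (star w)) *ᵥ v) ^ 2 =
      ((‖star v ⬝ᵥ w‖ ^ 4 : ℝ) : ℂ) := by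
    have : star v ⬝ᵥ (Matrix.vecMulVec w (star w)) *ᵥ v = ((‖star v ⬝ᵥ w‖ ^ 2 : ℝ) : ℂ) := by
      rw [Matrix.vecMulVec_mulVec, dotProduct_smul, ← Complex.normSq_eq_norm_sq,
        ← Complex.mul_conj]
      simp only [MulOpposite.smul_eq_mul_unop, MulOpposite.unop_op, ← starRingEnd_apply]
      congr 1
      simp [dotProduct, mul_comm]
    rw [this]
    push_cast
    ring
  have h1 := integrable_quadraticForm_sq (Matrix.vecMulVec w (star w))
  have h2 := integral_quadraticForm_sq (Matrix.vecMulVec w (star w))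
  simp_rw [key] at h1 h2
  have h1r : Integrable (fun v => ‖star v ⬝ᵥ w‖ ^ 4) (stdGaussianVector L) := h1.re
  rw [← ofReal_integral_eq_lintegral_ofReal h1r
    (.of_forall fun v => by positivity)]
  congr 1
  have h3 : (Matrix.vecMulVec w (star w)).trace = ((∑ n, ‖w n‖ ^ 2 : ℝ) : ℂ) := by
    simp [Matrix.trace_vecMulVec, dotProduct, Complex.mul_conj, Complex.normSq_eq_norm_sq]
  have h4 : (Matrix.vecMulVec w (star w) * Matrix.vecMulVec w (star w)).trace =
      (((∑ n, ‖w n‖ ^ 2) ^ 2 : ℝ) : ℂ) := by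
    rw [Matrix.vecMulVec_mul_vecMulVec, Matrix.trace_vecMulVec]
    rw [Matrix.trace_vecMulVec] at h3
    rw [dotProduct_smul, h3, dotProduct_comm, h3]
    push_cast
    simp [sq]
  rw [integral_complex_ofReal, h3, h4] at h2
  have h5 : (∫ v, ‖star v ⬝ᵥ w‖ ^ 4 ∂(stdGaussianVector L)) =
    (∑ n, ‖w n‖ ^ 2) ^ 2 + (∑ n, ‖w n‖ ^ 2) ^ 2 := by exact_mod_cast h2
  rw [h5]; ring

/-- The variance of the form is `tr (Q Q)`, which for a projection is its trace, that is, its rank.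
Relative to a mean of order `L` the fluctuations are therefore negligible. -/
theorem lintegral_quadraticForm_sub_trace_sq {L : ℕ} {Q : Matrix (Fin L) (Fin L) ℂ} {t : ℝ}
    (hQ : Q.IsHermitian) (hQ2 : Q * Q = Q) (ht : Q.trace = (t : ℂ)) :
    ∫⁻ v, ENNReal.ofReal (((star v ⬝ᵥ Q *ᵥ v).re - t) ^ 2) ∂(stdGaussianVector L) =
      ENNReal.ofReal t := by
  have key (v : Fin L → ℂ) : star v ⬝ᵥ Q *ᵥ v = (((star v ⬝ᵥ Q *ᵥ v).re : ℝ) : ℂ) := by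
    have := hQ.im_star_dotProduct_mulVec_self v
    apply Complex.ext
    · simp
    · simpa using this
  have h1 := integrable_quadraticForm_sq Q
  have h2 := integral_quadraticForm_sq Q
  have h1' := integrable_quadraticForm Q
  have h2' := integral_quadraticForm Q
  rw [hQ2, ht] at h2
  rw [ht] at h2'
  have hf : ∃ f : (Fin L → ℂ) → ℝ, ∀ v, star v ⬝ᵥ Q *ᵥ v = (f v : ℂ) := ⟨_, key⟩
  obtain ⟨f, hf⟩ := hf
  simp_rw [hf] at h1 h2 h1' h2' ⊢
  simp only [Complex.ofReal_re]
  rw [integral_complex_ofReal] at h2'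
  simp_rw [← Complex.ofReal_pow] at h1 h2
  rw [integral_complex_ofReal] at h2
  have i1 : Integrable (fun v => f v ^ 2) (stdGaussianVector L) := h1.re
  have i2 : Integrable f (stdGaussianVector L) := h1'.re
  have e2 : ∫ v, f v ∂(stdGaussianVector L) = t := by exact_mod_cast h2'
  have e1 : ∫ v, f v ^ 2 ∂(stdGaussianVector L) = t ^ 2 + t := by exact_mod_cast h2
  have hexp : ∀ v, (f v - t) ^ 2 = f v ^ 2 - 2 * t * f v + t ^ 2 := fun v => by ring
  simp_rw [hexp]
  rw [← ofReal_integral_eq_lintegral_ofReal]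
  · have i3 : Integrable (fun v => f v ^ 2 - 2 * t * f v) (stdGaussianVector L) :=
      i1.sub (i2.const_mul _)
    rw [integral_add i3 (integrable_const _),
      integral_sub i1 (i2.const_mul _), integral_const_mul, e1, e2]
    congr 1
    simp
    ring
  · exact (i1.sub (i2.const_mul _)).add (integrable_const _)
  · exact .of_forall fun v => by
      have : f v ^ 2 - 2 * t * f v + t ^ 2 = (f v - t) ^ 2 := by ring
      simp only [this]
      positivity

/-- With all coordinates fixed except one where `w` does not vanish, the equation leaves at most one
value for that coordinate, and the one-dimensional law has no atoms. -/
theorem stdGaussianVector_hyperplane {L : ℕ} {w : Fin L → ℂ} (hw : w ≠ 0) :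
    stdGaussianVector L {v | star v ⬝ᵥ w = 0} = 0 := by
  classical
  obtain ⟨n, hn⟩ := Function.ne_iff.1 hw
  have hmeas : MeasurableSet {v : Fin L → ℂ | star v ⬝ᵥ w = 0} :=
    (isClosed_eq (by fun_prop) continuous_const).measurableSet
  rw [← lintegral_indicator_one hmeas, stdGaussianVector,
    lintegral_eq_lmarginal_univ (fun _ => (0 : ℂ)),
    lmarginal_erase' _ (measurable_one.indicator hmeas) (Finset.mem_univ n)]
  have hz : ∀ x : Fin L → ℂ, ∫⁻ z, ({v : Fin L → ℂ | star v ⬝ᵥ w = 0}.indicator 1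
      (Function.update x n z) : ℝ≥0∞) ∂stdComplexGaussian = 0 := by
    intro x
    have hsub : {z : ℂ | star (Function.update x n z) ⬝ᵥ w = 0} ⊆
        {star (-(∑ i ∈ Finset.univ.erase n, star (x i) * w i) / w n)} := by
      intro z hz
      have hz' : star (Function.update x n z) ⬝ᵥ w = 0 := hz
      rw [dotProduct, ← Finset.add_sum_erase _ _ (Finset.mem_univ n)] at hz'
      simp only [Pi.star_apply, Function.update_self] at hz'
      rw [Finset.sum_congr rfl (g := fun i => star (x i) * w i)
        (fun i hi => by rw [Function.update_of_ne (Finset.ne_of_mem_erase hi)])] at hz'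
      rw [Set.mem_singleton_iff, eq_comm, ← star_eq_iff_star_eq, eq_comm, div_eq_iff hn]
      exact (eq_neg_of_add_eq_zero_left hz').symm
    have hmeas' : MeasurableSet {z : ℂ | star (Function.update x n z) ⬝ᵥ w = 0} :=
      (measurable_update x) hmeas
    refine (lintegral_indicator_one hmeas').trans ?_
    exact measure_mono_null hsub (measure_singleton _)
  simp only [hz]
  exact lintegral_zero

/-! ### The projection onto the orthogonal complement of a column space. -/

section Projection

set_option linter.unusedSectionVars false

variable {m n : Type*} [Fintype m] [Fintype n] [DecidableEq m] [DecidableEq n] (G : Matrix m n ℂ)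

/-- The orthogonal projection onto the orthogonal complement of the column space of `G`. -/
noncomputable def Matrix.compl_proj : Matrix m m ℂ := 1 - G * (Gᴴ * G)⁻¹ * Gᴴ

open scoped ComplexOrder in
theorem Matrix.isUnit_gram_of_linearIndependent (h : LinearIndependent ℂ fun j : n => G.col j) :
    IsUnit (Gᴴ * G).det := by
  rw [← Matrix.isUnit_iff_isUnit_det]
  exact (Matrix.PosDef.conjTranspose_mul_self G (Matrix.mulVec_injective_iff.2 h)).isUnit

theorem Matrix.linearIndependent_of_gram_det_ne_zero (h : (Gᴴ * G).det ≠ 0) :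
    LinearIndependent ℂ fun j : n => G.col j := by
  refine Matrix.mulVec_injective_iff.1 fun u v huv => ?_
  have hu : IsUnit (Gᴴ * G) := (Matrix.isUnit_iff_isUnit_det _).2 (Ne.isUnit h)
  refine Matrix.mulVec_injective_of_isUnit hu ?_
  change G *ᵥ u = G *ᵥ v at huv
  change (Gᴴ * G) *ᵥ u = (Gᴴ * G) *ᵥ v
  rw [← Matrix.mulVec_mulVec, ← Matrix.mulVec_mulVec, huv]

theorem Matrix.compl_proj_isHermitian : G.compl_proj.IsHermitian := by
  have h : ((Gᴴ * G)⁻¹)ᴴ = (Gᴴ * G)⁻¹ := by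
    rw [Matrix.conjTranspose_nonsing_inv, Matrix.conjTranspose_mul, Matrix.conjTranspose_conjTranspose]
  unfold Matrix.compl_proj Matrix.IsHermitian
  rw [Matrix.conjTranspose_sub, Matrix.conjTranspose_one, Matrix.conjTranspose_mul,
    Matrix.conjTranspose_mul, h, Matrix.conjTranspose_conjTranspose, Matrix.mul_assoc]

variable {G}

theorem Matrix.conjTranspose_mul_compl_proj (h : IsUnit (Gᴴ * G).det) : Gᴴ * G.compl_proj = 0 := by
  unfold Matrix.compl_proj
  rw [Matrix.mul_sub, Matrix.mul_one, ← Matrix.mul_assoc, ← Matrix.mul_assoc,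
    Matrix.mul_nonsing_inv _ h, Matrix.one_mul, sub_self]

theorem Matrix.compl_proj_mul_self (h : IsUnit (Gᴴ * G).det) :
    G.compl_proj * G.compl_proj = G.compl_proj := by
  conv_lhs => enter [1]; unfold Matrix.compl_proj
  rw [Matrix.sub_mul, Matrix.one_mul, Matrix.mul_assoc, Matrix.conjTranspose_mul_compl_proj h,
    Matrix.mul_zero, sub_zero]

theorem Matrix.trace_compl_proj (h : IsUnit (Gᴴ * G).det) :
    G.compl_proj.trace = (Fintype.card m : ℂ) - Fintype.card n := by
  unfold Matrix.compl_proj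
  rw [Matrix.trace_sub, Matrix.trace_one, Matrix.mul_assoc, Matrix.trace_mul_comm,
    Matrix.mul_assoc, Matrix.nonsing_inv_mul _ h, Matrix.trace_one]

/-- If the projection annihilates `u`, then `u = G (…)` is visibly in the range of `G`. This is what
makes the nulled channel nonzero when the columns are independent. -/
theorem Matrix.mem_span_of_compl_proj_mulVec_eq_zero {u : m → ℂ} (h : G.compl_proj *ᵥ u = 0) :
    u ∈ Submodule.span ℂ (Set.range fun j => G.col j) := by
  unfold Matrix.compl_proj at h
  rw [Matrix.sub_mulVec, Matrix.one_mulVec, sub_eq_zero, Matrix.mul_assoc,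
    ← Matrix.mulVec_mulVec] at h
  have hr := Matrix.range_mulVecLin G
  change _ = Submodule.span ℂ (Set.range fun j => G.col j) at hr
  rw [← hr]
  exact ⟨_, h.symm⟩

end Projection

/-! ### Zero-forcing precoders: unit norm, nulling and useful gain. -/

section Precoder

variable {M L : ℕ}

/-- The fading vectors towards BS `k` of the mobiles in `S` are linearly independent. -/
def IndepColumns (γ : Mobile M → ℕ → Fin L → ℂ) (k : ℕ) (S : Set (Mobile M)) : Prop :=
  LinearIndependent ℂ fun j : S => γ j k

variable {γ : Mobile M → ℕ → Fin L → ℂ} {k : ℕ} {S : Set (Mobile M)}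

open Classical in
theorem nullProjection_eq_compl_proj (γ : Mobile M → ℕ → Fin L → ℂ) (k : ℕ) [Fintype S] :
    nullProjection γ k S = (fadingMatrix γ k S).compl_proj := by
  rw [nullProjection, dif_pos S.toFinite]
  unfold Matrix.compl_proj
  congr!

theorem nullProjection_isHermitian (γ : Mobile M → ℕ → Fin L → ℂ) (k : ℕ) (hS : S.Finite) :
    (nullProjection γ k S).IsHermitian := by
  classical
  have := hS.fintype
  rw [nullProjection_eq_compl_proj]
  exact Matrix.compl_proj_isHermitian _

theorem nullProjection_mul_self (hS : S.Finite) (h : IndepColumns γ k S) :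
    nullProjection γ k S * nullProjection γ k S = nullProjection γ k S := by
  classical
  have := hS.fintype
  rw [nullProjection_eq_compl_proj]
  exact Matrix.compl_proj_mul_self (Matrix.isUnit_gram_of_linearIndependent _ h)

theorem trace_nullProjection (hS : S.Finite) (h : IndepColumns γ k S) :
    (nullProjection γ k S).trace = (((L : ℝ) - S.ncard : ℝ) : ℂ) := by
  classical
  have := hS.fintype
  rw [nullProjection_eq_compl_proj,
    Matrix.trace_compl_proj (Matrix.isUnit_gram_of_linearIndependent (fadingMatrix γ k S) h),
    Set.ncard_eq_toFinset_card', Set.toFinset_card]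
  simp

theorem star_dotProduct_nullProjection (hS : S.Finite) (h : IndepColumns γ k S) {l : Mobile M}
    (hl : l ∈ S) (u : Fin L → ℂ) : star (γ l k) ⬝ᵥ nullProjection γ k S *ᵥ u = 0 := by
  classical
  have := hS.fintype
  rw [nullProjection_eq_compl_proj]
  have h0 := Matrix.conjTranspose_mul_compl_proj (Matrix.isUnit_gram_of_linearIndependent _ h)
  have h1 := congrFun (congrArg (fun A => A *ᵥ u) h0) ⟨l, hl⟩
  beta_reduce at h1
  rw [← Matrix.mulVec_mulVec, Matrix.zero_mulVec] at h1
  exact h1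

/-- A vanishing projection would put the channel of `i` into the span of the nulled channels,
against independence of the enlarged family. -/
theorem nullProjection_mulVec_ne_zero {i : Mobile M} (hS : S.Finite) (hi : i ∉ S)
    (h : IndepColumns γ k (insert i S)) : nullProjection γ k S *ᵥ γ i k ≠ 0 := by
  classical
  have := hS.fintype
  rw [nullProjection_eq_compl_proj]
  intro h0
  have h1 := Matrix.mem_span_of_compl_proj_mulVec_eq_zero h0
  have h2 := (linearIndepOn_insert (f := fun j => γ j k) hi).1 h
  refine h2.2 ?_
  rwa [show (fun j => γ j k) '' S = Set.range fun j => (fadingMatrix γ k S).col j by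
    rw [Set.image_eq_range]; rfl]

theorem IndepColumns.mono {T : Set (Mobile M)} (h : IndepColumns γ k T) (hST : S ⊆ T) :
    IndepColumns γ k S :=
  LinearIndepOn.mono (v := fun j => γ j k) h hST

variable {D : ℝ} {x : ℕ → Plane} {y : Mobile M → Plane} {i j : Mobile M}

theorem sum_norm_sq_smul_inv_norm {L : ℕ} {u : Fin L → ℂ} (hu : u ≠ 0) :
    ∑ n, ‖(((‖WithLp.toLp 2 u‖⁻¹ : ℝ) : ℂ) • u) n‖ ^ 2 = 1 := by
  have h0 : ‖WithLp.toLp 2 u‖ ≠ 0 := by simpa using hu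
  have h1 : ‖WithLp.toLp 2 u‖ ^ 2 = ∑ n, ‖u n‖ ^ 2 := by
    rw [EuclideanSpace.norm_sq_eq]
  simp only [Pi.smul_apply, smul_eq_mul, norm_mul, mul_pow, ← Finset.mul_sum, ← h1]
  simp
  field_simp

theorem sum_norm_sq_precoder (h : nulledFading D x y γ i ≠ 0) :
    ∑ n, ‖precoder D x y γ i n‖ ^ 2 = 1 :=
  sum_norm_sq_smul_inv_norm h

theorem sum_norm_sq_precoder_le : ∑ n, ‖precoder D x y γ i n‖ ^ 2 ≤ 1 := by
  by_cases h : nulledFading D x y γ i = 0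
  · simp [precoder, h]
  · exact (sum_norm_sq_precoder h).le

theorem star_dotProduct_precoder_eq_zero (hS : (nearMobiles D x y i.1 \ {i}).Finite)
    (h : IndepColumns γ i.1 (nearMobiles D x y i.1 \ {i})) {l : Mobile M}
    (hl : l ∈ nearMobiles D x y i.1 \ {i}) : star (γ l i.1) ⬝ᵥ precoder D x y γ i = 0 := by
  rw [precoder, dotProduct_smul, nulledFading, star_dotProduct_nullProjection hS h hl, smul_zero]

/-- The useful signal of mobile `i` is the quadratic form of the null projection. -/
theorem norm_sq_star_dotProduct_precoder_self (hS : (nearMobiles D x y i.1 \ {i}).Finite)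
    (h : IndepColumns γ i.1 (nearMobiles D x y i.1 \ {i})) :
    ‖star (γ i i.1) ⬝ᵥ precoder D x y γ i‖ ^ 2 =
      (star (γ i i.1) ⬝ᵥ nullProjection γ i.1 (nearMobiles D x y i.1 \ {i}) *ᵥ γ i i.1).re := by
  set Q := nullProjection γ i.1 (nearMobiles D x y i.1 \ {i}) with hQ
  set v := γ i i.1 with hv
  have h1 : star v ⬝ᵥ Q *ᵥ v = ((‖WithLp.toLp 2 (Q *ᵥ v)‖ ^ 2 : ℝ) : ℂ) := by
    have h2 : star v ⬝ᵥ Q *ᵥ v = star (Q *ᵥ v) ⬝ᵥ (Q *ᵥ v) := by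
      rw [Matrix.star_mulVec, (nullProjection_isHermitian γ i.1 hS).eq, ← hQ,
        ← Matrix.dotProduct_mulVec, Matrix.mulVec_mulVec, nullProjection_mul_self hS h]
    rw [h2, EuclideanSpace.norm_sq_eq]
    simp only [dotProduct, Pi.star_apply, RCLike.star_def]
    push_cast
    refine Finset.sum_congr rfl fun a _ => ?_
    rw [← Complex.normSq_eq_conj_mul_self, Complex.normSq_eq_norm_sq]
    push_cast
    rfl
  rw [precoder, dotProduct_smul, nulledFading, ← hQ, ← hv, h1]
  by_cases h0 : ‖WithLp.toLp 2 (Q *ᵥ v)‖ = 0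
  · rw [h0]; simp
  · rw [Complex.ofReal_re, norm_smul]
    simp
    field_simp

end Precoder

/-! ### Measurability of the network quantities. -/

section Measurability

variable {A : Type*} [MeasurableSpace A] {M L : ℕ}

theorem measurableSet_eq_const_set {ι : Type*} [Countable ι] {S : A → Set ι} (hS : Measurable S)
    (s : Set ι) : MeasurableSet {a | S a = s} := by
  have : {a | S a = s} = ⋂ i, {a | i ∈ S a ↔ i ∈ s} := by
    ext a
    simp [Set.ext_iff]
  rw [this]
  refine MeasurableSet.iInter fun i => ?_
  have hi : MeasurableSet {a | i ∈ S a} := measurableSet_setOfPred.2 (measurable_set_iff.1 hS i)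
  by_cases h : i ∈ s
  · simpa only [h, iff_true] using hi
  · simp only [h, iff_false]
    exact hi.compl

/-- A function of a random set with countably many finite values is measurable as soon as it is so
for each fixed finite set and for all infinite ones together. -/
theorem measurable_comp_set {ι B : Type*} [Countable ι] [MeasurableSpace B] {S : A → Set ι}
    (hS : Measurable S) {F : Set ι → A → B} (hF : ∀ s : Set ι, s.Finite → Measurable (F s))
    {b : B} (hinf : ∀ s : Set ι, s.Infinite → ∀ a, F s a = b) :
    Measurable fun a => F (S a) a := by
  intro t ht
  have : (fun a => F (S a) a) ⁻¹' t =
      (⋃ s : Finset ι, {a | S a = (s : Set ι)} ∩ F (s : Set ι) ⁻¹' t) ∪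
      ((⋃ s : Finset ι, {a | S a = (s : Set ι)})ᶜ ∩ {_a | b ∈ t}) := by
    ext a
    simp only [Set.mem_preimage, Set.mem_union, Set.mem_iUnion, Set.mem_inter_iff, Set.mem_ofPred_eq,
      Set.mem_compl_iff]
    by_cases h : (S a).Finite
    · have h1 : S a = (h.toFinset : Set ι) := by simp
      constructor
      · intro h2
        exact Or.inl ⟨h.toFinset, h1, by rw [← h1]; exact h2⟩
      · rintro (⟨s, h2, h3⟩ | ⟨h2, -⟩)
        · rw [h2]; exact h3
        · exact absurd ⟨_, h1⟩ h2
    · rw [hinf _ h]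
      constructor
      · intro h2
        refine Or.inr ⟨?_, h2⟩
        rintro ⟨s, h3⟩
        exact h (h3 ▸ s.finite_toSet)
      · rintro (⟨s, h2, h3⟩ | ⟨-, h3⟩)
        · exact absurd (h2 ▸ s.finite_toSet) h
        · exact h3
  rw [this]
  refine .union (.iUnion fun s => (measurableSet_eq_const_set hS _).inter
    (hF _ s.finite_toSet ht)) (.inter (.compl (.iUnion fun s => measurableSet_eq_const_set hS _)) ?_)
  exact MeasurableSet.const _

variable {x : A → ℕ → Plane} {y : A → Mobile M → Plane} {γ : A → Mobile M → ℕ → Fin L → ℂ} {D : ℝ}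

theorem measurable_dist_mobile (hx : Measurable x) (hy : Measurable y) (i : Mobile M) (k : ℕ) :
    Measurable fun a => dist (y a i) (x a k) :=
  (measurable_pi_iff.1 hy i).dist (measurable_pi_iff.1 hx k)

theorem measurable_nearMobiles (hx : Measurable x) (hy : Measurable y) (k : ℕ) :
    Measurable fun a => nearMobiles D (x a) (y a) k := by
  refine measurable_set_iff.2 fun i => measurableSet_setOfPred.1 ?_
  exact measurableSet_lt (measurable_dist_mobile hx hy i k) measurable_const

theorem measurableSet_mem_nearMobiles (hx : Measurable x) (hy : Measurable y) (i : Mobile M)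
    (k : ℕ) : MeasurableSet {a | i ∈ nearMobiles D (x a) (y a) k} :=
  measurableSet_lt (measurable_dist_mobile hx hy i k) measurable_const

theorem measurableSet_isActive (hx : Measurable x) (hy : Measurable y) (k : ℕ) :
    MeasurableSet {a | IsActive L D (x a) (y a) k} := by
  have h1 := measurable_nearMobiles (D := D) hx hy k
  have h2 : Measurable fun a => nearMobiles D (x a) (y a) k ∪ servedMobiles M k := by
    refine measurable_set_iff.2 fun i => measurableSet_setOfPred.1 ?_
    have : {a | i ∈ nearMobiles D (x a) (y a) k ∪ servedMobiles M k} =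
      {a | i ∈ nearMobiles D (x a) (y a) k} ∪ {_a | i ∈ servedMobiles M k} := rfl
    rw [this]
    exact (measurableSet_mem_nearMobiles hx hy i k).union (MeasurableSet.const _)
  exact ((measurable_encard.comp h1) (MeasurableSet.of_discrete (s := Set.Iio (L : ℕ∞)))).union
    ((measurable_encard.comp h2) (MeasurableSet.of_discrete (s := Set.Iic (L : ℕ∞))))

theorem measurable_activity (hx : Measurable x) (hy : Measurable y) (k : ℕ) :
    Measurable fun a => activity L D (x a) (y a) k := by
  classical
  unfold activity
  exact Measurable.ite (measurableSet_isActive hx hy k) measurable_const measurable_const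

theorem measurable_gram_det (hγ : Measurable γ) (k : ℕ) (S : Set (Mobile M)) [Fintype S]
    [DecidableEq S] :
    Measurable fun a => ((fadingMatrix (γ a) k S)ᴴ * fadingMatrix (γ a) k S).det := by
  have hc : Continuous fun γ : Mobile M → ℕ → Fin L → ℂ =>
      ((fadingMatrix γ k S)ᴴ * fadingMatrix γ k S).det := by
    have hG : Continuous fun γ : Mobile M → ℕ → Fin L → ℂ => fadingMatrix γ k S :=
      continuous_matrix fun n j => by simp only [fadingMatrix, Matrix.of_apply]; fun_prop
    exact (hG.matrix_conjTranspose.matrix_mul hG).matrix_det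
  exact hc.measurable.comp hγ

theorem measurable_nullProjection_entry (hγ : Measurable γ) (k : ℕ) {S : A → Set (Mobile M)}
    (hS : Measurable S) (p q : Fin L) : Measurable fun a => nullProjection (γ a) k (S a) p q := by
  classical
  refine measurable_comp_set (F := fun s a => nullProjection (γ a) k s p q) (b := 0) hS
    (fun s hs => ?_) (fun s hs a => ?_)
  · have := hs.fintype
    -- Through the adjugate the entries become continuous functions of the fading times the inverse
    -- of the Gram determinant. The latter is measurable even where the determinant vanishes.
    simp only [nullProjection_eq_compl_proj, Matrix.compl_proj, Matrix.inv_def]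
    have hG : Continuous fun γ : Mobile M → ℕ → Fin L → ℂ => fadingMatrix γ k s :=
      continuous_matrix fun n j => by simp only [fadingMatrix, Matrix.of_apply]; fun_prop
    have hadj := (hG.matrix_conjTranspose.matrix_mul hG).matrix_adjugate
    have hprod := (hG.matrix_mul hadj).matrix_mul hG.matrix_conjTranspose
    have h2 : Measurable fun a => (fadingMatrix (γ a) k s * ((fadingMatrix (γ a) k s)ᴴ *
        fadingMatrix (γ a) k s).adjugate * (fadingMatrix (γ a) k s)ᴴ) p q :=
      (hprod.matrix_elem p q).measurable.comp hγ
    simp only [Matrix.mul_smul, Matrix.smul_mul, Matrix.sub_apply, Matrix.smul_apply,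
      Ring.inverse_eq_inv', smul_eq_mul]
    exact measurable_const.sub ((measurable_gram_det hγ k s).inv.mul h2)
  · have : ¬ s.Finite := hs
    simp [nullProjection, this]

theorem measurable_nulledFading (hx : Measurable x) (hy : Measurable y) (hγ : Measurable γ)
    (i : Mobile M) : Measurable fun a => nulledFading D (x a) (y a) (γ a) i := by
  refine measurable_pi_iff.2 fun n => ?_
  simp only [nulledFading, Matrix.mulVec, dotProduct]
  have hS : Measurable fun a => nearMobiles D (x a) (y a) i.1 \ {i} := by
    refine measurable_set_iff.2 fun l => measurableSet_setOfPred.1 ?_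
    exact (measurableSet_mem_nearMobiles hx hy l i.1).inter (MeasurableSet.const (¬ l ∈ ({i} : Set _)))
  refine Finset.measurable_fun_sum _ fun q _ => ?_
  exact (measurable_nullProjection_entry hγ i.1 hS n q).mul
    (measurable_pi_iff.1 (measurable_pi_iff.1 (measurable_pi_iff.1 hγ i) i.1) q)

theorem measurable_precoder (hx : Measurable x) (hy : Measurable y) (hγ : Measurable γ)
    (i : Mobile M) : Measurable fun a => precoder D (x a) (y a) (γ a) i := by
  have h := measurable_nulledFading (D := D) hx hy hγ i
  refine measurable_pi_iff.2 fun n => ?_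
  simp only [precoder, Pi.smul_apply, smul_eq_mul]
  refine Measurable.mul (Complex.measurable_ofReal.comp ?_) (measurable_pi_iff.1 h n)
  exact (((WithLp.measurable_toLp 2 _).comp h).norm).inv

/-- The activity is `0` or `1` and hence equals its square. In this form the last factor alone
contains the channel from the transmitting BS to the receiver explicitly. -/
theorem receivedPower_eq (α : ℝ) (x : ℕ → Plane) (y : Mobile M → Plane) (φ : Mobile M → ℝ)
    (γ : Mobile M → ℕ → Fin L → ℂ) (j i : Mobile M) :
    receivedPower α D x y φ γ j i = activity L D x y i.1 * φ i ^ 2 *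
      dist (y j) (x i.1) ^ (-α) * ‖star (γ j i.1) ⬝ᵥ precoder D x y γ i‖ ^ 2 := by
  have h1 : star (channel α x y γ j i.1) ⬝ᵥ precoder D x y γ i =
      ((dist (y j) (x i.1) ^ (-(α / 2)) : ℝ) : ℂ) * (star (γ j i.1) ⬝ᵥ precoder D x y γ i) := by
    simp only [dotProduct, channel, Pi.star_apply, Finset.mul_sum, star_mul', RCLike.star_def,
      Complex.conj_ofReal]
    exact Finset.sum_congr rfl fun _ _ => by ring
  have h2 : (dist (y j) (x i.1) ^ (-(α / 2))) ^ 2 = dist (y j) (x i.1) ^ (-α) := by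
    rw [← Real.rpow_natCast, ← Real.rpow_mul dist_nonneg]
    congr 1
    push_cast
    ring
  have h3 : activity L D x y i.1 ^ 2 = activity L D x y i.1 := by
    unfold activity
    split_ifs <;> simp
  rw [receivedPower, h1, norm_mul, norm_mul, mul_pow, mul_pow, Complex.norm_real, Complex.norm_real,
    Real.norm_eq_abs, Real.norm_eq_abs, sq_abs, sq_abs, h2, mul_pow, h3]
  ring

theorem measurable_receivedPower (α : ℝ) {φ : A → Mobile M → ℝ} (hx : Measurable x)
    (hy : Measurable y) (hφ : Measurable φ) (hγ : Measurable γ) (j i : Mobile M) :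
    Measurable fun a => receivedPower α D (x a) (y a) (φ a) (γ a) j i := by
  simp_rw [receivedPower_eq]
  refine (((measurable_activity hx hy i.1).mul ((measurable_pi_iff.1 hφ i).pow_const 2)).mul
    ((measurable_dist_mobile hx hy j i.1).pow_const (-α))).mul (Measurable.pow_const (.norm ?_) 2)
  simp only [dotProduct, Pi.star_apply]
  refine Finset.measurable_fun_sum _ fun q _ => Measurable.mul ?_ ?_
  · exact Complex.continuous_conj.measurable.comp
      (measurable_pi_iff.1 (measurable_pi_iff.1 (measurable_pi_iff.1 hγ j) i.1) q)
  · exact measurable_pi_iff.1 (measurable_precoder hx hy hγ i) q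

theorem measurable_knownFading (hx : Measurable x) (hy : Measurable y) (hγ : Measurable γ) :
    Measurable fun a => knownFading D (x a) (y a) (γ a) := by
  classical
  refine measurable_pi_iff.2 fun i => measurable_pi_iff.2 fun k => ?_
  unfold knownFading
  refine Measurable.ite ?_ (measurable_pi_iff.1 (measurable_pi_iff.1 hγ i) k) measurable_const
  exact (measurableSet_mem_nearMobiles hx hy i k).union (MeasurableSet.const (i ∈ servedMobiles M k))

end Measurability

/-! ### Replacing one fading vector by an independent copy. -/

section Resampling

set_option linter.unusedSectionVars false

variable {M L : ℕ}

/-- The fading field `γ` with the fading vector between mobile `i` and BS `k` replaced by `v`. -/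
def resample (i : Mobile M) (k : ℕ) (v : Fin L → ℂ) (γ : Mobile M → ℕ → Fin L → ℂ) :
    Mobile M → ℕ → Fin L → ℂ :=
  fun i' k' => if i' = i ∧ k' = k then v else γ i' k'

theorem measurable_resample (i : Mobile M) (k : ℕ) :
    Measurable fun p : (Fin L → ℂ) × (Mobile M → ℕ → Fin L → ℂ) => resample i k p.1 p.2 := by
  refine measurable_pi_iff.2 fun i' => measurable_pi_iff.2 fun k' => ?_
  unfold resample
  by_cases h : i' = i ∧ k' = k
  · simp only [h, and_self, if_true]; exact measurable_fst
  · simp only [h, if_false]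
    exact measurable_pi_iff.1 (measurable_pi_iff.1 measurable_snd i') k'

theorem measurable_resample_zero {A : Type*} [m : MeasurableSpace A]
    {h : A → Mobile M → ℕ → Fin L → ℂ} {i : Mobile M} {k : ℕ}
    (hh : ∀ i' k' n, ¬ (i' = i ∧ k' = k) → Measurable fun a => h a i' k' n) :
    Measurable fun a => resample i k 0 (h a) := by
  refine measurable_pi_iff.2 fun i' => measurable_pi_iff.2 fun k' => ?_
  by_cases h' : i' = i ∧ k' = k
  · simp only [resample, h', and_self, if_true]; exact measurable_const
  · simp only [resample, h', if_false]
    exact measurable_pi_iff.2 fun n => hh i' k' n h'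

variable {Ω : Type*} [mΩ : MeasurableSpace Ω] {μ : Measure Ω} [IsProbabilityMeasure μ]
  {g : Ω → Mobile M → ℕ → Fin L → ℂ}

theorem IsRayleighFading.map_vector (hg : IsRayleighFading μ g) (i : Mobile M) (k : ℕ) :
    μ.map (fun ω => g ω i k) = stdGaussianVector L := by
  have hm : ∀ n, Measurable fun ω => g ω i k n := fun n =>
    measurable_pi_iff.1 (measurable_pi_iff.1 (measurable_pi_iff.1 hg.measurable i) k) n
  have h1 : iIndepFun (fun n ω => g ω i k n) μ :=
    hg.indep.precomp (g := fun n : Fin L => ((i, k, n) : Mobile M × ℕ × Fin L))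
      (fun a b h => by simpa using h)
  have h2 := (iIndepFun_iff_map_fun_eq_pi_map fun n => (hm n).aemeasurable).1 h1
  rw [h2, stdGaussianVector]
  congr 1
  funext n
  exact hg.law i k n

/-- Setting the block `(i, k)` to zero leaves a function of the entries outside the block, and
disjoint blocks of an independent family are independent. -/
theorem IsRayleighFading.indepFun_resample (hg : IsRayleighFading μ g) (i : Mobile M) (k : ℕ) :
    IndepFun (fun ω => g ω i k) (fun ω => resample i k 0 (g ω)) μ := by
  have hm : ∀ p : Mobile M × ℕ × Fin L, Measurable fun ω => g ω p.1 p.2.1 p.2.2 := fun p =>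
    measurable_pi_iff.1 (measurable_pi_iff.1 (measurable_pi_iff.1 hg.measurable p.1) p.2.1) p.2.2
  set S : Set (Mobile M × ℕ × Fin L) := {p | p.1 = i ∧ p.2.1 = k}
  have h := indep_iSup_of_disjoint (fun p => (hm p).comap_le) hg.indep.iIndep
    (disjoint_compl_right (a := S))
  rw [IndepFun_iff_Indep]
  refine indep_of_indep_of_le_left (indep_of_indep_of_le_right h ?_) ?_
  · refine Measurable.comap_le (m₁ := _) (measurable_resample_zero (m := _) fun i' k' n h' => ?_)
    refine Measurable.mono (comap_measurable fun ω => g ω i' k' n) ?_ le_rfl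
    exact le_iSup₂_of_le (i', k', n) h' le_rfl
  · refine Measurable.comap_le (m₁ := _) ((@measurable_pi_iff _ _ _ (_) _ _).2 fun n => ?_)
    refine Measurable.mono (comap_measurable fun ω => g ω i k n) ?_ le_rfl
    exact le_iSup₂_of_le (i, k, n) ⟨rfl, rfl⟩ le_rfl

theorem resample_self (i : Mobile M) (k : ℕ) (u : Fin L → ℂ) (γ : Mobile M → ℕ → Fin L → ℂ) :
    resample i k (γ i k) (resample i k u γ) = γ := by
  funext i' k'
  unfold resample
  split_ifs with h
  · rw [h.1, h.2]
  · rfl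

theorem resample_resample (i : Mobile M) (k : ℕ) (u v : Fin L → ℂ)
    (γ : Mobile M → ℕ → Fin L → ℂ) : resample i k v (resample i k u γ) = resample i k v γ := by
  funext i' k'
  unfold resample
  split_ifs <;> rfl

/-- The joint law of a random element `τ` that is independent of the fading, and of the fading, is
unchanged if one fading vector is replaced by an independent copy. -/
theorem IsRayleighFading.lintegral_resample {T : Type*} [MeasurableSpace T] {τ : Ω → T}
    (hτ : Measurable τ) (hg : IsRayleighFading μ g) (hτg : IndepFun τ g μ)
    {F : T → (Mobile M → ℕ → Fin L → ℂ) → ℝ≥0∞} (hF : Measurable (Function.uncurry F))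
    (i : Mobile M) (k : ℕ) :
    ∫⁻ ω, F (τ ω) (g ω) ∂μ =
      ∫⁻ ω, ∫⁻ v, F (τ ω) (resample i k v (g ω)) ∂(stdGaussianVector L) ∂μ := by
  have hgm := hg.measurable
  have hgi : Measurable fun ω => g ω i k := measurable_pi_iff.1 (measurable_pi_iff.1 hgm i) k
  have hgr : Measurable fun ω => resample i k 0 (g ω) :=
    (measurable_resample i k).comp (measurable_const.prodMk hgm)
  have hprob : IsProbabilityMeasure (μ.map τ) := Measure.isProbabilityMeasure_map hτ.aemeasurable
  have hprobg : IsProbabilityMeasure (μ.map g) := Measure.isProbabilityMeasure_map hgm.aemeasurable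
  have hprobr : IsProbabilityMeasure (μ.map fun ω => resample i k 0 (g ω)) :=
    Measure.isProbabilityMeasure_map hgr.aemeasurable
  have hsplit : ∀ {H : T → (Mobile M → ℕ → Fin L → ℂ) → ℝ≥0∞}, Measurable (Function.uncurry H) →
      ∫⁻ ω, H (τ ω) (g ω) ∂μ = ∫⁻ t, ∫⁻ ω, H t (g ω) ∂μ ∂(μ.map τ) := by
    intro H hH
    have h1 := (indepFun_iff_map_prod_eq_prod_map_map hτ.aemeasurable hgm.aemeasurable).1 hτg
    have h2 := lintegral_map (μ := μ) hH (hτ.prodMk hgm)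
    simp only [Function.uncurry_apply_pair] at h2
    rw [← h2, h1, lintegral_prod _ hH.aemeasurable]
    refine lintegral_congr fun t => ?_
    exact lintegral_map (hH.comp measurable_prodMk_left) hgm
  have hG : Measurable (Function.uncurry fun t γ =>
      ∫⁻ v, F t (resample i k v γ) ∂(stdGaussianVector L)) := by
    refine Measurable.lintegral_prod_right (f := fun p : T × (Mobile M → ℕ → Fin L → ℂ) =>
      fun v => F p.1 (resample i k v p.2)) ?_
    exact hF.comp (measurable_fst.fst.prodMk
      ((measurable_resample i k).comp (measurable_snd.prodMk measurable_fst.snd)))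
  rw [hsplit hF, hsplit hG]
  refine lintegral_congr fun t => ?_
  have hFt : Measurable (F t) := hF.comp measurable_prodMk_left
  have h1 := (indepFun_iff_map_prod_eq_prod_map_map hgi.aemeasurable hgr.aemeasurable).1
    (hg.indepFun_resample i k)
  have h2 := lintegral_map (μ := μ) (f := fun p => F t (resample i k p.1 p.2))
    (hFt.comp (measurable_resample i k)) (hgi.prodMk hgr)
  -- Putting the true vector back into the zeroed field recovers the field. So the fading is a
  -- function of two independent parts, and Fubini integrates out the first.
  simp only [resample_self] at h2
  refine h2.symm.trans ?_
  have hK : Measurable fun p : (Fin L → ℂ) × (Mobile M → ℕ → Fin L → ℂ) =>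
      F t (resample i k p.1 p.2) := hFt.comp (measurable_resample i k)
  rw [h1, hg.map_vector, lintegral_prod_symm _ hK.aemeasurable,
    lintegral_map hK.lintegral_prod_left hgr]
  simp only [resample_resample]

end Resampling

/-! ### Almost sure independence of channels, and which quantities ignore a given channel. -/

section IndependentColumns

variable {Ω : Type*} [mΩ : MeasurableSpace Ω] {μ : Measure Ω} {M L : ℕ}
  {g : Ω → Mobile M → ℕ → Fin L → ℂ}

theorem exists_ne_zero_forall_star_dotProduct_eq_zero {γ : Mobile M → ℕ → Fin L → ℂ} {k : ℕ}
    {S : Set (Mobile M)} [Fintype S] (hS : Fintype.card S < L) :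
    ∃ w : Fin L → ℂ, w ≠ 0 ∧ ∀ u ∈ Submodule.span ℂ ((fun j => γ j k) '' S), star u ⬝ᵥ w = 0 := by
  have hker := LinearMap.ker_ne_bot_of_finrank_lt (f := ((fadingMatrix γ k S)ᴴ).mulVecLin)
    (by simpa using hS)
  obtain ⟨w, hw, hw0⟩ := Submodule.exists_mem_ne_zero_of_ne_bot hker
  refine ⟨w, hw0, fun u hu => ?_⟩
  induction hu using Submodule.span_induction with
  | mem u hu =>
    obtain ⟨j, hj, rfl⟩ := hu
    exact congrFun (show (fadingMatrix γ k S)ᴴ *ᵥ w = 0 from hw) ⟨j, hj⟩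
  | zero => simp
  | add a b _ _ ha hb => rw [star_add, add_dotProduct, ha, hb, add_zero]
  | smul c a _ ha => rw [star_smul, smul_dotProduct, ha, smul_zero]

theorem indepColumns_resample {γ : Mobile M → ℕ → Fin L → ℂ} {k : ℕ} {S : Set (Mobile M)}
    {i : Mobile M} (hi : i ∉ S) (v : Fin L → ℂ) :
    IndepColumns (resample i k v γ) k S ↔ IndepColumns γ k S := by
  have : (fun j : S => resample i k v γ j k) = fun j : S => γ j k := by
    funext j
    have : (j : Mobile M) ≠ i := fun h => hi (h ▸ j.2)
    simp [resample, this]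
  rw [IndepColumns, this, IndepColumns]

theorem indepColumns_iff_det {γ : Mobile M → ℕ → Fin L → ℂ} {k : ℕ} {S : Set (Mobile M)}
    [Fintype S] [DecidableEq S] :
    IndepColumns γ k S ↔ ((fadingMatrix γ k S)ᴴ * fadingMatrix γ k S).det ≠ 0 :=
  ⟨fun h => (Matrix.isUnit_gram_of_linearIndependent _ h).ne_zero,
    fun h => Matrix.linearIndependent_of_gram_det_ne_zero _ h⟩

theorem measurableSet_indepColumns (k : ℕ) (S : Finset (Mobile M)) :
    MeasurableSet {γ : Mobile M → ℕ → Fin L → ℂ | IndepColumns γ k (S : Set (Mobile M))} := by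
  classical
  simp_rw [indepColumns_iff_det]
  exact (measurableSet_eq_fun (measurable_gram_det measurable_id k _) measurable_const).compl

/-- Induction on the set: the new vector is resampled, and fewer than `L` earlier columns lie in
some hyperplane `w^⊥`. A fresh vector can destroy independence only by lying in that hyperplane,
which is null. -/
theorem IsRayleighFading.ae_indepColumns_finset [IsProbabilityMeasure μ]
    (hg : IsRayleighFading μ g) (k : ℕ) (S : Finset (Mobile M)) (hS : S.card ≤ L) :
    ∀ᵐ ω ∂μ, IndepColumns (g ω) k (S : Set (Mobile M)) := by
  classical
  induction S using Finset.induction_on with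
  | empty =>
    refine .of_forall fun ω => ?_
    have : IsEmpty ((∅ : Finset (Mobile M)) : Set (Mobile M)) := by simp
    exact linearIndependent_empty_type
  | insert i S hi ih =>
    rw [Finset.card_insert_of_notMem hi] at hS
    have ih' := ih (by omega)
    set B : Set (Mobile M → ℕ → Fin L → ℂ) := {γ | IndepColumns γ k (S : Set (Mobile M))} ∩
      {γ | IndepColumns γ k ((insert i S : Finset (Mobile M)) : Set (Mobile M))}ᶜ with hB
    have hBm : MeasurableSet B :=
      (measurableSet_indepColumns k S).inter (measurableSet_indepColumns k _).compl
    have h0 : ∫⁻ ω, B.indicator 1 (g ω) ∂μ = 0 := by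
      have h1 := hg.lintegral_resample (T := Unit) (τ := fun _ => ()) measurable_const
        (indepFun_const_left _ _) (F := fun _ γ => B.indicator 1 γ)
        ((measurable_one.indicator hBm).comp measurable_snd) i k
      refine h1.trans ?_
      refine (lintegral_congr fun ω => ?_).trans lintegral_zero
      obtain ⟨w, hw0, hw⟩ := exists_ne_zero_forall_star_dotProduct_eq_zero (γ := g ω) (k := k)
        (S := (S : Set (Mobile M))) (by simpa using hS)
      refine le_antisymm ?_ (zero_le)
      calc ∫⁻ v, B.indicator 1 (resample i k v (g ω)) ∂(stdGaussianVector L)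
          ≤ ∫⁻ v, ({v | star v ⬝ᵥ w = 0} : Set (Fin L → ℂ)).indicator 1 v
              ∂(stdGaussianVector L) := by
            refine lintegral_mono fun v => ?_
            by_cases hv : resample i k v (g ω) ∈ B
            · have hv' : v ∈ {v : Fin L → ℂ | star v ⬝ᵥ w = 0} := by
                obtain ⟨h2, h3⟩ := hv
                have h2' : IndepColumns (g ω) k (S : Set (Mobile M)) :=
                  (indepColumns_resample (by simpa using hi) v).1 h2
                by_contra hne
                refine h3 ?_
                change LinearIndepOn ℂ (fun j => resample i k v (g ω) j k) _
                rw [Finset.coe_insert, linearIndepOn_insert (by simpa using hi)]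
                refine ⟨h2, fun hmem => hne (hw v ?_)⟩
                have himg : (fun j => resample i k v (g ω) j k) '' (S : Set (Mobile M)) =
                    (fun j => g ω j k) '' (S : Set (Mobile M)) := by
                  refine Set.image_congr fun j hj => ?_
                  have : j ≠ i := fun h => hi (by simpa [h] using hj)
                  simp [resample, this]
                rw [himg] at hmem
                simpa [resample] using hmem
              rw [Set.indicator_of_mem hv, Set.indicator_of_mem hv']
              exact le_rfl
            · rw [Set.indicator_of_notMem hv]
              exact zero_le
        _ = 0 := by
            rw [lintegral_indicator_one
              (isClosed_eq (by fun_prop) continuous_const).measurableSet]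
            exact stdGaussianVector_hyperplane hw0
    have h1 : ∀ᵐ ω ∂μ, g ω ∉ B := by
      have h2 := (lintegral_eq_zero_iff ((measurable_one.indicator hBm).comp hg.measurable)).1 h0
      filter_upwards [h2] with ω h hB
      simp [hB] at h
    filter_upwards [h1, ih'] with ω h h'
    by_contra hc
    exact h ⟨h', hc⟩

/-- There are only countably many finite sets of mobiles. One null set therefore serves all of them,
and the statement can be applied to the random sets `𝒟_k`. -/
theorem IsRayleighFading.ae_indepColumns [IsProbabilityMeasure μ] (hg : IsRayleighFading μ g) :
    ∀ᵐ ω ∂μ, ∀ k, ∀ S : Set (Mobile M), S.Finite → S.ncard ≤ L → IndepColumns (g ω) k S := by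
  have h : ∀ᵐ ω ∂μ, ∀ k, ∀ S : Finset (Mobile M), S.card ≤ L →
      IndepColumns (g ω) k (S : Set (Mobile M)) := by
    refine ae_all_iff.2 fun k => ae_all_iff.2 fun S => ?_
    by_cases hS : S.card ≤ L
    · filter_upwards [hg.ae_indepColumns_finset k S hS] with ω h _ using h
    · exact .of_forall fun ω h => absurd h hS
  filter_upwards [h] with ω h k S hS hc
  have := h k hS.toFinset (by rwa [← Set.ncard_eq_toFinset_card S hS])
  rwa [hS.coe_toFinset] at this

/-- A representation of a network: the positions are functions of a random element `τ` that is
independent of the fading, and the powers are functions of `τ` and of the known fading. -/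
structure IsRepresentation {T : Type*} [MeasurableSpace T] (μ : Measure Ω) (D : ℝ)
    (X : Ω → ℕ → Plane) (Y : Ω → Mobile M → Plane) (g : Ω → Mobile M → ℕ → Fin L → ℂ)
    (φ : Ω → Mobile M → ℝ) (τ : Ω → T) (x : T → ℕ → Plane) (y : T → Mobile M → Plane)
    (Ψ : T → (Mobile M → ℕ → Fin L → ℂ) → Mobile M → ℝ) : Prop where
  measurable_tau : Measurable τ
  measurable_x : Measurable x
  measurable_y : Measurable y
  measurable_psi : Measurable (Function.uncurry Ψ)
  indep : IndepFun τ g μ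
  x_tau : ∀ ω, x (τ ω) = X ω
  y_tau : ∀ ω, y (τ ω) = Y ω
  psi_tau : ∀ ω, Ψ (τ ω) (knownFading D (X ω) (Y ω) (g ω)) = φ ω

/-- Doob–Dynkin: `𝓖` joined with the known fading is the σ-algebra generated by a pair, so the
powers factor through that pair. The abstract element `τ` is the identity into `Ω` equipped with
`𝓖`. -/
theorem IsPowerAllocation.exists_representation {Ω : Type*} [mΩ : MeasurableSpace Ω]
    {μ : Measure Ω} {M L : ℕ} {g : Ω → Mobile M → ℕ → Fin L → ℂ} {D P : ℝ}
    {X : Ω → ℕ → Plane} {Y : Ω → Mobile M → Plane} {φ : Ω → Mobile M → ℝ}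
    (h : IsPowerAllocation μ D P X Y g φ) :
    ∃ 𝓖 : MeasurableSpace Ω, ∃ Ψ : Ω → (Mobile M → ℕ → Fin L → ℂ) → Mobile M → ℝ,
      @IsRepresentation Ω mΩ M L Ω 𝓖 μ D X Y g φ id X Y Ψ := by
  obtain ⟨𝓖, hle, hX, hY, hind, hφ⟩ := h.causal
  have hcomap : MeasurableSpace.comap (fun ω => (ω, knownFading D (X ω) (Y ω) (g ω)))
      (𝓖.prod inferInstance) = 𝓖 ⊔ MeasurableSpace.comap
        (fun ω => knownFading D (X ω) (Y ω) (g ω)) inferInstance := by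
    simp only [MeasurableSpace.prod, MeasurableSpace.comap_sup, MeasurableSpace.comap_comp]
    congr 1
    exact MeasurableSpace.comap_id
  rw [← hcomap] at hφ
  obtain ⟨Ψ, hΨ, he⟩ := @Measurable.exists_eq_measurable_comp _ _ _ _ _ _ _ _ _ hφ
  refine ⟨𝓖, fun ω γ => Ψ (ω, γ), ?_⟩
  refine @IsRepresentation.mk Ω mΩ M L Ω 𝓖 μ D X Y g φ id X Y _ ?_ hX hY hΨ ?_
    (fun _ => rfl) (fun _ => rfl) (fun ω => (congrFun he ω).symm)
  · exact measurable_id'' hle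
  · rw [IndepFun_iff_Indep, MeasurableSpace.comap_id]
    exact hind

section Deterministic

variable {α D : ℝ} {x : ℕ → Plane} {y : Mobile M → Plane} {γ : Mobile M → ℕ → Fin L → ℂ}
  {φ : Mobile M → ℝ} {k : ℕ} {i j : Mobile M}

/-- This is where the information pattern enters: a BS that neither nulls nor serves a mobile does
not know its channel, so all powers stay fixed while that channel is averaged. -/
theorem knownFading_resample (hi : i ∉ nearMobiles D x y k) (hk : i.1 ≠ k) (v : Fin L → ℂ) :
    knownFading D x y (resample i k v γ) = knownFading D x y γ := by
  classical
  funext i' k'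
  unfold knownFading resample
  by_cases h : i' = i ∧ k' = k
  · obtain ⟨rfl, rfl⟩ := h
    have : i' ∉ nearMobiles D x y k' ∪ servedMobiles M k' := by
      rintro (h | h)
      · exact hi h
      · exact hk h
    simp [this]
  · simp [h]

theorem nullProjection_congr {γ' : Mobile M → ℕ → Fin L → ℂ} {S : Set (Mobile M)}
    (h : ∀ l ∈ S, γ' l k = γ l k) : nullProjection γ' k S = nullProjection γ k S := by
  have : fadingMatrix γ' k S = fadingMatrix γ k S := by
    ext n l
    simp [fadingMatrix, h l l.2]
  unfold nullProjection
  rw [this]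

theorem nulledFading_congr {γ' : Mobile M → ℕ → Fin L → ℂ} (hj : γ' j j.1 = γ j j.1)
    (h : ∀ l ∈ nearMobiles D x y j.1, γ' l j.1 = γ l j.1) :
    nulledFading D x y γ' j = nulledFading D x y γ j := by
  rw [nulledFading, nulledFading, hj, nullProjection_congr fun l hl => h l hl.1]

/-- A precoder uses only the channels at its own BS, and of these only those of the served mobile
and of the nulled mobiles. -/
theorem precoder_resample (h : j.1 = k → j ≠ i ∧ i ∉ nearMobiles D x y k) (v : Fin L → ℂ) :
    precoder D x y (resample i k v γ) j = precoder D x y γ j := by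
  have : nulledFading D x y (resample i k v γ) j = nulledFading D x y γ j := by
    refine nulledFading_congr ?_ fun l hl => ?_
    · have : ¬ (j = i ∧ j.1 = k) := fun h' => (h h'.2).1 h'.1
      simp [resample, this]
    · have : ¬ (l = i ∧ j.1 = k) := by
        rintro ⟨rfl, rfl⟩
        exact (h rfl).2 hl
      simp [resample, this]
  rw [precoder, precoder, this]

theorem receivedPower_resample_of_ne (h : j.1 ≠ k) (v : Fin L → ℂ) (i' : Mobile M) :
    receivedPower α D x y φ (resample i k v γ) i' j = receivedPower α D x y φ γ i' j := by
  rw [receivedPower_eq, receivedPower_eq, precoder_resample fun h' => absurd h' h]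
  simp [resample, h]

theorem receivedPower_resample (hj : j ≠ i) (hi : i ∉ nearMobiles D x y j.1) (v : Fin L → ℂ) :
    receivedPower α D x y φ (resample i j.1 v γ) i j = activity L D x y j.1 * φ j ^ 2 *
      dist (y i) (x j.1) ^ (-α) * ‖star v ⬝ᵥ precoder D x y γ j‖ ^ 2 := by
  rw [receivedPower_eq, precoder_resample fun _ => ⟨hj, hi⟩]
  simp [resample]

theorem receivedPower_nonneg : 0 ≤ receivedPower α D x y φ γ i j := by
  unfold receivedPower; positivity

theorem activity_nonneg : 0 ≤ activity L D x y k := by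
  unfold activity; split_ifs <;> simp

theorem activity_le_one : activity L D x y k ≤ 1 := by
  unfold activity; split_ifs <;> simp

theorem IsActive.finite_nearMobiles (h : IsActive L D x y k) : (nearMobiles D x y k).Finite := by
  rcases h with h | h
  · exact Set.finite_of_encard_le_coe h.le
  · exact Set.finite_of_encard_le_coe ((Set.encard_le_encard Set.subset_union_left).trans h)

/-- Under the second clause of activity, `j` lies in `𝒟_k ∪ ℳ_k` but has been removed on the left;
this gives the strict inequality. It leaves one degree of freedom for serving `j`. -/
theorem IsActive.ncard_lt (h : IsActive L D x y j.1) : (nearMobiles D x y j.1 \ {j}).ncard < L := by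
  have hfin := h.finite_nearMobiles
  have hfin' : (nearMobiles D x y j.1 \ {j}).Finite := hfin.subset Set.sdiff_subset
  rw [← Nat.cast_lt (α := ℕ∞), hfin'.cast_ncard_eq]
  rcases h with h | h
  · exact (Set.encard_le_encard Set.sdiff_subset).trans_lt h
  · refine lt_of_lt_of_le ?_ h
    refine hfin'.encard_lt_encard ⟨Set.sdiff_subset.trans Set.subset_union_left, fun hs => ?_⟩
    exact (hs (Or.inr rfl : j ∈ nearMobiles D x y j.1 ∪ servedMobiles M j.1)).2 rfl

theorem IsActive.indepColumns (h : IsActive L D x y j.1)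
    (hγ : ∀ k, ∀ S : Set (Mobile M), S.Finite → S.ncard ≤ L → IndepColumns γ k S) :
    IndepColumns γ j.1 (insert j (nearMobiles D x y j.1 \ {j})) := by
  have hfin' : (nearMobiles D x y j.1 \ {j}).Finite := h.finite_nearMobiles.subset Set.sdiff_subset
  refine hγ _ _ (hfin'.insert _) ?_
  exact (Set.ncard_insert_le _ _).trans h.ncard_lt

theorem IsActive.nulledFading_ne_zero (h : IsActive L D x y j.1)
    (hγ : ∀ k, ∀ S : Set (Mobile M), S.Finite → S.ncard ≤ L → IndepColumns γ k S) :
    nulledFading D x y γ j ≠ 0 :=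
  nullProjection_mulVec_ne_zero (h.finite_nearMobiles.subset Set.sdiff_subset) (by simp)
    (h.indepColumns hγ)

/-- A mobile in the zero-forcing region of a BS receives no interference from it. -/
theorem receivedPower_eq_zero (hi : i ∈ nearMobiles D x y j.1) (hij : i ≠ j)
    (hγ : ∀ k, ∀ S : Set (Mobile M), S.Finite → S.ncard ≤ L → IndepColumns γ k S) :
    receivedPower α D x y φ γ i j = 0 := by
  rw [receivedPower_eq]
  by_cases h : IsActive L D x y j.1
  · rw [star_dotProduct_precoder_eq_zero (h.finite_nearMobiles.subset Set.sdiff_subset)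
      ((h.indepColumns hγ).mono (Set.subset_insert _ _)) ⟨hi, hij⟩]
    simp
  · simp [activity, h]

/-- With the precoder fixed as a unit vector, the mean gain over the fresh channel is `1`. For an
inactive BS both sides vanish. -/
theorem lintegral_receivedPower_resample (hj : j ≠ i) (hi : i ∉ nearMobiles D x y j.1)
    (hγ : ∀ k, ∀ S : Set (Mobile M), S.Finite → S.ncard ≤ L → IndepColumns γ k S) :
    ∫⁻ v, ENNReal.ofReal (receivedPower α D x y φ (resample i j.1 v γ) i j)
      ∂(stdGaussianVector L) =
      ENNReal.ofReal (activity L D x y j.1 * φ j ^ 2 * dist (y i) (x j.1) ^ (-α)) := by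
  simp_rw [receivedPower_resample hj hi]
  by_cases h : IsActive L D x y j.1
  · have h1 : 0 ≤ activity L D x y j.1 * φ j ^ 2 * dist (y i) (x j.1) ^ (-α) :=
      mul_nonneg (mul_nonneg activity_nonneg (sq_nonneg _)) (Real.rpow_nonneg dist_nonneg _)
    simp_rw [ENNReal.ofReal_mul h1]
    rw [lintegral_const_mul' _ _ ENNReal.ofReal_ne_top, lintegral_norm_star_dotProduct_sq,
      sum_norm_sq_precoder (h.nulledFading_ne_zero hγ)]
    simp
  · simp [activity, h]

end Deterministic

end IndependentColumns

/-! ### Averaging the interference over channels unknown to the BSs. -/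

section Interference

set_option linter.unusedSectionVars false

variable {M L : ℕ} [NeZero M]

open Classical in
/-- The indicator of the event that the typical mobile is outside the zero-forcing region of
BS `k`. -/
noncomputable def farIndicator (D : ℝ) (x : ℕ → Plane) (y : Mobile M → Plane) (k : ℕ) : ℝ≥0∞ :=
  if ((0, 0) : Mobile M) ∈ nearMobiles D x y k then 0 else 1

/-- The power that the typical mobile receives from BS `k`. -/
noncomputable def bsInterference (α D : ℝ) (x : ℕ → Plane) (y : Mobile M → Plane)
    (φ : Mobile M → ℝ) (γ : Mobile M → ℕ → Fin L → ℂ) (k : ℕ) : ℝ≥0∞ :=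
  ∑ m : Fin M, ENNReal.ofReal (receivedPower α D x y φ γ (0, 0) (k, m))

/-- The mean of `bsInterference` over the fading. -/
noncomputable def bsMeanInterference (L : ℕ) (α D : ℝ) (x : ℕ → Plane) (y : Mobile M → Plane)
    (φ : Mobile M → ℝ) (k : ℕ) : ℝ≥0∞ :=
  ENNReal.ofReal (activity L D x y k * bsPower φ k * dist (y (0, 0)) (x k) ^ (-α))

theorem bsMeanInterference_eq_sum (α D : ℝ) (x : ℕ → Plane) (y : Mobile M → Plane)
    (φ : Mobile M → ℝ) (k : ℕ) :
    bsMeanInterference L α D x y φ k = ∑ m : Fin M, ENNReal.ofReal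
      (activity L D x y k * φ (k, m) ^ 2 * dist (y (0, 0)) (x k) ^ (-α)) := by
  rw [bsMeanInterference, bsPower, Finset.mul_sum, Finset.sum_mul, ENNReal.ofReal_sum_of_nonneg]
  exact fun m _ => mul_nonneg (mul_nonneg activity_nonneg (sq_nonneg _))
    (Real.rpow_nonneg dist_nonneg _)

section

variable {A : Type*} [MeasurableSpace A] {x : A → ℕ → Plane} {y : A → Mobile M → Plane}
  {γ : A → Mobile M → ℕ → Fin L → ℂ} {φ : A → Mobile M → ℝ} {α D : ℝ}

theorem measurable_farIndicator (hx : Measurable x) (hy : Measurable y) (k : ℕ) :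
    Measurable fun a => farIndicator D (x a) (y a) k := by
  classical
  unfold farIndicator
  exact Measurable.ite (measurableSet_mem_nearMobiles hx hy _ k) measurable_const measurable_const

theorem measurable_bsInterference (hx : Measurable x) (hy : Measurable y) (hφ : Measurable φ)
    (hγ : Measurable γ) (k : ℕ) :
    Measurable fun a => bsInterference α D (x a) (y a) (φ a) (γ a) k :=
  Finset.measurable_fun_sum _ fun m _ =>
    (measurable_receivedPower α hx hy hφ hγ (0, 0) (k, m)).ennreal_ofReal

theorem measurable_bsPower (hφ : Measurable φ) (k : ℕ) : Measurable fun a => bsPower (φ a) k :=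
  Finset.measurable_fun_sum _ fun m _ => (measurable_pi_iff.1 hφ (k, m)).pow_const 2

theorem measurable_bsMeanInterference (hx : Measurable x) (hy : Measurable y) (hφ : Measurable φ)
    (k : ℕ) : Measurable fun a => bsMeanInterference L α D (x a) (y a) (φ a) k :=
  (((measurable_activity hx hy k).mul (measurable_bsPower hφ k)).mul
    ((measurable_dist_mobile hx hy _ k).pow_const _)).ennreal_ofReal

end

variable {Ω T : Type*} [MeasurableSpace Ω] [MeasurableSpace T] {μ : Measure Ω}
  [IsProbabilityMeasure μ] {α D P : ℝ} {X : Ω → ℕ → Plane} {Y : Ω → Mobile M → Plane}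
  {g : Ω → Mobile M → ℕ → Fin L → ℂ} {φ : Ω → Mobile M → ℝ} {τ : Ω → T} {x : T → ℕ → Plane}
  {y : T → Mobile M → Plane} {Ψ : T → (Mobile M → ℕ → Fin L → ℂ) → Mobile M → ℝ}

theorem IsRepresentation.measurable_power (h : IsRepresentation μ D X Y g φ τ x y Ψ) :
    Measurable fun p : T × (Mobile M → ℕ → Fin L → ℂ) =>
      Ψ p.1 (knownFading D (x p.1) (y p.1) p.2) :=
  h.measurable_psi.comp (measurable_fst.prodMk (measurable_knownFading
    (h.measurable_x.comp measurable_fst) (h.measurable_y.comp measurable_fst) measurable_snd))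

theorem IsRepresentation.measurable_X (h : IsRepresentation μ D X Y g φ τ x y Ψ) :
    Measurable X := by
  have := h.measurable_x.comp h.measurable_tau
  rwa [show x ∘ τ = X from funext h.x_tau] at this

theorem IsRepresentation.measurable_Y (h : IsRepresentation μ D X Y g φ τ x y Ψ) :
    Measurable Y := by
  have := h.measurable_y.comp h.measurable_tau
  rwa [show y ∘ τ = Y from funext h.y_tau] at this

theorem IsRepresentation.measurable_phi (h : IsRepresentation μ D X Y g φ τ x y Ψ)
    (hg : IsRayleighFading μ g) : Measurable φ := by
  have := h.measurable_power.comp (h.measurable_tau.prodMk hg.measurable)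
  convert this using 1
  funext ω
  simp [h.x_tau, h.y_tau, h.psi_tau]

/-- On the far event the weight, the powers and the precoder ignore the channel to the typical
mobile, which can thus be averaged out; the far indicator removes the other event. BS `0` is
excluded because it serves the typical mobile and so knows that channel. The weight `C` permits
iterating over several BSs. -/
theorem IsRepresentation.lintegral_far_mul_receivedPower
    (h : IsRepresentation μ D X Y g φ τ x y Ψ) (hg : IsRayleighFading μ g)
    {C : T → (Mobile M → ℕ → Fin L → ℂ) → ℝ≥0∞} (hC : Measurable (Function.uncurry C))
    {j : Mobile M} (hj : j.1 ≠ 0)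
    (hCinv : ∀ t γ v, ((0, 0) : Mobile M) ∉ nearMobiles D (x t) (y t) j.1 →
      C t (resample (0, 0) j.1 v γ) = C t γ) :
    ∫⁻ ω, farIndicator D (X ω) (Y ω) j.1 * (C (τ ω) (g ω) *
        ENNReal.ofReal (receivedPower α D (X ω) (Y ω) (φ ω) (g ω) (0, 0) j)) ∂μ =
      ∫⁻ ω, farIndicator D (X ω) (Y ω) j.1 * (C (τ ω) (g ω) *
        ENNReal.ofReal (activity L D (X ω) (Y ω) j.1 * φ ω j ^ 2 *
          dist (Y ω (0, 0)) (X ω j.1) ^ (-α))) ∂μ := by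
  set F : T → (Mobile M → ℕ → Fin L → ℂ) → ℝ≥0∞ := fun t γ => farIndicator D (x t) (y t) j.1 *
    (C t γ * ENNReal.ofReal (receivedPower α D (x t) (y t)
      (Ψ t (knownFading D (x t) (y t) γ)) γ (0, 0) j)) with hF
  have hx : Measurable fun p : T × (Mobile M → ℕ → Fin L → ℂ) => x p.1 :=
    h.measurable_x.comp measurable_fst
  have hy : Measurable fun p : T × (Mobile M → ℕ → Fin L → ℂ) => y p.1 :=
    h.measurable_y.comp measurable_fst
  have hFm : Measurable (Function.uncurry F) :=
    (measurable_farIndicator hx hy j.1).mul (hC.mul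
      (measurable_receivedPower α hx hy h.measurable_power measurable_snd _ j).ennreal_ofReal)
  have h1 := hg.lintegral_resample h.measurable_tau h.indep hFm (0, 0) j.1
  simp only [hF, h.x_tau, h.y_tau, h.psi_tau] at h1
  rw [h1]
  refine lintegral_congr_ae ?_
  filter_upwards [hg.ae_indepColumns] with ω hω
  by_cases hnear : ((0, 0) : Mobile M) ∈ nearMobiles D (X ω) (Y ω) j.1
  · simp [farIndicator, hnear]
  · have hj0 : j ≠ (0, 0) := fun h => hj (by rw [h])
    have hCi : ∀ v, C (τ ω) (resample (0, 0) j.1 v (g ω)) = C (τ ω) (g ω) := fun v =>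
      hCinv _ _ _ (by rw [h.x_tau, h.y_tau]; exact hnear)
    have hk : ∀ v, knownFading D (X ω) (Y ω) (resample (0, 0) j.1 v (g ω)) =
        knownFading D (X ω) (Y ω) (g ω) := fun v => knownFading_resample hnear hj.symm v
    simp only [hCi, hk, h.psi_tau, ← mul_assoc]
    rw [lintegral_const_mul, lintegral_receivedPower_resample hj0 hnear hω]
    exact (measurable_receivedPower α measurable_const measurable_const measurable_const
      ((measurable_resample (0, 0) j.1).comp (measurable_id.prodMk measurable_const)) _ j
      ).ennreal_ofReal

theorem IsRepresentation.lintegral_far_mul_bsInterference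
    (h : IsRepresentation μ D X Y g φ τ x y Ψ) (hg : IsRayleighFading μ g)
    {C : T → (Mobile M → ℕ → Fin L → ℂ) → ℝ≥0∞} (hC : Measurable (Function.uncurry C))
    {k : ℕ} (hk : k ≠ 0)
    (hCinv : ∀ t γ v, ((0, 0) : Mobile M) ∉ nearMobiles D (x t) (y t) k →
      C t (resample (0, 0) k v γ) = C t γ) :
    ∫⁻ ω, farIndicator D (X ω) (Y ω) k * (C (τ ω) (g ω) *
        bsInterference α D (X ω) (Y ω) (φ ω) (g ω) k) ∂μ =
      ∫⁻ ω, farIndicator D (X ω) (Y ω) k * (C (τ ω) (g ω) *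
        bsMeanInterference L α D (X ω) (Y ω) (φ ω) k) ∂μ := by
  have hx := h.measurable_X
  have hy := h.measurable_Y
  have hφ := h.measurable_phi hg
  have hCm : Measurable fun ω => C (τ ω) (g ω) := hC.comp (h.measurable_tau.prodMk hg.measurable)
  simp_rw [bsMeanInterference_eq_sum, bsInterference, Finset.mul_sum]
  have hm1 : ∀ m, Measurable fun ω => farIndicator D (X ω) (Y ω) k * (C (τ ω) (g ω) *
      ENNReal.ofReal (receivedPower α D (X ω) (Y ω) (φ ω) (g ω) (0, 0) (k, m))) := fun m =>
    (measurable_farIndicator hx hy k).mul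
      (hCm.mul (measurable_receivedPower α hx hy hφ hg.measurable _ _).ennreal_ofReal)
  have hm2 : ∀ m, Measurable fun ω => farIndicator D (X ω) (Y ω) k * (C (τ ω) (g ω) *
      ENNReal.ofReal (activity L D (X ω) (Y ω) k * φ ω (k, m) ^ 2 *
        dist (Y ω (0, 0)) (X ω k) ^ (-α))) := fun m =>
    (measurable_farIndicator hx hy k).mul
      (hCm.mul (((measurable_activity hx hy k).mul
        ((measurable_pi_iff.1 hφ (k, m)).pow_const 2)).mul
        ((measurable_dist_mobile hx hy _ k).pow_const _)).ennreal_ofReal)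
  rw [lintegral_finsetSum _ fun m _ => hm1 m, lintegral_finsetSum _ fun m _ => hm2 m]
  exact Finset.sum_congr rfl fun m _ =>
    h.lintegral_far_mul_receivedPower hg hC (j := (k, m)) hk hCinv

theorem IsRepresentation.lintegral_bsInterference
    (h : IsRepresentation μ D X Y g φ τ x y Ψ) (hg : IsRayleighFading μ g)
    {k : ℕ} (hk : k ≠ 0) :
    ∫⁻ ω, farIndicator D (X ω) (Y ω) k * bsInterference α D (X ω) (Y ω) (φ ω) (g ω) k ∂μ =
      ∫⁻ ω, farIndicator D (X ω) (Y ω) k * bsMeanInterference L α D (X ω) (Y ω) (φ ω) k ∂μ := by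
  simpa using h.lintegral_far_mul_bsInterference (α := α) hg (C := fun _ _ => 1)
    measurable_const hk (fun _ _ _ _ => rfl)

/-- The interference powers of two distinct BSs are uncorrelated given everything that is known
to the BSs. -/
theorem IsRepresentation.lintegral_bsInterference_mul
    (h : IsRepresentation μ D X Y g φ τ x y Ψ) (hg : IsRayleighFading μ g)
    {k l : ℕ} (hk : k ≠ 0) (hl : l ≠ 0) (hkl : k ≠ l) :
    ∫⁻ ω, (farIndicator D (X ω) (Y ω) k * bsInterference α D (X ω) (Y ω) (φ ω) (g ω) k) *
        (farIndicator D (X ω) (Y ω) l * bsInterference α D (X ω) (Y ω) (φ ω) (g ω) l) ∂μ =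
      ∫⁻ ω, (farIndicator D (X ω) (Y ω) k * bsMeanInterference L α D (X ω) (Y ω) (φ ω) k) *
        (farIndicator D (X ω) (Y ω) l * bsMeanInterference L α D (X ω) (Y ω) (φ ω) l) ∂μ := by
  have hx : Measurable fun p : T × (Mobile M → ℕ → Fin L → ℂ) => x p.1 :=
    h.measurable_x.comp measurable_fst
  have hy : Measurable fun p : T × (Mobile M → ℕ → Fin L → ℂ) => y p.1 :=
    h.measurable_y.comp measurable_fst
  -- The channel of BS `k` is averaged first, with the interference from BS `l` as weight; then that
  -- of BS `l`, with the mean interference from BS `k` as weight.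
  have h1 := h.lintegral_far_mul_bsInterference (α := α) hg (k := k) (C := fun t γ =>
    farIndicator D (x t) (y t) l * bsInterference α D (x t) (y t)
      (Ψ t (knownFading D (x t) (y t) γ)) γ l)
    ((measurable_farIndicator hx hy l).mul
      (measurable_bsInterference hx hy h.measurable_power measurable_snd l)) hk (by
      intro t γ v hnear
      rw [knownFading_resample hnear hk.symm v]
      unfold bsInterference
      congr 1
      exact Finset.sum_congr rfl fun m _ => by
        rw [receivedPower_resample_of_ne (j := (l, m)) (Ne.symm hkl)])
  have h2 := h.lintegral_far_mul_bsInterference (α := α) hg (k := l) (C := fun t γ =>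
    farIndicator D (x t) (y t) k * bsMeanInterference L α D (x t) (y t)
      (Ψ t (knownFading D (x t) (y t) γ)) k)
    ((measurable_farIndicator hx hy k).mul
      (measurable_bsMeanInterference hx hy h.measurable_power k)) hl (by
      intro t γ v hnear
      rw [knownFading_resample hnear hl.symm v])
  simp only [h.x_tau, h.y_tau, h.psi_tau] at h1 h2
  calc _ = _ := lintegral_congr fun ω => by ring
    _ = _ := h1
    _ = _ := lintegral_congr fun ω => by ring
    _ = _ := h2
    _ = _ := lintegral_congr fun ω => by ring

/-- Expectation of a quantity that is at most a multiple, determined by the positions, of the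
squared (or fourth power) gain of a channel unknown to the BS. -/
theorem IsRepresentation.lintegral_gain
    (h : IsRepresentation μ D X Y g φ τ x y Ψ) (hg : IsRayleighFading μ g) {j : Mobile M}
    (hj : j ≠ (0, 0)) {c : T → ℝ≥0∞} (hc : Measurable c)
    {q : ℕ} {B : ℝ≥0∞} (hq : ∀ w : Fin L → ℂ, ∑ n, ‖w n‖ ^ 2 ≤ 1 →
      ∫⁻ v, ENNReal.ofReal (‖star v ⬝ᵥ w‖ ^ q) ∂(stdGaussianVector L) ≤ B) :
    ∫⁻ ω, farIndicator D (X ω) (Y ω) j.1 * (c (τ ω) *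
        ENNReal.ofReal (‖star (g ω (0, 0) j.1) ⬝ᵥ precoder D (X ω) (Y ω) (g ω) j‖ ^ q)) ∂μ ≤
      (∫⁻ ω, farIndicator D (X ω) (Y ω) j.1 * c (τ ω) ∂μ) * B := by
  have hx : Measurable fun p : T × (Mobile M → ℕ → Fin L → ℂ) => x p.1 :=
    h.measurable_x.comp measurable_fst
  have hy : Measurable fun p : T × (Mobile M → ℕ → Fin L → ℂ) => y p.1 :=
    h.measurable_y.comp measurable_fst
  set F : T → (Mobile M → ℕ → Fin L → ℂ) → ℝ≥0∞ := fun t γ => farIndicator D (x t) (y t) j.1 *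
    (c t * ENNReal.ofReal (‖star (γ (0, 0) j.1) ⬝ᵥ precoder D (x t) (y t) γ j‖ ^ q)) with hF
  have hFm : Measurable (Function.uncurry F) := by
    refine (measurable_farIndicator hx hy j.1).mul ((hc.comp measurable_fst).mul
      (Measurable.ennreal_ofReal (Measurable.pow_const (.norm ?_) q)))
    simp only [dotProduct, Pi.star_apply]
    refine Finset.measurable_fun_sum _ fun n _ => Measurable.mul ?_ ?_
    · exact Complex.continuous_conj.measurable.comp (measurable_pi_iff.1 (measurable_pi_iff.1
        (measurable_pi_iff.1 measurable_snd (0, 0)) j.1) n)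
    · exact measurable_pi_iff.1 (measurable_precoder hx hy measurable_snd j) n
  have h1 := hg.lintegral_resample h.measurable_tau h.indep hFm (0, 0) j.1
  simp only [hF, h.x_tau, h.y_tau] at h1
  have hcm : Measurable fun ω => farIndicator D (X ω) (Y ω) j.1 * c (τ ω) :=
    (measurable_farIndicator h.measurable_X h.measurable_Y j.1).mul (hc.comp h.measurable_tau)
  rw [h1, ← lintegral_mul_const _ hcm]
  refine lintegral_mono fun ω => ?_
  by_cases hnear : ((0, 0) : Mobile M) ∈ nearMobiles D (X ω) (Y ω) j.1
  · simp [farIndicator, hnear]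
  · have hp : ∀ v, precoder D (X ω) (Y ω) (resample (0, 0) j.1 v (g ω)) j =
        precoder D (X ω) (Y ω) (g ω) j := fun v => precoder_resample (fun _ => ⟨hj, hnear⟩) v
    have hr : ∀ v, resample (0, 0) j.1 v (g ω) (0, 0) j.1 = v := fun v => by simp [resample]
    simp only [hp, hr, ← mul_assoc]
    have hm : Measurable fun v : Fin L → ℂ =>
        ENNReal.ofReal (‖star v ⬝ᵥ precoder D (X ω) (Y ω) (g ω) j‖ ^ q) :=
      (by fun_prop : Continuous fun v : Fin L → ℂ =>
        ‖star v ⬝ᵥ precoder D (X ω) (Y ω) (g ω) j‖ ^ q).measurable.ennreal_ofReal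
    rw [lintegral_const_mul _ hm]
    gcongr
    exact hq _ sum_norm_sq_precoder_le

theorem lintegral_gain_sq_le (w : Fin L → ℂ) (hw : ∑ n, ‖w n‖ ^ 2 ≤ 1) :
    ∫⁻ v, ENNReal.ofReal (‖star v ⬝ᵥ w‖ ^ 2) ∂(stdGaussianVector L) ≤ 1 := by
  rw [lintegral_norm_star_dotProduct_sq]
  simpa using hw

theorem lintegral_gain_pow_four_le (w : Fin L → ℂ) (hw : ∑ n, ‖w n‖ ^ 2 ≤ 1) :
    ∫⁻ v, ENNReal.ofReal (‖star v ⬝ᵥ w‖ ^ 4) ∂(stdGaussianVector L) ≤ 2 := by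
  rw [lintegral_norm_star_dotProduct_pow_four, ← ENNReal.ofReal_ofNat 2]
  refine ENNReal.ofReal_le_ofReal ?_
  have h0 : 0 ≤ ∑ n, ‖w n‖ ^ 2 := by positivity
  nlinarith

theorem sq_le_of_bsPower_le {φ : Mobile M → ℝ} {k : ℕ} (h : bsPower φ k ≤ P) (m : Fin M) :
    φ (k, m) ^ 2 ≤ P :=
  (Finset.single_le_sum (f := fun m => φ (k, m) ^ 2) (fun _ _ => sq_nonneg _)
    (Finset.mem_univ m)).trans h

/-- Cauchy–Schwarz over the `M` mobiles of the BS gives one factor `M`, summing the resulting bounds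
a second, and the fourth moment of the gain the `2`. All powers are first replaced by `P`. -/
theorem IsRepresentation.lintegral_bsInterference_sq_le
    (h : IsRepresentation μ D X Y g φ τ x y Ψ) (hg : IsRayleighFading μ g)
    (hP : ∀ᵐ ω ∂μ, ∀ k, bsPower (φ ω) k ≤ P) {k : ℕ} (hk : k ≠ 0) :
    ∫⁻ ω, (farIndicator D (X ω) (Y ω) k *
        bsInterference α D (X ω) (Y ω) (φ ω) (g ω) k) ^ 2 ∂μ ≤
      (∫⁻ ω, farIndicator D (X ω) (Y ω) k * ENNReal.ofReal
        (P ^ 2 * (dist (Y ω (0, 0)) (X ω k) ^ (-α)) ^ 2) ∂μ) * (M * (M * 2)) := by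
  have hfar : ∀ ω, farIndicator D (X ω) (Y ω) k ^ 2 = farIndicator D (X ω) (Y ω) k := fun ω => by
    unfold farIndicator; split_ifs <;> simp
  have hP0 : ∀ᵐ ω ∂μ, 0 ≤ P := by
    filter_upwards [hP] with ω hω
    exact (sq_nonneg _).trans (sq_le_of_bsPower_le (hω k) 0)
  have hle : ∀ᵐ ω ∂μ, (farIndicator D (X ω) (Y ω) k *
      bsInterference α D (X ω) (Y ω) (φ ω) (g ω) k) ^ 2 ≤ ∑ m : Fin M, M *
        (farIndicator D (X ω) (Y ω) k * (ENNReal.ofReal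
          (P ^ 2 * (dist (Y ω (0, 0)) (X ω k) ^ (-α)) ^ 2) * ENNReal.ofReal
          (‖star (g ω (0, 0) k) ⬝ᵥ precoder D (X ω) (Y ω) (g ω) (k, m)‖ ^ 4))) := by
    filter_upwards [hP, hP0] with ω hω hPpos
    rw [mul_pow, hfar, ← Finset.mul_sum, ← Finset.mul_sum, mul_left_comm]
    gcongr
    unfold bsInterference
    have hcs : (∑ m : Fin M, ENNReal.ofReal (receivedPower α D (X ω) (Y ω) (φ ω) (g ω) (0, 0)
        (k, m))) ^ 2 ≤ M * ∑ m : Fin M, ENNReal.ofReal (receivedPower α D (X ω) (Y ω) (φ ω) (g ω)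
          (0, 0) (k, m) ^ 2) := by
      rw [← ENNReal.ofReal_sum_of_nonneg fun _ _ => receivedPower_nonneg,
        ← ENNReal.ofReal_sum_of_nonneg fun _ _ => by positivity,
        ← ENNReal.ofReal_pow (Finset.sum_nonneg fun _ _ => receivedPower_nonneg),
        ← ENNReal.ofReal_natCast, ← ENNReal.ofReal_mul (by positivity)]
      refine ENNReal.ofReal_le_ofReal ?_
      have := sq_sum_le_card_mul_sum_sq (s := (Finset.univ : Finset (Fin M)))
        (f := fun m => receivedPower α D (X ω) (Y ω) (φ ω) (g ω) (0, 0) (k, m))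
      simpa using this
    refine hcs.trans ?_
    gcongr with m
    rw [← ENNReal.ofReal_mul (by positivity)]
    refine ENNReal.ofReal_le_ofReal ?_
    rw [receivedPower_eq]
    have h1 := activity_le_one (L := L) (D := D) (x := X ω) (y := Y ω) (k := k)
    have h0 := activity_nonneg (L := L) (D := D) (x := X ω) (y := Y ω) (k := k)
    have h2 := sq_le_of_bsPower_le (hω k) m
    have h3 : activity L D (X ω) (Y ω) k * φ ω (k, m) ^ 2 ≤ 1 * P :=
      mul_le_mul h1 h2 (sq_nonneg _) zero_le_one
    have h4 : (activity L D (X ω) (Y ω) k * φ ω (k, m) ^ 2) ^ 2 ≤ P ^ 2 := by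
      rw [one_mul] at h3
      exact pow_le_pow_left₀ (mul_nonneg h0 (sq_nonneg _)) h3 2
    simp only
    rw [mul_pow, mul_pow, ← pow_mul]
    gcongr
  refine (lintegral_mono_ae hle).trans ?_
  have hc : Measurable fun t => ENNReal.ofReal (P ^ 2 * (dist (y t (0, 0)) (x t k) ^ (-α)) ^ 2) :=
    ((((measurable_dist_mobile h.measurable_x h.measurable_y _ k).pow_const _).pow_const 2
      ).const_mul _).ennreal_ofReal
  have hm : ∀ m : Fin M, Measurable fun ω => (M : ℝ≥0∞) *
        (farIndicator D (X ω) (Y ω) k * (ENNReal.ofReal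
          (P ^ 2 * (dist (Y ω (0, 0)) (X ω k) ^ (-α)) ^ 2) * ENNReal.ofReal
          (‖star (g ω (0, 0) k) ⬝ᵥ precoder D (X ω) (Y ω) (g ω) (k, m)‖ ^ 4))) := by
    intro m
    refine ((measurable_farIndicator h.measurable_X h.measurable_Y k).mul (Measurable.mul
      ?_ (Measurable.ennreal_ofReal (Measurable.pow_const (.norm ?_) 4)))).const_mul _
    · exact ((((measurable_dist_mobile h.measurable_X h.measurable_Y _ k).pow_const _).pow_const 2
        ).const_mul _).ennreal_ofReal
    · simp only [dotProduct, Pi.star_apply]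
      refine Finset.measurable_fun_sum _ fun n _ => Measurable.mul ?_ ?_
      · exact Complex.continuous_conj.measurable.comp (measurable_pi_iff.1 (measurable_pi_iff.1
          (measurable_pi_iff.1 hg.measurable (0, 0)) k) n)
      · exact measurable_pi_iff.1
          (measurable_precoder h.measurable_X h.measurable_Y hg.measurable (k, m)) n
  rw [lintegral_finsetSum _ fun m _ => hm m]
  calc _ ≤ ∑ _m : Fin M, M * ((∫⁻ ω, farIndicator D (X ω) (Y ω) k * ENNReal.ofReal
        (P ^ 2 * (dist (Y ω (0, 0)) (X ω k) ^ (-α)) ^ 2) ∂μ) * 2) := by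
        refine Finset.sum_le_sum fun m _ => ?_
        rw [lintegral_const_mul' _ _ (by simp)]
        gcongr
        have := h.lintegral_gain hg (j := (k, m)) (fun h => hk (by simpa using congrArg Prod.fst h))
          hc (q := 4) lintegral_gain_pow_four_le
        simpa only [h.x_tau, h.y_tau] using this
    _ = _ := by simp; ring

/-- The power received by the typical mobile from its own BS `0` that is intended for the other
mobiles of this BS. -/
noncomputable def ownInterference (α D : ℝ) (x : ℕ → Plane) (y : Mobile M → Plane)
    (φ : Mobile M → ℝ) (γ : Mobile M → ℕ → Fin L → ℂ) : ℝ≥0∞ :=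
  ∑ m ∈ (Finset.univ.erase 0 : Finset (Fin M)),
    ENNReal.ofReal (receivedPower α D x y φ γ (0, 0) (0, m))

/-- BS `0` knows the channel of the typical mobile, and its powers may depend on it. They are
therefore bounded by `P` before averaging; the precoders of its other mobiles do ignore this channel
on the far event, where moreover `r₀₀ ≥ D`. -/
theorem IsRepresentation.lintegral_ownInterference_le
    (h : IsRepresentation μ D X Y g φ τ x y Ψ) (hg : IsRayleighFading μ g)
    (hP : ∀ᵐ ω ∂μ, ∀ k, bsPower (φ ω) k ≤ P) (hD : 0 < D) (hα : 0 < α) :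
    ∫⁻ ω, farIndicator D (X ω) (Y ω) 0 *
        ownInterference α D (X ω) (Y ω) (φ ω) (g ω) ∂μ ≤ M * ENNReal.ofReal (P * D ^ (-α)) := by
  have hle : ∀ᵐ ω ∂μ, farIndicator D (X ω) (Y ω) 0 *
        ownInterference α D (X ω) (Y ω) (φ ω) (g ω) ≤
      ∑ m ∈ (Finset.univ.erase 0 : Finset (Fin M)), farIndicator D (X ω) (Y ω) 0 *
        (ENNReal.ofReal (P * D ^ (-α)) * ENNReal.ofReal
          (‖star (g ω (0, 0) 0) ⬝ᵥ precoder D (X ω) (Y ω) (g ω) (0, m)‖ ^ 2)) := by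
    filter_upwards [hP] with ω hω
    have hP0 : 0 ≤ P := (sq_nonneg _).trans (sq_le_of_bsPower_le (hω 0) 0)
    rw [ownInterference, Finset.mul_sum]
    by_cases hnear : ((0, 0) : Mobile M) ∈ nearMobiles D (X ω) (Y ω) 0
    · simp [farIndicator, hnear]
    gcongr with m
    rw [← ENNReal.ofReal_mul (by positivity)]
    refine ENNReal.ofReal_le_ofReal ?_
    rw [receivedPower_eq]
    have h1 := activity_le_one (L := L) (D := D) (x := X ω) (y := Y ω) (k := 0)
    have h0 := activity_nonneg (L := L) (D := D) (x := X ω) (y := Y ω) (k := 0)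
    have h2 := sq_le_of_bsPower_le (hω 0) m
    have h3 : activity L D (X ω) (Y ω) 0 * φ ω (0, m) ^ 2 ≤ 1 * P :=
      mul_le_mul h1 h2 (sq_nonneg _) zero_le_one
    rw [one_mul] at h3
    have h5 : D ≤ dist (Y ω (0, 0)) (X ω 0) := not_lt.1 hnear
    have h6 : dist (Y ω (0, 0)) (X ω 0) ^ (-α) ≤ D ^ (-α) :=
      Real.rpow_le_rpow_of_nonpos hD h5 (by linarith)
    have h7 := Real.rpow_nonneg (dist_nonneg (x := Y ω (0, 0)) (y := X ω 0)) (-α)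
    simp only
    gcongr
  refine (lintegral_mono_ae hle).trans ?_
  have hm : ∀ m : Fin M, Measurable fun ω => farIndicator D (X ω) (Y ω) 0 *
        (ENNReal.ofReal (P * D ^ (-α)) * ENNReal.ofReal
          (‖star (g ω (0, 0) 0) ⬝ᵥ precoder D (X ω) (Y ω) (g ω) (0, m)‖ ^ 2)) := by
    intro m
    refine ((measurable_farIndicator h.measurable_X h.measurable_Y 0).mul (Measurable.mul
      measurable_const (Measurable.ennreal_ofReal (Measurable.pow_const (.norm ?_) 2))))
    simp only [dotProduct, Pi.star_apply]
    refine Finset.measurable_fun_sum _ fun n _ => Measurable.mul ?_ ?_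
    · exact Complex.continuous_conj.measurable.comp (measurable_pi_iff.1 (measurable_pi_iff.1
        (measurable_pi_iff.1 hg.measurable (0, 0)) 0) n)
    · exact measurable_pi_iff.1
        (measurable_precoder h.measurable_X h.measurable_Y hg.measurable (0, m)) n
  rw [lintegral_finsetSum _ fun m _ => hm m]
  calc _ ≤ ∑ _m ∈ (Finset.univ.erase 0 : Finset (Fin M)), ENNReal.ofReal (P * D ^ (-α)) := by
        refine Finset.sum_le_sum fun m hm => ?_
        have h1 := h.lintegral_gain hg (j := (0, m))
          (fun h => (Finset.ne_of_mem_erase hm) (by simpa using congrArg Prod.snd h))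
          (c := fun _ => ENNReal.ofReal (P * D ^ (-α))) measurable_const (q := 2)
          lintegral_gain_sq_le
        refine h1.trans ?_
        rw [mul_one]
        calc _ ≤ ∫⁻ _ω, ENNReal.ofReal (P * D ^ (-α)) ∂μ := lintegral_mono fun ω => by
                unfold farIndicator; split_ifs <;> simp
          _ = _ := by simp
    _ ≤ _ := by
        rw [Finset.sum_const, nsmul_eq_mul]
        gcongr
        exact_mod_cast (Finset.card_le_card (Finset.erase_subset _ _)).trans (by simp)

end Interference

/-! ### Concentration of the beamforming gain. -/

section Signal

set_option linter.unusedSectionVars false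

variable {M L : ℕ} [NeZero M] {Ω T : Type*} [MeasurableSpace Ω] [MeasurableSpace T] {μ : Measure Ω}
  [IsProbabilityMeasure μ] {D : ℝ} {X : Ω → ℕ → Plane} {Y : Ω → Mobile M → Plane}
  {g : Ω → Mobile M → ℕ → Fin L → ℂ} {φ : Ω → Mobile M → ℝ} {τ : Ω → T} {x : T → ℕ → Plane}
  {y : T → Mobile M → Plane} {Ψ : T → (Mobile M → ℕ → Fin L → ℂ) → Mobile M → ℝ}

/-- The beamforming gain `|g† w|²` of the typical mobile. -/
noncomputable def signalGain (D : ℝ) (x : ℕ → Plane) (y : Mobile M → Plane)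
    (γ : Mobile M → ℕ → Fin L → ℂ) : ℝ :=
  ‖star (γ (0, 0) 0) ⬝ᵥ precoder D x y γ (0, 0)‖ ^ 2

theorem measurable_signalGain {A : Type*} [MeasurableSpace A] {x : A → ℕ → Plane}
    {y : A → Mobile M → Plane} {γ : A → Mobile M → ℕ → Fin L → ℂ} (hx : Measurable x)
    (hy : Measurable y) (hγ : Measurable γ) :
    Measurable fun a => signalGain D (x a) (y a) (γ a) := by
  unfold signalGain
  refine Measurable.pow_const (.norm ?_) 2
  simp only [dotProduct, Pi.star_apply]
  refine Finset.measurable_fun_sum _ fun n _ => Measurable.mul ?_ ?_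
  · exact Complex.continuous_conj.measurable.comp (measurable_pi_iff.1 (measurable_pi_iff.1
      (measurable_pi_iff.1 hγ (0, 0)) 0) n)
  · exact measurable_pi_iff.1 (measurable_precoder hx hy hγ (0, 0)) n

theorem measurable_ncard_nearMobiles_diff {A : Type*} [MeasurableSpace A] {x : A → ℕ → Plane}
    {y : A → Mobile M → Plane} (hx : Measurable x) (hy : Measurable y) (i : Mobile M) (k : ℕ) :
    Measurable fun a => ((nearMobiles D (x a) (y a) k \ {i}).ncard : ℝ) := by
  have hS : Measurable fun a => nearMobiles D (x a) (y a) k \ {i} := by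
    refine measurable_set_iff.2 fun l => measurableSet_setOfPred.1 ?_
    exact (measurableSet_mem_nearMobiles hx hy l k).inter (MeasurableSet.const (¬ l ∈ ({i} : Set _)))
  exact (Measurable.of_discrete (f := fun n : ℕ => (n : ℝ))).comp (measurable_ncard.comp hS)

/-- The beamforming gain concentrates at the number of remaining degrees of freedom. -/
theorem IsRepresentation.lintegral_signalGain_sub_sq_le
    (h : IsRepresentation μ D X Y g φ τ x y Ψ) (hg : IsRayleighFading μ g) :
    ∫⁻ ω, ENNReal.ofReal (activity L D (X ω) (Y ω) 0 * (signalGain D (X ω) (Y ω) (g ω) -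
      (L - (nearMobiles D (X ω) (Y ω) 0 \ {(0, 0)}).ncard)) ^ 2) ∂μ ≤ L := by
  have hx : Measurable fun p : T × (Mobile M → ℕ → Fin L → ℂ) => x p.1 :=
    h.measurable_x.comp measurable_fst
  have hy : Measurable fun p : T × (Mobile M → ℕ → Fin L → ℂ) => y p.1 :=
    h.measurable_y.comp measurable_fst
  set F : T → (Mobile M → ℕ → Fin L → ℂ) → ℝ≥0∞ := fun t γ =>
    ENNReal.ofReal (activity L D (x t) (y t) 0 * (signalGain D (x t) (y t) γ -
      (L - (nearMobiles D (x t) (y t) 0 \ {(0, 0)}).ncard)) ^ 2) with hF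
  have hFm : Measurable (Function.uncurry F) :=
    ((measurable_activity hx hy 0).mul (((measurable_signalGain hx hy measurable_snd).sub
      (measurable_const.sub (measurable_ncard_nearMobiles_diff hx hy _ 0))).pow_const 2)
      ).ennreal_ofReal
  have h1 := hg.lintegral_resample h.measurable_tau h.indep hFm (0, 0) 0
  simp only [hF, h.x_tau, h.y_tau] at h1
  rw [h1]
  calc _ ≤ ∫⁻ _ω, (L : ℝ≥0∞) ∂μ := ?_
    _ = L := by simp
  refine lintegral_mono_ae ?_
  filter_upwards [hg.ae_indepColumns] with ω hω
  by_cases hact : IsActive L D (X ω) (Y ω) 0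
  · set S := nearMobiles D (X ω) (Y ω) 0 \ {((0, 0) : Mobile M)} with hS
    have hfin : S.Finite := hact.finite_nearMobiles.subset Set.sdiff_subset
    have hactj : IsActive L D (X ω) (Y ω) ((0, 0) : Mobile M).1 := hact
    have hind : IndepColumns (g ω) 0 S := (hactj.indepColumns hω).mono (Set.subset_insert _ _)
    have hnot : ((0, 0) : Mobile M) ∉ S := by simp [hS]
    -- The typical mobile is removed from the set to be nulled, so the projection does not involve
    -- its channel: after resampling the gain is a quadratic form with a fixed matrix.
    have hsig : ∀ v, signalGain D (X ω) (Y ω) (resample (0, 0) 0 v (g ω)) =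
        (star v ⬝ᵥ nullProjection (g ω) 0 S *ᵥ v).re := by
      intro v
      have h2 := norm_sq_star_dotProduct_precoder_self (i := ((0, 0) : Mobile M))
        (γ := resample (0, 0) 0 v (g ω)) (D := D) (x := X ω) (y := Y ω) hfin
        ((indepColumns_resample hnot v).2 hind)
      have h3 : resample (0, 0) 0 v (g ω) (0, 0) 0 = v := by simp [resample]
      have h4 : nullProjection (resample (0, 0) 0 v (g ω)) 0 S = nullProjection (g ω) 0 S :=
        nullProjection_congr fun l hl => by
          have : l ≠ (0, 0) := fun h => hnot (h ▸ hl)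
          simp [resample, this]
      simp only [← hS, h4, h3] at h2
      rw [signalGain, h3]
      exact h2
    have ha : activity L D (X ω) (Y ω) 0 = 1 := by simp [activity, hact]
    simp only [hsig, ha, one_mul]
    rw [lintegral_quadraticForm_sub_trace_sq (nullProjection_isHermitian _ _ hfin)
      (nullProjection_mul_self hfin hind) (trace_nullProjection hfin hind),
      ← ENNReal.ofReal_natCast]
    exact ENNReal.ofReal_le_ofReal (by simp)
  · simp [activity, hact]

end Signal

/-! ### Moments of the Poisson law. -/

section PoissonMoments

theorem succ_mul_poissonMeasure_singleton (r : ℝ≥0) (n : ℕ) :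
    ((n + 1 : ℕ) : ℝ≥0∞) * poissonMeasure r {n + 1} = r * poissonMeasure r {n} := by
  rw [poissonMeasure_singleton, poissonMeasure_singleton, ← ENNReal.ofReal_natCast,
    ← ENNReal.ofReal_coe_nnreal, ← ENNReal.ofReal_mul (by positivity),
    ← ENNReal.ofReal_mul (by positivity)]
  congr 1
  rw [Nat.factorial_succ]
  push_cast
  field_simp
  ring

/-- Size biasing: the factor `n` cancels in the factorial and shifts the index. The choices `f = 1`
and `f = id` give the first two moments. -/
theorem lintegral_mul_poissonMeasure (r : ℝ≥0) (f : ℕ → ℝ≥0∞) :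
    ∫⁻ n, n * f n ∂(poissonMeasure r) = r * ∫⁻ n, f (n + 1) ∂(poissonMeasure r) := by
  rw [lintegral_countable', lintegral_countable', tsum_eq_zero_add' ENNReal.summable,
    ← ENNReal.tsum_mul_left]
  simp only [Nat.cast_zero, zero_mul, zero_add]
  refine tsum_congr fun n => ?_
  rw [mul_right_comm, succ_mul_poissonMeasure_singleton]
  ring

theorem lintegral_id_poissonMeasure (r : ℝ≥0) : ∫⁻ n, (n : ℝ≥0∞) ∂(poissonMeasure r) = r := by
  have := lintegral_mul_poissonMeasure r (fun _ => 1)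
  simpa using this

theorem lintegral_sq_poissonMeasure (r : ℝ≥0) :
    ∫⁻ n, (n : ℝ≥0∞) ^ 2 ∂(poissonMeasure r) = r ^ 2 + r := by
  have := lintegral_mul_poissonMeasure r (fun n => (n : ℝ≥0∞))
  simp only [sq]
  rw [this]
  push_cast
  rw [lintegral_add_right _ measurable_const, lintegral_id_poissonMeasure]
  simp [mul_add]

end PoissonMoments

/-! ### First and second moment measures of the Poisson process. -/

section PointProcess

variable {Ω : Type*} [MeasurableSpace Ω] {μ : Measure Ω} {lam : ℝ} {W : Ω → ℕ → Plane}

/-- The number of points of `W` in `B`. -/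
noncomputable def pointCount (W : ℕ → Plane) (B : Set Plane) : ℝ≥0∞ :=
  ∑' k, B.indicator 1 (W k)

theorem pointCount_eq_encard (w : ℕ → Plane) (B : Set Plane) :
    pointCount w B = ({k | w k ∈ B}.encard : ℝ≥0∞) := by
  rw [← ENNReal.tsum_set_one, tsum_subtype {k | w k ∈ B} (fun _ => (1 : ℝ≥0∞)), pointCount]
  refine tsum_congr fun k => ?_
  by_cases h : w k ∈ B <;> simp [h, Set.indicator]

theorem measurable_pointCount (hW : Measurable W) {B : Set Plane} (hB : MeasurableSet B) :
    Measurable fun ω => pointCount (W ω) B :=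
  Measurable.tsum fun k => (measurable_one.indicator hB).comp (measurable_pi_iff.1 hW k)

theorem measurable_encard_points (hW : Measurable W) {B : Set Plane} (hB : MeasurableSet B) :
    Measurable fun ω => {k | W ω k ∈ B}.encard :=
  measurable_encard.comp (measurable_set_iff.2 fun k => measurableSet_setOfPred.1
    ((measurable_pi_iff.1 hW k) hB))

theorem IsHomogeneousPoisson.lintegral_comp [IsProbabilityMeasure μ]
    (h : IsHomogeneousPoisson μ lam W) (hW : Measurable W) {B : Set Plane} (hB : MeasurableSet B)
    (hvol : volume B ≠ ∞) (f : ℝ≥0∞ → ℝ≥0∞) :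
    ∫⁻ ω, f (pointCount (W ω) B) ∂μ =
      ∫⁻ n, f (n : ℝ≥0∞) ∂(poissonMeasure (lam * (volume B).toReal).toNNReal) := by
  set r := (lam * (volume B).toReal).toNNReal
  have hm := measurable_encard_points hW hB
  have hn : ∀ n : ℕ, μ {ω | {k | W ω k ∈ B}.encard = (n : ℕ∞)} = poissonMeasure r {n} :=
    h.poisson B hB hvol
  have hsing : ∀ n : ℕ, MeasurableSet {ω | {k | W ω k ∈ B}.encard = (n : ℕ∞)} := fun n =>
    hm (MeasurableSet.of_discrete (s := {(n : ℕ∞)}))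
  -- The Poisson weights of the natural numbers already sum to one, so no mass is left for an
  -- infinite count.
  have htop : μ {ω | {k | W ω k ∈ B}.encard = ⊤} = 0 := by
    have h1 : μ (⋃ n : ℕ, {ω | {k | W ω k ∈ B}.encard = (n : ℕ∞)}) = 1 := by
      rw [measure_iUnion _ hsing]
      · simp_rw [hn]
        have := measure_univ (μ := poissonMeasure r)
        rwa [← Set.iUnion_of_singleton ℕ, measure_iUnion (fun a b hab => by simpa using hab)
          (fun _ => measurableSet_singleton _)] at this
      · intro a b hab
        refine Set.disjoint_left.2 fun ω ha hb => hab ?_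
        have ha' : {k | W ω k ∈ B}.encard = (a : ℕ∞) := ha
        have hb' : {k | W ω k ∈ B}.encard = (b : ℕ∞) := hb
        exact_mod_cast ha'.symm.trans hb'
    have h2 := (prob_compl_eq_zero_iff (MeasurableSet.iUnion hsing)).2 h1
    refine measure_mono_null (fun ω hω => ?_) h2
    simp only [Set.mem_compl_iff, Set.mem_iUnion, not_exists]
    intro n hn'
    have ha' : {k | W ω k ∈ B}.encard = (n : ℕ∞) := hn'
    have hb' : {k | W ω k ∈ B}.encard = ⊤ := hω
    rw [hb'] at ha'
    exact ENat.top_ne_natCast n ha'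
  have hnat : Measurable fun ω => {k | W ω k ∈ B}.encard.toNat :=
    (Measurable.of_discrete (f := ENat.toNat)).comp hm
  have hlaw : μ.map (fun ω => {k | W ω k ∈ B}.encard.toNat) = poissonMeasure r := by
    refine Measure.ext_of_singleton fun n => ?_
    rw [Measure.map_apply hnat (measurableSet_singleton _), ← hn n]
    refine measure_congr ?_
    have : ∀ᵐ ω ∂μ, {k | W ω k ∈ B}.encard ≠ ⊤ := by
      rw [ae_iff]; simpa using htop
    filter_upwards [this] with ω hω
    refine propext ?_
    change {k | W ω k ∈ B}.encard.toNat = n ↔ {k | W ω k ∈ B}.encard = n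
    constructor
    · intro h; rw [← h, ENat.natCast_toNat hω]
    · intro h; rw [h, ENat.toNat_natCast]
  rw [← hlaw, lintegral_map (by exact Measurable.of_discrete) hnat]
  refine lintegral_congr_ae ?_
  have : ∀ᵐ ω ∂μ, {k | W ω k ∈ B}.encard ≠ ⊤ := by
    rw [ae_iff]; simpa using htop
  filter_upwards [this] with ω hω
  rw [pointCount_eq_encard]
  congr 1
  conv_lhs => rw [← ENat.natCast_toNat hω]
  simp

theorem IsHomogeneousPoisson.lintegral_pointCount [IsProbabilityMeasure μ] (hlam : 0 ≤ lam)
    (h : IsHomogeneousPoisson μ lam W) (hW : Measurable W) {B : Set Plane} (hB : MeasurableSet B)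
    (hvol : volume B ≠ ∞) :
    ∫⁻ ω, pointCount (W ω) B ∂μ = ENNReal.ofReal lam * volume B := by
  rw [h.lintegral_comp hW hB hvol fun n => n]
  rw [lintegral_id_poissonMeasure, ← ENNReal.ofReal.eq_1, ENNReal.ofReal_mul hlam,
    ENNReal.ofReal_toReal hvol]

theorem IsHomogeneousPoisson.lintegral_pointCount_sq [IsProbabilityMeasure μ] (hlam : 0 ≤ lam)
    (h : IsHomogeneousPoisson μ lam W) (hW : Measurable W) {B : Set Plane} (hB : MeasurableSet B)
    (hvol : volume B ≠ ∞) :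
    ∫⁻ ω, pointCount (W ω) B ^ 2 ∂μ =
      (ENNReal.ofReal lam * volume B) ^ 2 + ENNReal.ofReal lam * volume B := by
  rw [h.lintegral_comp hW hB hvol (fun n => n ^ 2), lintegral_sq_poissonMeasure,
    ← ENNReal.ofReal.eq_1, ENNReal.ofReal_mul hlam, ENNReal.ofReal_toReal hvol]

theorem IsHomogeneousPoisson.lintegral_pointCount_mul_of_disjoint [IsProbabilityMeasure μ]
    (hlam : 0 ≤ lam) (h : IsHomogeneousPoisson μ lam W) (hW : Measurable W) {A B : Set Plane}
    (hA : MeasurableSet A) (hB : MeasurableSet B) (hvA : volume A ≠ ∞) (hvB : volume B ≠ ∞)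
    (hAB : Disjoint A B) :
    ∫⁻ ω, pointCount (W ω) A * pointCount (W ω) B ∂μ =
      (ENNReal.ofReal lam * volume A) * (ENNReal.ofReal lam * volume B) := by
  have h1 := h.indep 2 ![A, B] (by intro i; fin_cases i <;> simpa)
    (by intro i; fin_cases i <;> simpa)
    (by intro i j hij; fin_cases i <;> fin_cases j <;> simp_all [disjoint_comm])
  have h2 := h1.indepFun (i := 0) (j := 1) (by simp)
  have h3 : IndepFun (fun ω => pointCount (W ω) A) (fun ω => pointCount (W ω) B) μ := by
    have := h2.comp (φ := fun n : ℕ∞ => (n : ℝ≥0∞)) (ψ := fun n : ℕ∞ => (n : ℝ≥0∞))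
      Measurable.of_discrete Measurable.of_discrete
    simp only [pointCount_eq_encard]
    exact this
  rw [← h.lintegral_pointCount hlam hW hA hvA, ← h.lintegral_pointCount hlam hW hB hvB]
  exact lintegral_mul_eq_lintegral_mul_lintegral_of_indepFun
    (measurable_pointCount hW hA) (measurable_pointCount hW hB) h3

theorem pointCount_add_inter (w : ℕ → Plane) (A B : Set Plane) :
    pointCount w A = pointCount w (A \ B) + pointCount w (A ∩ B) := by
  unfold pointCount
  rw [← ENNReal.tsum_add]
  refine tsum_congr fun k => ?_
  by_cases hA : w k ∈ A <;> by_cases hB : w k ∈ B <;> simp [hA, hB]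

/-- Splitting into `A \ B`, `B \ A` and `A ∩ B`, counts in different pieces are independent, and
only the square of the count in `A ∩ B` contributes more than the product of the means. -/
theorem IsHomogeneousPoisson.lintegral_pointCount_mul [IsProbabilityMeasure μ]
    (hlam : 0 ≤ lam) (h : IsHomogeneousPoisson μ lam W) (hW : Measurable W) {A B : Set Plane}
    (hA : MeasurableSet A) (hB : MeasurableSet B) (hvA : volume A ≠ ∞) (hvB : volume B ≠ ∞) :
    ∫⁻ ω, pointCount (W ω) A * pointCount (W ω) B ∂μ =
      (ENNReal.ofReal lam * volume A) * (ENNReal.ofReal lam * volume B) +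
        ENNReal.ofReal lam * volume (A ∩ B) := by
  have hAd := hA.diff hB
  have hBd := hB.diff hA
  have hI := hA.inter hB
  have hvAd : volume (A \ B) ≠ ∞ := measure_ne_top_of_subset Set.sdiff_subset hvA
  have hvBd : volume (B \ A) ≠ ∞ := measure_ne_top_of_subset Set.sdiff_subset hvB
  have hvI : volume (A ∩ B) ≠ ∞ := measure_ne_top_of_subset Set.inter_subset_left hvA
  have m1 := measurable_pointCount hW hAd
  have m2 := measurable_pointCount hW hBd
  have m3 := measurable_pointCount hW hI
  have hsplit : ∀ ω, pointCount (W ω) A * pointCount (W ω) B =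
      (pointCount (W ω) (A \ B) * pointCount (W ω) (B \ A) +
       pointCount (W ω) (A \ B) * pointCount (W ω) (A ∩ B)) +
      (pointCount (W ω) (B \ A) * pointCount (W ω) (A ∩ B) + pointCount (W ω) (A ∩ B) ^ 2) := by
    intro ω
    rw [pointCount_add_inter (W ω) A B, pointCount_add_inter (W ω) B A, Set.inter_comm B A]
    ring
  simp_rw [hsplit]
  have m12 : Measurable fun ω => pointCount (W ω) (A \ B) * pointCount (W ω) (B \ A) := m1.mul m2
  have m13 : Measurable fun ω => pointCount (W ω) (A \ B) * pointCount (W ω) (A ∩ B) := m1.mul m3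
  have m23 : Measurable fun ω => pointCount (W ω) (B \ A) * pointCount (W ω) (A ∩ B) := m2.mul m3
  have m123 : Measurable fun ω => pointCount (W ω) (A \ B) * pointCount (W ω) (B \ A) +
    pointCount (W ω) (A \ B) * pointCount (W ω) (A ∩ B) := m12.add m13
  rw [lintegral_add_left m123, lintegral_add_left m12,
    lintegral_add_left m23,
    h.lintegral_pointCount_mul_of_disjoint hlam hW hAd hBd hvAd hvBd
      (Set.disjoint_left.2 fun z h1 h2 => h1.2 h2.1),
    h.lintegral_pointCount_mul_of_disjoint hlam hW hAd hI hvAd hvI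
      (Set.disjoint_left.2 fun z h1 h2 => h1.2 h2.2),
    h.lintegral_pointCount_mul_of_disjoint hlam hW hBd hI hvBd hvI
      (Set.disjoint_left.2 fun z h1 h2 => h1.2 h2.1),
    h.lintegral_pointCount_sq hlam hW hI hvI]
  have hvA' : volume A = volume (A \ B) + volume (A ∩ B) := by
    rw [add_comm, measure_inter_add_sdiff A hB]
  have hvB' : volume B = volume (B \ A) + volume (A ∩ B) := by
    rw [add_comm, Set.inter_comm, measure_inter_add_sdiff B hA]
  rw [hvA', hvB']
  ring

/-- The measurable subsets of the plane that have finite area. -/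
def finiteAreaSets : Set (Set Plane) := {s | MeasurableSet s ∧ volume s ≠ ∞}

theorem isPiSystem_finiteAreaSets : IsPiSystem finiteAreaSets := fun _ hs _ ht _ =>
  ⟨hs.1.inter ht.1, measure_ne_top_of_subset Set.inter_subset_left hs.2⟩

theorem generateFrom_finiteAreaSets :
    MeasurableSpace.generateFrom finiteAreaSets = (inferInstance : MeasurableSpace Plane) := by
  refine le_antisymm (MeasurableSpace.generateFrom_le fun s hs => hs.1) fun s hs => ?_
  have : s = ⋃ n : ℕ, s ∩ Metric.ball 0 n := by
    rw [← Set.inter_iUnion, Metric.iUnion_ball_nat, Set.inter_univ]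
  rw [this]
  refine MeasurableSet.iUnion fun n => MeasurableSpace.measurableSet_generateFrom
    ⟨hs.inter measurableSet_ball, ?_⟩
  exact measure_ne_top_of_subset Set.inter_subset_right measure_ball_lt_top.ne

/-- The balls around the origin span the plane. -/
def finiteAreaSets_spanning {m : Measure Plane} (hm : ∀ s ∈ finiteAreaSets, m s < ∞) :
    m.FiniteSpanningSetsIn finiteAreaSets where
  set (n : ℕ) := Metric.ball 0 n
  set_mem _ := ⟨measurableSet_ball, measure_ball_lt_top.ne⟩
  finite _ := hm _ ⟨measurableSet_ball, measure_ball_lt_top.ne⟩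
  spanning := Metric.iUnion_ball_nat 0

/-- The mean counts identify both measures on the sets of finite area, a generating π-system that
contains an exhaustion by balls. -/
theorem IsHomogeneousPoisson.sum_map_eq [IsProbabilityMeasure μ] (hlam : 0 ≤ lam)
    (h : IsHomogeneousPoisson μ lam W) (hW : Measurable W) :
    Measure.sum (fun k => μ.map fun ω => W ω k) = ENNReal.ofReal lam • volume := by
  have heq : ∀ s ∈ finiteAreaSets, Measure.sum (fun k => μ.map fun ω => W ω k) s =
      (ENNReal.ofReal lam • volume : Measure Plane) s := by
    intro s hs
    rw [Measure.sum_apply _ hs.1, Measure.smul_apply, smul_eq_mul,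
      ← h.lintegral_pointCount hlam hW hs.1 hs.2]
    unfold pointCount
    have hm : ∀ k, Measurable fun ω => (s.indicator 1 (W ω k) : ℝ≥0∞) := fun k =>
      (measurable_one.indicator hs.1).comp (measurable_pi_iff.1 hW k)
    rw [lintegral_tsum fun k => (hm k).aemeasurable]
    refine tsum_congr fun k => ?_
    have hk := measurable_pi_iff.1 hW k
    rw [Measure.map_apply hk hs.1]
    exact (lintegral_indicator_one (hk hs.1)).symm
  refine Measure.FiniteSpanningSetsIn.ext generateFrom_finiteAreaSets.symm
    isPiSystem_finiteAreaSets (finiteAreaSets_spanning fun s hs => ?_) heq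
  rw [heq s hs, Measure.smul_apply, smul_eq_mul]
  exact ENNReal.mul_lt_top ENNReal.ofReal_lt_top hs.2.lt_top

/-- **Campbell's formula** for the Poisson process. -/
theorem IsHomogeneousPoisson.lintegral_tsum_points [IsProbabilityMeasure μ] (hlam : 0 ≤ lam)
    (h : IsHomogeneousPoisson μ lam W) (hW : Measurable W) {f : Plane → ℝ≥0∞}
    (hf : Measurable f) :
    ∫⁻ ω, ∑' k, f (W ω k) ∂μ = ENNReal.ofReal lam * ∫⁻ z, f z := by
  have hm : ∀ k, Measurable fun ω => f (W ω k) := fun k => hf.comp (measurable_pi_iff.1 hW k)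
  rw [← smul_eq_mul, ← lintegral_smul_measure, ← h.sum_map_eq hlam hW, lintegral_sum_measure,
    lintegral_tsum fun k => (hm k).aemeasurable]
  exact tsum_congr fun k => (lintegral_map hf (measurable_pi_iff.1 hW k)).symm

/-- The second factorial moment measure of the Poisson process. -/
theorem IsHomogeneousPoisson.tsum_pairs [IsProbabilityMeasure μ] (hlam : 0 ≤ lam)
    (h : IsHomogeneousPoisson μ lam W) (hW : Measurable W) {F : Plane × Plane → ℝ≥0∞}
    (hF : Measurable F) :
    ∑' p : ℕ × ℕ, (if p.1 = p.2 then 0 else ∫⁻ ω, F (W ω p.1, W ω p.2) ∂μ) =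
      ENNReal.ofReal lam ^ 2 * ∫⁻ z, ∫⁻ z', F (z, z') := by
  have hWk : ∀ k, Measurable fun ω => W ω k := measurable_pi_iff.1 hW
  set m2 : Measure (Plane × Plane) := Measure.sum fun p : ℕ × ℕ =>
    if p.1 = p.2 then 0 else μ.map fun ω => (W ω p.1, W ω p.2) with hm2
  have heq : (ENNReal.ofReal lam • volume : Measure Plane).prod (ENNReal.ofReal lam • volume) =
      m2 := by
    have hfin : ∀ s ∈ finiteAreaSets, (ENNReal.ofReal lam • volume : Measure Plane) s < ∞ :=
      fun s hs => by
        rw [Measure.smul_apply, smul_eq_mul]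
        exact ENNReal.mul_lt_top ENNReal.ofReal_lt_top hs.2.lt_top
    refine Measure.prod_eq_generateFrom generateFrom_finiteAreaSets generateFrom_finiteAreaSets
      isPiSystem_finiteAreaSets isPiSystem_finiteAreaSets (finiteAreaSets_spanning hfin)
      (finiteAreaSets_spanning hfin) fun A hA B hB => ?_
    have h1 := h.lintegral_pointCount_mul hlam hW hA.1 hB.1 hA.2 hB.2
    have h2 : ∫⁻ ω, pointCount (W ω) A * pointCount (W ω) B ∂μ =
        m2 (A ×ˢ B) + ENNReal.ofReal lam * volume (A ∩ B) := by
      have e1 : ∀ ω, pointCount (W ω) A * pointCount (W ω) B =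
          ∑' p : ℕ × ℕ, A.indicator 1 (W ω p.1) * B.indicator 1 (W ω p.2) := by
        intro ω
        rw [pointCount, pointCount, ENNReal.tsum_prod
          (f := fun k l => A.indicator 1 (W ω k) * B.indicator 1 (W ω l)), ← ENNReal.tsum_mul_right]
        exact tsum_congr fun k => ENNReal.tsum_mul_left.symm
      simp_rw [e1]
      have hmeas : ∀ p : ℕ × ℕ, Measurable fun ω =>
          (A.indicator 1 (W ω p.1) * B.indicator 1 (W ω p.2) : ℝ≥0∞) := fun p =>
        ((measurable_one.indicator hA.1).comp (hWk p.1)).mul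
          ((measurable_one.indicator hB.1).comp (hWk p.2))
      rw [lintegral_tsum fun p => (hmeas p).aemeasurable]
      have e2 : ∀ p : ℕ × ℕ, ∫⁻ ω, A.indicator 1 (W ω p.1) * B.indicator 1 (W ω p.2) ∂μ =
          μ ((fun ω => (W ω p.1, W ω p.2)) ⁻¹' (A ×ˢ B)) := by
        intro p
        rw [← lintegral_indicator_one
          (((hWk p.1).prodMk (hWk p.2)) (hA.1.prod hB.1))]
        refine lintegral_congr fun ω => ?_
        by_cases ha : W ω p.1 ∈ A <;> by_cases hb : W ω p.2 ∈ B <;>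
          simp [ha, hb, Set.indicator]
      simp_rw [e2]
      -- The diagonal pairs `p.1 = p.2` contribute the mean count in `A ∩ B`, which is exactly the
      -- excess term in the product moment of the two counts.
      have e3 : ∀ p : ℕ × ℕ, μ ((fun ω => (W ω p.1, W ω p.2)) ⁻¹' (A ×ˢ B)) =
          (if p.1 = p.2 then 0 else μ ((fun ω => (W ω p.1, W ω p.2)) ⁻¹' (A ×ˢ B))) +
          (if p.2 = p.1 then μ ((fun ω => W ω p.1) ⁻¹' (A ∩ B)) else 0) := by
        intro p
        by_cases hp : p.1 = p.2
        · rw [if_pos hp, if_pos hp.symm, zero_add, hp]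
          rfl
        · rw [if_neg hp, if_neg (Ne.symm hp), add_zero]
      rw [tsum_congr e3, ENNReal.tsum_add]
      congr 1
      · rw [hm2, Measure.sum_apply _ (hA.1.prod hB.1)]
        refine tsum_congr fun p => ?_
        by_cases hp : p.1 = p.2
        · rw [if_pos hp, if_pos hp]; rfl
        · rw [if_neg hp, if_neg hp, Measure.map_apply ((hWk p.1).prodMk (hWk p.2)) (hA.1.prod hB.1)]
      · rw [ENNReal.tsum_prod (f := fun k l =>
          if l = k then μ ((fun ω => W ω k) ⁻¹' (A ∩ B)) else 0)]
        rw [tsum_congr fun k => tsum_ite_eq k fun _ => μ ((fun ω => W ω k) ⁻¹' (A ∩ B))]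
        have e4 := congrFun (congrArg (fun m : Measure Plane => (m : Set Plane → ℝ≥0∞))
          (h.sum_map_eq hlam hW)) (A ∩ B)
        beta_reduce at e4
        rw [Measure.sum_apply _ (hA.1.inter hB.1), Measure.smul_apply, smul_eq_mul] at e4
        rw [← e4]
        exact tsum_congr fun k => (Measure.map_apply (hWk k) (hA.1.inter hB.1)).symm
    rw [h1] at h2
    -- Finiteness allows cancelling the diagonal term in `[0, ∞]`.
    have hne : ENNReal.ofReal lam * volume (A ∩ B) ≠ ∞ :=
      ENNReal.mul_ne_top ENNReal.ofReal_ne_top (measure_ne_top_of_subset Set.inter_subset_left hA.2)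
    rw [Measure.smul_apply, Measure.smul_apply, smul_eq_mul, smul_eq_mul]
    exact ((ENNReal.add_left_inj hne).1 h2).symm
  have h3 : ∫⁻ p, F p ∂m2 = ∑' p : ℕ × ℕ,
      (if p.1 = p.2 then 0 else ∫⁻ ω, F (W ω p.1, W ω p.2) ∂μ) := by
    rw [hm2, lintegral_sum_measure]
    refine tsum_congr fun p => ?_
    by_cases hp : p.1 = p.2
    · rw [if_pos hp, if_pos hp, lintegral_zero_measure]
    · rw [if_neg hp, if_neg hp]
      exact lintegral_map hF ((hWk p.1).prodMk (hWk p.2))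
  rw [← h3, ← heq, lintegral_prod _ hF.aemeasurable, lintegral_smul_measure]
  simp_rw [lintegral_smul_measure, smul_eq_mul]
  rw [lintegral_const_mul _ hF.lintegral_prod_right']
  ring

end PointProcess

/-! ### The truncated path loss and its integral over the plane. -/

section PathLoss

/-- The path loss `r ^ (-p)` outside the zero-forcing radius `D`. -/
noncomputable def pathLoss (p D r : ℝ) : ℝ := if D ≤ r then r ^ (-p) else 0

theorem pathLoss_nonneg {p D r : ℝ} (hD : 0 < D) : 0 ≤ pathLoss p D r := by
  unfold pathLoss
  split_ifs with h
  · exact Real.rpow_nonneg (hD.le.trans h) _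
  · exact le_rfl

theorem pathLoss_le {p D r : ℝ} (hp : 0 ≤ p) (hD : 0 < D) : pathLoss p D r ≤ D ^ (-p) := by
  unfold pathLoss
  split_ifs with h
  · exact Real.rpow_le_rpow_of_nonpos hD h (by linarith)
  · exact Real.rpow_nonneg hD.le _

theorem measurable_pathLoss (p D : ℝ) : Measurable (pathLoss p D) :=
  Measurable.ite measurableSet_Ici (measurable_id.pow_const _) measurable_const

theorem lintegral_pathLoss {p D : ℝ} (hp : 2 < p) (hD : 0 < D) :
    ∫⁻ z : Plane, ENNReal.ofReal (pathLoss p D (dist 0 z)) =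
      ENNReal.ofReal (2 * Real.pi * D ^ (2 - p) / (p - 2)) := by
  have hdim : Module.finrank ℝ Plane = 2 := by simp
  have hpoint : ∀ r ∈ Set.Ioi (0 : ℝ), r ^ (Module.finrank ℝ Plane - 1) • pathLoss p D r =
      (Set.Ici D).indicator (fun r => r ^ (1 - p)) r := by
    intro r hr
    rw [hdim]
    by_cases h : D ≤ r
    · rw [Set.indicator_of_mem (show r ∈ Set.Ici D from h), pathLoss, if_pos h]
      simp only [Nat.add_one_sub_one, pow_one, smul_eq_mul]
      rw [sub_eq_add_neg, Real.rpow_add hr, Real.rpow_one]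
    · rw [Set.indicator_of_notMem (show r ∉ Set.Ici D from h), pathLoss, if_neg h]
      simp
  have hint : IntegrableOn (fun r : ℝ => r ^ (1 - p)) (Set.Ioi D) :=
    integrableOn_Ioi_rpow_of_lt (by linarith) hD
  have hI : Integrable fun z : Plane => pathLoss p D ‖z‖ := by
    rw [integrable_fun_norm_addHaar, integrableOn_congr_fun hpoint measurableSet_Ioi]
    rw [IntegrableOn, integrable_indicator_iff measurableSet_Ici]
    exact ((integrableOn_Ici_iff_integrableOn_Ioi (by simp)).2 hint).mono_measure Measure.restrict_le_self
  have hval : ∫ z : Plane, pathLoss p D ‖z‖ = 2 * Real.pi * D ^ (2 - p) / (p - 2) := by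
    rw [integral_fun_norm_addHaar, setIntegral_congr_fun measurableSet_Ioi hpoint,
      setIntegral_indicator measurableSet_Ici,
      show Set.Ioi (0 : ℝ) ∩ Set.Ici D = Set.Ici D from
        Set.inter_eq_right.2 fun r hr => lt_of_lt_of_le hD hr,
      integral_Ici_eq_integral_Ioi, integral_Ioi_rpow_of_lt (by linarith) hD, hdim,
      Measure.real, EuclideanSpace.volume_ball_fin_two]
    have h1 : p - 2 ≠ 0 := by linarith
    have h2 : 1 - p + 1 = -(p - 2) := by ring
    rw [h2, show (2 : ℝ) - p = -(p - 2) by ring]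
    have h3 : 2 - p ≠ 0 := by linarith
    simp [Real.pi_pos.le]
    field_simp
    ring
  simp_rw [dist_zero_left]
  rw [← ofReal_integral_eq_lintegral_ofReal hI (.of_forall fun z => pathLoss_nonneg hD), hval]

/-- Path losses of points at distance less than `1` are comparable. -/
theorem pathLoss_le_of_dist_lt_one {p D : ℝ} (hp : 0 ≤ p) (hD : 2 ≤ D) {w z : Plane}
    (h : dist w z < 1) :
    pathLoss p D (dist 0 w) ≤ 2 ^ p * pathLoss p (D / 2) (dist 0 z) := by
  have hnn : 0 ≤ 2 ^ p * pathLoss p (D / 2) (dist 0 z) :=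
    mul_nonneg (by positivity) (pathLoss_nonneg (by linarith))
  by_cases hw : D ≤ dist 0 w
  · have h1 : dist 0 w ≤ dist 0 z + 1 := by
      have := dist_triangle 0 z w
      rw [dist_comm z w] at this
      linarith
    have h2 : dist 0 z ≤ dist 0 w + 1 := by
      have := dist_triangle 0 w z
      linarith
    rw [pathLoss, pathLoss, if_pos hw, if_pos (by linarith)]
    have hz : 0 < dist 0 z := by linarith
    -- Since `D ≥ 2`, moving by less than `1` costs at most a factor `2` in distance; this explains
    -- both the `2 ^ p` and the radius `D / 2`.
    have h3 : (dist 0 w) ^ (-p) ≤ (dist 0 z / 2) ^ (-p) :=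
      Real.rpow_le_rpow_of_nonpos (by linarith) (by linarith) (by linarith)
    refine h3.trans (le_of_eq ?_)
    rw [Real.div_rpow hz.le (by norm_num), Real.rpow_neg (by norm_num : (0 : ℝ) ≤ 2), div_inv_eq_mul,
      mul_comm]
  · rw [pathLoss, if_neg hw]
    exact hnn

end PathLoss

/-! ### Chebyshev bounds for Poisson counts in discs. -/

section PoissonChebyshev

theorem lintegral_sub_sq_poissonMeasure (r : ℝ≥0) :
    ∫⁻ n : ℕ, ENNReal.ofReal (((n : ℝ) - r) ^ 2) ∂(poissonMeasure r) = r := by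
  -- The square is expanded with the cross term moved to the left, so that everything stays a sum in
  -- `[0, ∞]`.
  have h1 : ∀ n : ℕ, ENNReal.ofReal (((n : ℝ) - r) ^ 2) + 2 * r * n = (n : ℝ≥0∞) ^ 2 + r ^ 2 := by
    intro n
    have e1 : (2 * r * n : ℝ≥0∞) = ENNReal.ofReal (2 * r * n) := by
      rw [ENNReal.ofReal_mul (by positivity), ENNReal.ofReal_mul (by positivity)]
      simp
    have e2 : ((n : ℝ≥0∞) ^ 2 + r ^ 2) = ENNReal.ofReal ((n : ℝ) ^ 2 + r ^ 2) := by
      rw [ENNReal.ofReal_add (by positivity) (by positivity), ENNReal.ofReal_pow (by positivity),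
        ENNReal.ofReal_pow (by positivity)]
      simp
    rw [e1, e2, ← ENNReal.ofReal_add (by positivity) (by positivity)]
    congr 1
    ring
  have h2 := lintegral_congr (μ := poissonMeasure r) h1
  rw [lintegral_add_right _ Measurable.of_discrete, lintegral_const_mul _ Measurable.of_discrete,
    lintegral_id_poissonMeasure, lintegral_add_right _ measurable_const,
    lintegral_sq_poissonMeasure] at h2
  simp only [lintegral_const, measure_univ, mul_one] at h2
  have hne : (2 * r * r : ℝ≥0∞) ≠ ∞ := by finiteness
  refine (ENNReal.add_left_inj hne).1 (h2.trans ?_)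
  ring

variable {Ω : Type*} [MeasurableSpace Ω] {μ : Measure Ω} {lam : ℝ} {W : Ω → ℕ → Plane}

theorem toNNReal_mul_volume_ball (lam : ℝ) (z : Plane) {ρ : ℝ} (hρ : 0 ≤ ρ) :
    (lam * (volume (Metric.ball z ρ)).toReal).toNNReal = (lam * (Real.pi * ρ ^ 2)).toNNReal := by
  rw [EuclideanSpace.volume_ball_fin_two]
  congr 2
  simp [Real.pi_pos.le, hρ]
  ring

theorem IsHomogeneousPoisson.lintegral_ball_sub_sq [IsProbabilityMeasure μ] (hlam : 0 ≤ lam)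
    (h : IsHomogeneousPoisson μ lam W) (hW : Measurable W) (z : Plane) {ρ : ℝ} (hρ : 0 ≤ ρ) :
    ∫⁻ ω, ENNReal.ofReal (((pointCount (W ω) (Metric.ball z ρ)).toReal -
      lam * (Real.pi * ρ ^ 2)) ^ 2) ∂μ = ENNReal.ofReal (lam * (Real.pi * ρ ^ 2)) := by
  have h0 : 0 ≤ lam * (Real.pi * ρ ^ 2) := by have := Real.pi_pos; positivity
  rw [h.lintegral_comp hW measurableSet_ball measure_ball_lt_top.ne
    fun n => ENNReal.ofReal ((n.toReal - lam * (Real.pi * ρ ^ 2)) ^ 2),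
    toNNReal_mul_volume_ball lam z hρ]
  have := lintegral_sub_sq_poissonMeasure (lam * (Real.pi * ρ ^ 2)).toNNReal
  rw [Real.coe_toNNReal _ h0] at this
  simp only [ENNReal.toReal_natCast]
  exact this

theorem IsHomogeneousPoisson.measure_ball_ge_le [IsProbabilityMeasure μ] (hlam : 0 ≤ lam)
    (h : IsHomogeneousPoisson μ lam W) (hW : Measurable W) (z : Plane) {ρ c : ℝ} (hρ : 0 ≤ ρ)
    (hc : lam * (Real.pi * ρ ^ 2) < c) :
    μ {ω | ENNReal.ofReal c ≤ pointCount (W ω) (Metric.ball z ρ)} ≤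
      ENNReal.ofReal (lam * (Real.pi * ρ ^ 2) / (c - lam * (Real.pi * ρ ^ 2)) ^ 2) := by
  set m := lam * (Real.pi * ρ ^ 2) with hm
  have h0 : 0 ≤ m := by have := Real.pi_pos; positivity
  have hcm : 0 < c - m := by linarith
  have hms : MeasurableSet {ω | ENNReal.ofReal c ≤ pointCount (W ω) (Metric.ball z ρ)} :=
    measurableSet_le measurable_const (measurable_pointCount hW measurableSet_ball)
  have h1 : μ {ω | ENNReal.ofReal c ≤ pointCount (W ω) (Metric.ball z ρ)} =
      ∫⁻ ω, (Set.Ici (ENNReal.ofReal c)).indicator 1 (pointCount (W ω) (Metric.ball z ρ)) ∂μ := by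
    rw [← lintegral_indicator_one hms]
    rfl
  rw [h1, h.lintegral_comp hW measurableSet_ball measure_ball_lt_top.ne
    (fun n => (Set.Ici (ENNReal.ofReal c)).indicator 1 n), toNNReal_mul_volume_ball lam z hρ, ← hm]
  have h2 := lintegral_sub_sq_poissonMeasure m.toNNReal
  rw [Real.coe_toNNReal _ h0] at h2
  have h3 : ENNReal.ofReal (m / (c - m) ^ 2) =
      ENNReal.ofReal (((c - m) ^ 2)⁻¹) * (m.toNNReal : ℝ≥0∞) := by
    rw [div_eq_inv_mul, ENNReal.ofReal_mul (by positivity)]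
    rfl
  rw [h3, ← h2, ← lintegral_const_mul _ Measurable.of_discrete]
  refine lintegral_mono fun n => ?_
  by_cases hn : (n : ℝ≥0∞) ∈ Set.Ici (ENNReal.ofReal c)
  · rw [Set.indicator_of_mem hn, Pi.one_apply, ← ENNReal.ofReal_mul (by positivity),
      ENNReal.one_le_ofReal, ← div_eq_inv_mul, one_le_div (by positivity)]
    have hn' : c ≤ n := by
      have : ENNReal.ofReal c ≤ (n : ℝ≥0∞) := hn
      rw [← ENNReal.ofReal_natCast] at this
      exact (ENNReal.ofReal_le_ofReal_iff (by positivity)).1 this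
    exact pow_le_pow_left₀ hcm.le (by linarith) 2
  · rw [Set.indicator_of_notMem hn]
    exact zero_le

/-- The mean number of points in a unit disc on the event that a larger disc has many points. -/
theorem IsHomogeneousPoisson.lintegral_unit_ball_indicator_le [IsProbabilityMeasure μ]
    (hlam : 0 ≤ lam) (h : IsHomogeneousPoisson μ lam W) (hW : Measurable W) (z : Plane) {ρ c : ℝ}
    (hρ : 0 ≤ ρ) (hc : lam * (Real.pi * ρ ^ 2) < c) :
    ∫⁻ ω, pointCount (W ω) (Metric.ball z 1) *
      {ω | ENNReal.ofReal c ≤ pointCount (W ω) (Metric.ball z ρ)}.indicator 1 ω ∂μ ≤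
      ENNReal.ofReal (((lam * Real.pi) ^ 2 + lam * Real.pi) ^ (1 / 2 : ℝ) *
        (lam * (Real.pi * ρ ^ 2) / (c - lam * (Real.pi * ρ ^ 2)) ^ 2) ^ (1 / 2 : ℝ)) := by
  have hms : MeasurableSet {ω | ENNReal.ofReal c ≤ pointCount (W ω) (Metric.ball z ρ)} :=
    measurableSet_le measurable_const (measurable_pointCount hW measurableSet_ball)
  have hpi := Real.pi_pos
  -- Cauchy–Schwarz separates the second moment of the count in the unit disc from the Chebyshev
  -- tail of the large disc. The bound does not depend on the centre.
  have h1 := ENNReal.lintegral_mul_le_Lp_mul_Lq μ (p := 2) (q := 2) Real.HolderConjugate.two_two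
    (measurable_pointCount hW (measurableSet_ball (x := z) (ε := 1))).aemeasurable
    (measurable_one.indicator hms : Measurable
      ({ω | ENNReal.ofReal c ≤ pointCount (W ω) (Metric.ball z ρ)}.indicator
        (1 : Ω → ℝ≥0∞))).aemeasurable
  refine h1.trans ?_
  rw [ENNReal.ofReal_mul (by positivity), ← ENNReal.ofReal_rpow_of_nonneg (by positivity) (by norm_num),
    ← ENNReal.ofReal_rpow_of_nonneg (by positivity) (by norm_num)]
  gcongr
  · simp only [ENNReal.rpow_ofNat]
    rw [h.lintegral_pointCount_sq hlam hW measurableSet_ball measure_ball_lt_top.ne,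
      EuclideanSpace.volume_ball_fin_two, ENNReal.ofReal_add (by positivity) (by positivity),
      ENNReal.ofReal_pow (by positivity), ENNReal.ofReal_mul hlam]
    simp
  · refine le_trans (le_of_eq ?_) (h.measure_ball_ge_le hlam hW z hρ hc)
    rw [← lintegral_indicator_one hms]
    refine lintegral_congr fun ω => ?_
    by_cases hω : ω ∈ {ω | ENNReal.ofReal c ≤ pointCount (W ω) (Metric.ball z ρ)} <;>
      simp [hω, Set.indicator]

end PoissonChebyshev

/-! ### Comparing nearby mobiles with nearby BSs. -/

section Counting

variable {M : ℕ} {D R : ℝ} {x : ℕ → Plane} {y : Mobile M → Plane}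

/-- A mobile within `D` of BS `k` has its own BS within `D + R`, and each BS serves `M` mobiles. The
`+ 1` accounts for BS `0`, which is not a point of the process. -/
theorem encard_nearMobiles_le (hR : ∀ i : Mobile M, dist (y i) (x i.1) ≤ R) (k : ℕ) :
    ((nearMobiles D x y k).encard : ℝ≥0∞) ≤
      M * (pointCount (fun l => x (l + 1)) (Metric.ball (x k) (D + R)) + 1) := by
  set S := {l | x (l + 1) ∈ Metric.ball (x k) (D + R)} with hS
  have hsub : nearMobiles D x y k ⊆ (insert 0 (Nat.succ '' S)) ×ˢ Set.univ := by
    rintro ⟨l, m⟩ hl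
    have h1 : dist (y (l, m)) (x k) < D := hl
    have h2 := hR (l, m)
    have h3 : dist (x l) (x k) < D + R := by
      have := dist_triangle (x l) (y (l, m)) (x k)
      rw [dist_comm (x l) (y (l, m))] at this
      simp only at h2
      linarith
    refine ⟨?_, Set.mem_univ _⟩
    cases l with
    | zero => exact Set.mem_insert _ _
    | succ l => exact Set.mem_insert_of_mem _ ⟨l, h3, rfl⟩
  have h1 : (nearMobiles D x y k).encard ≤ (S.encard + 1) * M := by
    refine (Set.encard_le_encard hsub).trans ?_
    rw [Set.encard_prod]
    gcongr
    · refine (Set.encard_insert_le _ _).trans ?_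
      rw [Nat.succ_injective.encard_image]
    · simp
  rw [pointCount_eq_encard, mul_comm]
  calc ((nearMobiles D x y k).encard : ℝ≥0∞) ≤ (((S.encard + 1) * M : ℕ∞) : ℝ≥0∞) := by
        exact_mod_cast h1
    _ = _ := by simp; rfl

theorem le_encard_nearMobiles (hR : ∀ i : Mobile M, dist (y i) (x i.1) ≤ R) (k : ℕ) :
    M * pointCount (fun l => x (l + 1)) (Metric.ball (x k) (D - R)) ≤
      ((nearMobiles D x y k).encard : ℝ≥0∞) := by
  set S := {l | x (l + 1) ∈ Metric.ball (x k) (D - R)} with hS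
  have hsub : (Nat.succ '' S) ×ˢ (Set.univ : Set (Fin M)) ⊆ nearMobiles D x y k := by
    rintro ⟨l, m⟩ ⟨⟨l, hl, rfl⟩, -⟩
    have h1 : dist (x (l + 1)) (x k) < D - R := hl
    have h2 := hR (l + 1, m)
    have := dist_triangle (y (l + 1, m)) (x (l + 1)) (x k)
    change dist (y (l + 1, m)) (x k) < D
    simp only at h2
    linarith
  have h1 : S.encard * M ≤ (nearMobiles D x y k).encard := by
    refine le_trans (le_of_eq ?_) (Set.encard_le_encard hsub)
    rw [Set.encard_prod, Nat.succ_injective.encard_image]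
    simp
  rw [pointCount_eq_encard, mul_comm]
  calc _ = ((S.encard * M : ℕ∞) : ℝ≥0∞) := by simp; rfl
    _ ≤ _ := by exact_mod_cast h1

theorem le_encard_of_not_isActive {L : ℕ} {k : ℕ} (h : ¬ IsActive L D x y k) :
    (L : ℝ≥0∞) ≤ (nearMobiles D x y k).encard := by
  have : ¬ (nearMobiles D x y k).encard < L := fun h' => h (Or.inl h')
  exact_mod_cast not_lt.1 this

theorem pointCount_mono {w : ℕ → Plane} {A B : Set Plane} (h : A ⊆ B) :
    pointCount w A ≤ pointCount w B :=
  ENNReal.tsum_le_tsum fun _ => Set.indicator_le_indicator_of_subset h (fun _ => zero_le) _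

end Counting

/-! ### Mean of the interference from the BSs of the process. -/

section FarInterference

set_option linter.unusedSectionVars false

variable {M L : ℕ} [NeZero M]

/-- The interference from all BSs other than BS `0` that do not null the typical mobile. -/
noncomputable def farInterference (α D : ℝ) (x : ℕ → Plane) (y : Mobile M → Plane)
    (φ : Mobile M → ℝ) (γ : Mobile M → ℕ → Fin L → ℂ) : ℝ≥0∞ :=
  ∑' k, farIndicator D x y (k + 1) * bsInterference α D x y φ γ (k + 1)

theorem farIndicator_mul_ofReal {D : ℝ} {x : ℕ → Plane} {y : Mobile M → Plane} (h0 : y (0, 0) = 0)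
    {c : ℝ} (hc : 0 ≤ c) (p : ℝ) (k : ℕ) :
    farIndicator D x y k * ENNReal.ofReal (c * dist (y (0, 0)) (x k) ^ (-p)) =
      ENNReal.ofReal c * ENNReal.ofReal (pathLoss p D (dist 0 (x k))) := by
  rw [ENNReal.ofReal_mul hc, h0, farIndicator, pathLoss]
  by_cases h : dist 0 (x k) < D
  · rw [if_pos (show ((0, 0) : Mobile M) ∈ nearMobiles D x y k by
      change dist (y (0, 0)) (x k) < D; rwa [h0]), if_neg (not_le.2 h)]
    simp
  · rw [if_neg (show ((0, 0) : Mobile M) ∉ nearMobiles D x y k by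
      change ¬ dist (y (0, 0)) (x k) < D; rwa [h0]), if_pos (not_lt.1 h), one_mul]

theorem bsPower_nonneg {φ : Mobile M → ℝ} {k : ℕ} : 0 ≤ bsPower φ k :=
  Finset.sum_nonneg fun _ _ => sq_nonneg _

theorem farIndicator_mul_bsMeanInterference {α D : ℝ} {x : ℕ → Plane} {y : Mobile M → Plane}
    (h0 : y (0, 0) = 0) (φ : Mobile M → ℝ) (k : ℕ) :
    farIndicator D x y k * bsMeanInterference L α D x y φ k =
      ENNReal.ofReal (activity L D x y k * bsPower φ k) *
        ENNReal.ofReal (pathLoss α D (dist 0 (x k))) :=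
  farIndicator_mul_ofReal h0 (mul_nonneg activity_nonneg bsPower_nonneg) α k

variable {Ω T : Type*} [MeasurableSpace Ω] [MeasurableSpace T] {μ : Measure Ω}
  [IsProbabilityMeasure μ] {α D P lam R : ℝ} {X : Ω → ℕ → Plane} {Y : Ω → Mobile M → Plane}
  {g : Ω → Mobile M → ℕ → Fin L → ℂ} {φ : Ω → Mobile M → ℝ} {τ : Ω → T} {x : T → ℕ → Plane}
  {y : T → Mobile M → Plane} {Ψ : T → (Mobile M → ℕ → Fin L → ℂ) → Mobile M → ℝ}

theorem measurable_shift {X : Ω → ℕ → Plane} (hX : Measurable X) :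
    Measurable fun ω k => X ω (k + 1) :=
  measurable_pi_iff.2 fun k => measurable_pi_iff.1 hX (k + 1)

theorem measurable_farInterference (hX : Measurable X) (hY : Measurable Y) (hφ : Measurable φ)
    (hg : Measurable g) :
    Measurable fun ω => farInterference α D (X ω) (Y ω) (φ ω) (g ω) :=
  Measurable.tsum fun k =>
    (measurable_farIndicator hX hY (k + 1)).mul (measurable_bsInterference hX hY hφ hg (k + 1))

theorem measurable_ofReal_pathLoss (hX : Measurable X) (p D : ℝ) (k : ℕ) :
    Measurable fun ω => ENNReal.ofReal (pathLoss p D (dist 0 (X ω k))) :=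
  ((measurable_pathLoss p D).comp
    (measurable_const.dist (measurable_pi_iff.1 hX k))).ennreal_ofReal

theorem measurable_active_power (hX : Measurable X) (hY : Measurable Y) (hφ : Measurable φ)
    (k : ℕ) : Measurable fun ω =>
      ENNReal.ofReal (activity L D (X ω) (Y ω) k * bsPower (φ ω) k) :=
  ((measurable_activity hX hY k).mul (measurable_bsPower hφ k)).ennreal_ofReal

theorem IsRepresentation.lintegral_farInterference
    (h : IsRepresentation μ D X Y g φ τ x y Ψ) (hg : IsRayleighFading μ g)
    (hnet : IsCellularNetwork μ lam R X Y) :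
    ∫⁻ ω, farInterference α D (X ω) (Y ω) (φ ω) (g ω) ∂μ =
      ∫⁻ ω, ∑' k, ENNReal.ofReal (activity L D (X ω) (Y ω) (k + 1) * bsPower (φ ω) (k + 1)) *
        ENNReal.ofReal (pathLoss α D (dist 0 (X ω (k + 1)))) ∂μ := by
  have hX := h.measurable_X
  have hY := h.measurable_Y
  have hφ := h.measurable_phi hg
  have hm1 : ∀ k, Measurable fun ω => farIndicator D (X ω) (Y ω) (k + 1) *
      bsInterference α D (X ω) (Y ω) (φ ω) (g ω) (k + 1) := fun k =>
    (measurable_farIndicator hX hY (k + 1)).mul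
      (measurable_bsInterference hX hY hφ hg.measurable (k + 1))
  have hm2 : ∀ k, Measurable fun ω =>
      ENNReal.ofReal (activity L D (X ω) (Y ω) (k + 1) * bsPower (φ ω) (k + 1)) *
        ENNReal.ofReal (pathLoss α D (dist 0 (X ω (k + 1)))) := fun k =>
    (measurable_active_power hX hY hφ (k + 1)).mul (measurable_ofReal_pathLoss hX α D (k + 1))
  unfold farInterference
  rw [lintegral_tsum fun k => (hm1 k).aemeasurable, lintegral_tsum fun k => (hm2 k).aemeasurable]
  refine tsum_congr fun k => ?_
  rw [h.lintegral_bsInterference hg k.succ_ne_zero]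
  refine lintegral_congr_ae ?_
  filter_upwards [hnet.typical_at_origin] with ω hω
  exact farIndicator_mul_bsMeanInterference hω _ _

theorem IsCellularNetwork.lintegral_tsum_pathLoss (hnet : IsCellularNetwork μ lam R X Y)
    (hlam : 0 ≤ lam) {p : ℝ} (hp : 2 < p) (hD : 0 < D) :
    ∫⁻ ω, ∑' k, ENNReal.ofReal (pathLoss p D (dist 0 (X ω (k + 1)))) ∂μ =
      ENNReal.ofReal lam * ENNReal.ofReal (2 * Real.pi * D ^ (2 - p) / (p - 2)) := by
  rw [hnet.poisson.lintegral_tsum_points hlam (measurable_shift hnet.measurable_bs)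
    (f := fun z => ENNReal.ofReal (pathLoss p D (dist 0 z)))
    ((measurable_pathLoss p D).comp (measurable_const.dist measurable_id)).ennreal_ofReal,
    lintegral_pathLoss hp hD]

theorem active_power_le (hω : ∀ k, bsPower (φ ω) k ≤ P) (k : ℕ) {z : ℕ → Plane}
    {y : Mobile M → Plane} :
    ENNReal.ofReal (activity L D z y k * bsPower (φ ω) k) ≤ ENNReal.ofReal P := by
  refine ENNReal.ofReal_le_ofReal ?_
  have := mul_le_mul (activity_le_one (L := L) (D := D) (x := z) (y := y) (k := k)) (hω k)
    bsPower_nonneg zero_le_one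
  linarith

theorem IsRepresentation.lintegral_farInterference_le
    (h : IsRepresentation μ D X Y g φ τ x y Ψ) (hg : IsRayleighFading μ g)
    (hnet : IsCellularNetwork μ lam R X Y) (hP : ∀ᵐ ω ∂μ, ∀ k, bsPower (φ ω) k ≤ P)
    (hlam : 0 ≤ lam) (hα : 2 < α) (hD : 0 < D) :
    ∫⁻ ω, farInterference α D (X ω) (Y ω) (φ ω) (g ω) ∂μ ≤
      ENNReal.ofReal P * (ENNReal.ofReal lam *
        ENNReal.ofReal (2 * Real.pi * D ^ (2 - α) / (α - 2))) := by
  rw [h.lintegral_farInterference hg hnet, ← hnet.lintegral_tsum_pathLoss hlam hα hD,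
    ← lintegral_const_mul' _ _ ENNReal.ofReal_ne_top]
  refine lintegral_mono_ae ?_
  filter_upwards [hP] with ω hω
  rw [← ENNReal.tsum_mul_left]
  exact ENNReal.tsum_le_tsum fun k => mul_le_mul_left (active_power_le hω (k + 1)) _

/-- The mean path loss of the inactive BSs. -/
noncomputable def inactivePathLoss (μ : Measure Ω) (L : ℕ) (α D : ℝ) (X : Ω → ℕ → Plane)
    (Y : Ω → Mobile M → Plane) : ℝ≥0∞ :=
  ∫⁻ ω, ∑' k, ENNReal.ofReal (1 - activity L D (X ω) (Y ω) (k + 1)) *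
    ENNReal.ofReal (pathLoss α D (dist 0 (X ω (k + 1)))) ∂μ

/-- The hypothesis says that two measures on the distance axis agree on Borel sets; hence they
integrate every `f` alike. This carries the Campbell form of the mean power condition over to the
path loss. -/
theorem lintegral_tsum_mul_eq_of_indicator {u v : ℕ → Ω → ℝ≥0∞} {ρ : ℕ → Ω → ℝ}
    (hu : ∀ k, Measurable (u k)) (hv : ∀ k, Measurable (v k)) (hρ : ∀ k, Measurable (ρ k))
    (h : ∀ B : Set ℝ, MeasurableSet B → ∫⁻ ω, ∑' k, B.indicator (fun _ => u k ω) (ρ k ω) ∂μ =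
      ∫⁻ ω, ∑' k, B.indicator (fun _ => v k ω) (ρ k ω) ∂μ)
    {f : ℝ → ℝ≥0∞} (hf : Measurable f) :
    ∫⁻ ω, ∑' k, u k ω * f (ρ k ω) ∂μ = ∫⁻ ω, ∑' k, v k ω * f (ρ k ω) ∂μ := by
  have key : ∀ w : ℕ → Ω → ℝ≥0∞, (∀ k, Measurable (w k)) → (∀ B : Set ℝ, MeasurableSet B →
      ∫⁻ ω, ∑' k, B.indicator (fun _ => w k ω) (ρ k ω) ∂μ =
        Measure.sum (fun k => (μ.withDensity (w k)).map (ρ k)) B) ∧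
      ∫⁻ ω, ∑' k, w k ω * f (ρ k ω) ∂μ =
        ∫⁻ r, f r ∂(Measure.sum fun k => (μ.withDensity (w k)).map (ρ k)) := by
    intro w hw
    refine ⟨fun B hB => ?_, ?_⟩
    · have e : ∀ k, (fun ω => B.indicator (fun _ => w k ω) (ρ k ω)) =
          (ρ k ⁻¹' B).indicator (w k) := fun k => by
        funext ω
        by_cases hB : ρ k ω ∈ B <;> simp [hB, Set.indicator]
      have hm : ∀ k, Measurable fun ω => B.indicator (fun _ => w k ω) (ρ k ω) := fun k => by
        rw [e k]; exact (hw k).indicator (hρ k hB)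
      rw [lintegral_tsum fun k => (hm k).aemeasurable, Measure.sum_apply _ hB]
      refine tsum_congr fun k => ?_
      rw [e k, lintegral_indicator (hρ k hB), Measure.map_apply (hρ k) hB,
        withDensity_apply _ (hρ k hB)]
    · have hm : ∀ k, Measurable fun ω => w k ω * f (ρ k ω) := fun k =>
        (hw k).mul (hf.comp (hρ k))
      rw [lintegral_tsum fun k => (hm k).aemeasurable, lintegral_sum_measure]
      refine tsum_congr fun k => ?_
      rw [lintegral_map hf (hρ k)]
      exact (lintegral_withDensity_eq_lintegral_mul _ (hw k) (hf.comp (hρ k))).symm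
  rw [(key u hu).2, (key v hv).2]
  congr 1
  ext B hB
  rw [← (key u hu).1 B hB, ← (key v hv).1 B hB, h B hB]

/-- Beyond `D` the mean power of an active BS is at least `Pbar - |δ| D^(-γ)`. Crediting each
inactive BS with `Pbar` makes this bound valid for all BSs, and then Campbell's formula for the
Poisson process applies. -/
theorem IsRepresentation.le_lintegral_farInterference
    (h : IsRepresentation μ D X Y g φ τ x y Ψ) (hg : IsRayleighFading μ g)
    (hnet : IsCellularNetwork μ lam R X Y) {Pbar δ γ : ℝ}
    (hmean : MeanPowerCondition μ L D Pbar δ γ X Y φ)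
    (hlam : 0 ≤ lam) (hα : 2 < α) (hD : 0 < D) (hγ : 0 ≤ γ) :
    ENNReal.ofReal (Pbar - |δ| * D ^ (-γ)) * (ENNReal.ofReal lam *
        ENNReal.ofReal (2 * Real.pi * D ^ (2 - α) / (α - 2))) ≤
      ∫⁻ ω, farInterference α D (X ω) (Y ω) (φ ω) (g ω) ∂μ +
        ENNReal.ofReal Pbar * inactivePathLoss μ L α D X Y := by
  have hX := h.measurable_X
  have hY := h.measurable_Y
  have hφ := h.measurable_phi hg
  obtain ⟨ξ, hξm, hξ, hB⟩ := hmean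
  have hdist : ∀ k, Measurable fun ω => dist 0 (X ω (k + 1)) := fun k =>
    measurable_const.dist (measurable_pi_iff.1 hX (k + 1))
  have h1 := lintegral_tsum_mul_eq_of_indicator (μ := μ)
    (u := fun k ω => ENNReal.ofReal (activity L D (X ω) (Y ω) (k + 1) * bsPower (φ ω) (k + 1)))
    (v := fun k ω => ENNReal.ofReal (activity L D (X ω) (Y ω) (k + 1) *
      (Pbar + ξ (dist 0 (X ω (k + 1))))))
    (ρ := fun k ω => dist 0 (X ω (k + 1)))
    (fun k => measurable_active_power hX hY hφ (k + 1))
    (fun k => ((measurable_activity hX hY (k + 1)).mul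
      ((hξm.comp (hdist k)).const_add _)).ennreal_ofReal) hdist
    (fun B hBm => by
      rw [hB B hBm]
      refine lintegral_congr fun ω => tsum_congr fun k => ?_
      simp [Set.indicator])
    (f := fun r => ENNReal.ofReal (pathLoss α D r)) (measurable_pathLoss α D).ennreal_ofReal
  rw [h.lintegral_farInterference hg hnet, h1, inactivePathLoss,
    ← hnet.lintegral_tsum_pathLoss hlam hα hD, ← lintegral_const_mul' _ _ ENNReal.ofReal_ne_top,
    ← lintegral_const_mul' _ _ ENNReal.ofReal_ne_top]
  have hm : Measurable fun ω => ∑' k, ENNReal.ofReal (activity L D (X ω) (Y ω) (k + 1) *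
      (Pbar + ξ (dist 0 (X ω (k + 1))))) * ENNReal.ofReal (pathLoss α D (dist 0 (X ω (k + 1)))) :=
    Measurable.tsum fun k => (((measurable_activity hX hY (k + 1)).mul
      ((hξm.comp (hdist k)).const_add _)).ennreal_ofReal).mul
        (measurable_ofReal_pathLoss hX α D (k + 1))
  rw [← lintegral_add_left hm]
  refine lintegral_mono fun ω => ?_
  rw [← ENNReal.tsum_mul_left, ← ENNReal.tsum_mul_left, ← ENNReal.tsum_add]
  refine ENNReal.tsum_le_tsum fun k => ?_
  rw [← mul_assoc, ← add_mul]
  by_cases hr : D ≤ dist 0 (X ω (k + 1))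
  · gcongr
    have hc : Pbar - |δ| * D ^ (-γ) ≤ Pbar + ξ (dist 0 (X ω (k + 1))) := by
      have h2 := (abs_le.1 (hξ _ (hD.trans_le hr))).1
      have h3 : dist 0 (X ω (k + 1)) ^ (-γ) ≤ D ^ (-γ) :=
        Real.rpow_le_rpow_of_nonpos hD hr (by linarith)
      have h4 := mul_le_mul (le_abs_self δ) h3 (Real.rpow_nonneg dist_nonneg _) (abs_nonneg δ)
      linarith
    have hcP : Pbar - |δ| * D ^ (-γ) ≤ Pbar := by
      have := mul_nonneg (abs_nonneg δ) (Real.rpow_nonneg hD.le (-γ))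
      linarith
    by_cases ha : IsActive L D (X ω) (Y ω) (k + 1)
    · simpa [activity, ha] using ENNReal.ofReal_le_ofReal hc
    · simpa [activity, ha] using ENNReal.ofReal_le_ofReal hcP
  · rw [pathLoss, if_neg hr]
    simp

end FarInterference

/-! ### The path loss of the inactive BSs is negligible. -/

section Inactive

set_option linter.unusedSectionVars false

variable {M L : ℕ} [NeZero M] {Ω : Type*} [MeasurableSpace Ω] {μ : Measure Ω}
  [IsProbabilityMeasure μ] {α D lam R : ℝ} {X : Ω → ℕ → Plane} {Y : Ω → Mobile M → Plane}

/-- Inactivity forces at least `L` mobiles into `𝒟_k`, hence at least `L / M - 1` BSs of the process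
into a disc about BS `k`. The extra radius `1` allows any nearby centre `z` instead of the random
one. -/
theorem le_pointCount_of_not_isActive {x : ℕ → Plane} {y : Mobile M → Plane}
    (hR : ∀ i : Mobile M, dist (y i) (x i.1) ≤ R) {k : ℕ} (h : ¬ IsActive L D x y k) {z : Plane}
    (hz : dist (x k) z < 1) :
    ENNReal.ofReal (L / M - 1) ≤
      pointCount (fun l => x (l + 1)) (Metric.ball z (D + R + 1)) := by
  have hM : (0 : ℝ) < M := by exact_mod_cast NeZero.pos M
  have h1 := (le_encard_of_not_isActive h).trans (encard_nearMobiles_le hR k)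
  have hsub : Metric.ball (x k) (D + R) ⊆ Metric.ball z (D + R + 1) :=
    Metric.ball_subset_ball' (by linarith)
  have h2 := h1.trans (mul_le_mul_right (add_le_add_left
    (pointCount_mono (w := fun l => x (l + 1)) hsub) 1) (M : ℝ≥0∞))
  set N := pointCount (fun l => x (l + 1)) (Metric.ball z (D + R + 1))
  clear_value N
  by_cases hN : N = ∞
  · rw [hN]; exact le_top
  · lift N to ℝ≥0 using hN
    have h3 : (L : ℝ) ≤ M * (N + 1) := by exact_mod_cast h2
    rw [← ENNReal.ofReal_coe_nnreal]
    refine ENNReal.ofReal_le_ofReal ?_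
    have : (L : ℝ) / M ≤ N + 1 := by rw [div_le_iff₀ hM]; linarith
    linarith

theorem measurable_pointCount_ball {A : Type*} [MeasurableSpace A] {w : A → ℕ → Plane}
    {z : A → Plane} (hw : Measurable w) (hz : Measurable z) (r : ℝ) :
    Measurable fun a => pointCount (w a) (Metric.ball (z a) r) := by
  refine Measurable.tsum fun k => ?_
  have hms : MeasurableSet {a : A | dist (w a k) (z a) < r} :=
    measurableSet_lt ((measurable_pi_iff.1 hw k).dist hz) measurable_const
  exact measurable_one.indicator hms

/-- Each inactive BS is averaged over the unit disc around it, of area `π`. At the deterministic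
centre `z` only counts of the process remain, so no conditioning on a point of the process is
needed. -/
theorem tsum_inactive_le {x : ℕ → Plane} {y : Mobile M → Plane}
    (hR : ∀ i : Mobile M, dist (y i) (x i.1) ≤ R) (hα : 0 ≤ α) (hD : 2 ≤ D) :
    ∑' k, ENNReal.ofReal (1 - activity L D x y (k + 1)) *
      ENNReal.ofReal (pathLoss α D (dist 0 (x (k + 1)))) ≤
      ENNReal.ofReal Real.pi⁻¹ * ∫⁻ z, ENNReal.ofReal (2 ^ α * pathLoss α (D / 2) (dist 0 z)) *
        (pointCount (fun l => x (l + 1)) (Metric.ball z 1) *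
          {z : Plane | ENNReal.ofReal (L / M - 1) ≤
            pointCount (fun l => x (l + 1)) (Metric.ball z (D + R + 1))}.indicator 1 z) := by
  have hpi := Real.pi_pos
  set E : Set Plane := {z : Plane | ENNReal.ofReal (L / M - 1) ≤
    pointCount (fun l => x (l + 1)) (Metric.ball z (D + R + 1))} with hE
  have hEm : MeasurableSet E := measurableSet_le measurable_const
    (measurable_pointCount_ball measurable_const measurable_id _)
  have hHs : ∀ z, ENNReal.ofReal (2 ^ α * pathLoss α (D / 2) (dist 0 z)) *
        (pointCount (fun l => x (l + 1)) (Metric.ball z 1) * E.indicator 1 z) =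
      ∑' k, ENNReal.ofReal (2 ^ α * pathLoss α (D / 2) (dist 0 z)) *
        ((Metric.ball z 1).indicator 1 (x (k + 1)) * E.indicator 1 z) := by
    intro z
    rw [ENNReal.tsum_mul_left, ENNReal.tsum_mul_right]
    rfl
  have hm : ∀ k, Measurable fun z : Plane =>
      ENNReal.ofReal (2 ^ α * pathLoss α (D / 2) (dist 0 z)) *
        ((Metric.ball z 1).indicator 1 (x (k + 1)) * E.indicator 1 z) := by
    intro k
    refine (((measurable_pathLoss α (D / 2)).comp
      (measurable_const.dist measurable_id)).const_mul _).ennreal_ofReal.mul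
      (Measurable.mul ?_ (measurable_one.indicator hEm))
    have hms : MeasurableSet {z : Plane | dist (x (k + 1)) z < 1} :=
      measurableSet_lt (measurable_const.dist measurable_id) measurable_const
    exact measurable_one.indicator hms
  rw [lintegral_congr hHs, lintegral_tsum fun k => (hm k).aemeasurable, ← ENNReal.tsum_mul_left]
  refine ENNReal.tsum_le_tsum fun k => ?_
  by_cases ha : IsActive L D x y (k + 1)
  · simp [activity, ha]
  have hball : ∫⁻ z : Plane, ENNReal.ofReal (pathLoss α D (dist 0 (x (k + 1)))) *
      (Metric.ball (x (k + 1)) 1).indicator 1 z =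
      ENNReal.ofReal (pathLoss α D (dist 0 (x (k + 1)))) * ENNReal.ofReal Real.pi := by
    rw [lintegral_const_mul _ (measurable_one.indicator measurableSet_ball),
      lintegral_indicator_one measurableSet_ball, EuclideanSpace.volume_ball_fin_two]
    simp
  have e1 : ENNReal.ofReal (pathLoss α D (dist 0 (x (k + 1)))) =
      ENNReal.ofReal Real.pi⁻¹ * ∫⁻ z : Plane,
        ENNReal.ofReal (pathLoss α D (dist 0 (x (k + 1)))) *
          (Metric.ball (x (k + 1)) 1).indicator 1 z := by
    rw [hball, mul_left_comm, ← ENNReal.ofReal_mul (by positivity), inv_mul_cancel₀ hpi.ne']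
    simp
  have e2 : activity L D x y (k + 1) = 0 := by simp [activity, ha]
  rw [e2, sub_zero, ENNReal.ofReal_one, one_mul, e1]
  refine mul_le_mul_right (lintegral_mono fun z => ?_) _
  by_cases hz : z ∈ Metric.ball (x (k + 1)) 1
  · have hz' : dist (x (k + 1)) z < 1 := by rw [dist_comm]; exact hz
    have hmem : z ∈ E := le_pointCount_of_not_isActive hR ha hz'
    rw [Set.indicator_of_mem hz, Set.indicator_of_mem hmem,
      Set.indicator_of_mem (show x (k + 1) ∈ Metric.ball z 1 from hz')]
    simp only [Pi.one_apply, mul_one]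
    exact ENNReal.ofReal_le_ofReal (pathLoss_le_of_dist_lt_one hα hD hz')
  · rw [Set.indicator_of_notMem hz, mul_zero]
    exact zero_le

/-- By Tonelli the expectation is taken at each centre `z` separately, where the Cauchy–Schwarz and
Chebyshev bound holds uniformly in `z`; the path loss is then integrated over the plane. -/
theorem IsCellularNetwork.inactivePathLoss_le (hnet : IsCellularNetwork μ lam R X Y)
    (hlam : 0 ≤ lam) (hα : 2 < α) (hD : 2 ≤ D) (hR : 0 ≤ R)
    (hL : lam * (Real.pi * (D + R + 1) ^ 2) < L / M - 1) :
    inactivePathLoss μ L α D X Y ≤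
      ENNReal.ofReal (Real.pi⁻¹ * (2 ^ α * (2 * Real.pi * (D / 2) ^ (2 - α) / (α - 2))) *
        (((lam * Real.pi) ^ 2 + lam * Real.pi) ^ (1 / 2 : ℝ) *
        (lam * (Real.pi * (D + R + 1) ^ 2) /
          (L / M - 1 - lam * (Real.pi * (D + R + 1) ^ 2)) ^ 2) ^ (1 / 2 : ℝ))) := by
  have hpi := Real.pi_pos
  set ρ := D + R + 1 with hρ
  have hX := hnet.measurable_bs
  have hY := hnet.measurable_mobile
  set W : Ω → ℕ → Plane := fun ω k => X ω (k + 1) with hWdef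
  have hW : Measurable W := measurable_shift hX
  set c := (L : ℝ) / M - 1 with hc
  set ε := ((lam * Real.pi) ^ 2 + lam * Real.pi) ^ (1 / 2 : ℝ) *
        (lam * (Real.pi * ρ ^ 2) / (c - lam * (Real.pi * ρ ^ 2)) ^ 2) ^ (1 / 2 : ℝ) with hε
  set f : Plane → ℝ≥0∞ := fun z => ENNReal.ofReal (2 ^ α * pathLoss α (D / 2) (dist 0 z)) with hf
  have hfm : Measurable f := (((measurable_pathLoss α (D / 2)).comp
    (measurable_const.dist measurable_id)).const_mul _).ennreal_ofReal
  set H : Plane → Ω → ℝ≥0∞ := fun z ω => pointCount (W ω) (Metric.ball z 1) *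
      {ω | ENNReal.ofReal c ≤ pointCount (W ω) (Metric.ball z ρ)}.indicator 1 ω with hH
  have hcount : ∀ r, Measurable fun p : Plane × Ω => pointCount (W p.2) (Metric.ball p.1 r) :=
    measurable_pointCount_ball (hW.comp measurable_snd) measurable_fst
  have hHm : Measurable fun p : Plane × Ω => H p.1 p.2 := by
    refine (hcount 1).mul ?_
    exact measurable_one.indicator (measurableSet_le measurable_const (hcount ρ))
  have hpoint : ∀ᵐ ω ∂μ, ∑' k, ENNReal.ofReal (1 - activity L D (X ω) (Y ω) (k + 1)) *
      ENNReal.ofReal (pathLoss α D (dist 0 (X ω (k + 1)))) ≤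
      ENNReal.ofReal Real.pi⁻¹ * ∫⁻ z, f z * H z ω := by
    filter_upwards [hnet.dist_serving_le] with ω hω
    exact tsum_inactive_le hω (by linarith) hD
  have hswap : ∫⁻ ω, (∫⁻ z, f z * H z ω) ∂μ = ∫⁻ z, (∫⁻ ω, f z * H z ω ∂μ) :=
    lintegral_lintegral_swap (((hfm.comp measurable_snd).mul
      (hHm.comp (measurable_snd.prodMk measurable_fst))).aemeasurable)
  calc inactivePathLoss μ L α D X Y
      ≤ ∫⁻ ω, ENNReal.ofReal Real.pi⁻¹ * (∫⁻ z, f z * H z ω) ∂μ := lintegral_mono_ae hpoint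
    _ = ENNReal.ofReal Real.pi⁻¹ * ∫⁻ z, ∫⁻ ω, f z * H z ω ∂μ := by
        rw [lintegral_const_mul' _ _ ENNReal.ofReal_ne_top, hswap]
    _ ≤ ENNReal.ofReal Real.pi⁻¹ * ∫⁻ z, f z * ENNReal.ofReal ε := by
        refine mul_le_mul_right (lintegral_mono fun z => ?_) _
        rw [lintegral_const_mul' _ _ ENNReal.ofReal_ne_top]
        exact mul_le_mul_right
          (hnet.poisson.lintegral_unit_ball_indicator_le hlam hW z (by linarith) hL) _
    _ = _ := by
        have hα2 : 0 < α - 2 := by linarith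
        rw [lintegral_mul_const' _ _ ENNReal.ofReal_ne_top, ← mul_assoc]
        have : ∫⁻ z, f z = ENNReal.ofReal (2 ^ α * (2 * Real.pi * (D / 2) ^ (2 - α) / (α - 2))) := by
          have hD2 : 0 < D / 2 := by linarith
          rw [ENNReal.ofReal_mul (by positivity), ← lintegral_pathLoss hα hD2,
            ← lintegral_const_mul' _ _ ENNReal.ofReal_ne_top]
          exact lintegral_congr fun z => ENNReal.ofReal_mul (by positivity)
        have hD2 : 0 ≤ (D / 2) ^ (2 - α) := Real.rpow_nonneg (by linarith) _
        rw [this, ← ENNReal.ofReal_mul (by positivity), ← ENNReal.ofReal_mul (by positivity)]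

end Inactive

/-! ### Second moment of the interference from the BSs of the process. -/

section SecondMoment

set_option linter.unusedSectionVars false

variable {M L : ℕ} [NeZero M] {Ω T : Type*} [MeasurableSpace Ω] [MeasurableSpace T] {μ : Measure Ω}
  [IsProbabilityMeasure μ] {α D P Pbar δ γ lam R : ℝ} {X : Ω → ℕ → Plane} {Y : Ω → Mobile M → Plane}
  {g : Ω → Mobile M → ℕ → Fin L → ℂ} {φ : Ω → Mobile M → ℝ} {τ : Ω → T} {x : T → ℕ → Plane}
  {y : T → Mobile M → Plane} {Ψ : T → (Mobile M → ℕ → Fin L → ℂ) → Mobile M → ℝ}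

/-- The bound on the power correlation of two BSs at distance `d`. -/
noncomputable def correlationBound (P Pbar δ γ t d : ℝ) : ℝ≥0∞ :=
  ENNReal.ofReal (Pbar ^ 2 + |δ| * t ^ (-γ)) +
    (Set.Iio t).indicator (fun _ => ENNReal.ofReal (P ^ 2)) d

theorem measurable_correlationBound (P Pbar δ γ t : ℝ) :
    Measurable (correlationBound P Pbar δ γ t) :=
  Measurable.add (f := fun _ => ENNReal.ofReal (Pbar ^ 2 + |δ| * t ^ (-γ))) measurable_const
    (measurable_const.indicator measurableSet_Iio)

/-- Beyond distance `t` the decay of the correlation error is used, below `t` only the crude error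
bound `P²`. The cut `t` is chosen later. -/
theorem ofReal_le_correlationBound {t d v : ℝ} (ht : 0 < t) (hγ : 0 ≤ γ)
    (hv : |v - Pbar ^ 2| ≤ min (P ^ 2) (δ * d ^ (-γ))) :
    ENNReal.ofReal v ≤ correlationBound P Pbar δ γ t d := by
  have hp : 0 ≤ |δ| * t ^ (-γ) := mul_nonneg (abs_nonneg _) (Real.rpow_nonneg ht.le _)
  unfold correlationBound
  by_cases hd : d < t
  · rw [Set.indicator_of_mem (Set.mem_Iio.2 hd), ← ENNReal.ofReal_add (by positivity) (by positivity)]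
    refine ENNReal.ofReal_le_ofReal ?_
    have := (abs_le.1 (hv.trans (min_le_left _ _))).2
    linarith
  · rw [Set.indicator_of_notMem (by simpa using hd), add_zero]
    refine ENNReal.ofReal_le_ofReal ?_
    have h1 := (abs_le.1 (hv.trans (min_le_right _ _))).2
    have h2 : d ^ (-γ) ≤ t ^ (-γ) := Real.rpow_le_rpow_of_nonpos ht (not_lt.1 hd) (by linarith)
    have h3 := mul_le_mul (le_abs_self δ) h2
      (Real.rpow_nonneg (ht.le.trans (not_lt.1 hd)) _) (abs_nonneg δ)
    linarith

/-- A bound on a conditional expectation carries over to weighted integrals. -/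
theorem lintegral_mul_le_of_condExp_le {A : Type*} [mA : MeasurableSpace A] {ν : Measure Ω}
    [IsFiniteMeasure ν] {ψ : Ω → A} (hψ : Measurable ψ) {G : Ω → ℝ} (hG : Integrable G ν)
    (hG0 : 0 ≤ G) {H : A → ℝ≥0∞} (hH : Measurable H)
    (hle : ∀ᵐ ω ∂ν, ENNReal.ofReal (condExp (mA.comap ψ) ν G ω) ≤ H (ψ ω))
    {F : A → ℝ≥0∞} (hF : Measurable F) :
    ∫⁻ ω, ENNReal.ofReal (G ω) * F (ψ ω) ∂ν ≤ ∫⁻ ω, H (ψ ω) * F (ψ ω) ∂ν := by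
  have hm : mA.comap ψ ≤ ‹MeasurableSpace Ω› := hψ.comap_le
  have hGm : AEMeasurable (fun ω => ENNReal.ofReal (G ω)) ν := hG.aemeasurable.ennreal_ofReal
  have hHm : Measurable fun ω => H (ψ ω) := hH.comp hψ
  -- The defining property of the conditional expectation compares the two densities on every `ψ ⁻¹'
  -- B`, that is, it orders the image measures; arbitrary weights `F ∘ ψ` follow.
  have hmeas : (ν.withDensity fun ω => ENNReal.ofReal (G ω)).map ψ ≤
      (ν.withDensity fun ω => H (ψ ω)).map ψ := by
    refine Measure.le_iff.2 fun B hB => ?_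
    rw [Measure.map_apply hψ hB, Measure.map_apply hψ hB, withDensity_apply _ (hψ hB),
      withDensity_apply _ (hψ hB)]
    have hc0 : 0 ≤ᵐ[ν] condExp (mA.comap ψ) ν G := condExp_nonneg (.of_forall hG0)
    calc ∫⁻ ω in ψ ⁻¹' B, ENNReal.ofReal (G ω) ∂ν
        = ENNReal.ofReal (∫ ω in ψ ⁻¹' B, G ω ∂ν) :=
          (ofReal_integral_eq_lintegral_ofReal hG.integrableOn (.of_forall hG0)).symm
      _ = ENNReal.ofReal (∫ ω in ψ ⁻¹' B, condExp (mA.comap ψ) ν G ω ∂ν) := by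
          rw [setIntegral_condExp hm hG ⟨B, hB, rfl⟩]
      _ = ∫⁻ ω in ψ ⁻¹' B, ENNReal.ofReal (condExp (mA.comap ψ) ν G ω) ∂ν :=
          ofReal_integral_eq_lintegral_ofReal integrable_condExp.integrableOn
            (ae_restrict_of_ae hc0)
      _ ≤ ∫⁻ ω in ψ ⁻¹' B, H (ψ ω) ∂ν := lintegral_mono_ae (ae_restrict_of_ae hle)
  have hFψ : Measurable fun ω => F (ψ ω) := hF.comp hψ
  calc ∫⁻ ω, ENNReal.ofReal (G ω) * F (ψ ω) ∂ν
      = ∫⁻ a, F a ∂((ν.withDensity fun ω => ENNReal.ofReal (G ω)).map ψ) := by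
        rw [lintegral_map hF hψ]
        exact (lintegral_withDensity_eq_lintegral_mul₀ hGm hFψ.aemeasurable).symm
    _ ≤ ∫⁻ a, F a ∂((ν.withDensity fun ω => H (ψ ω)).map ψ) := lintegral_mono' hmeas le_rfl
    _ = _ := by
        rw [lintegral_map hF hψ]
        exact lintegral_withDensity_eq_lintegral_mul _ hHm hFψ

/-- The activities restrict the integral to the event on which the correlation condition is
conditioned, and the normalisation of the conditional measure cancels. Dropping the restriction on
the right only enlarges the bound. -/
theorem lintegral_active_power_mul_le (hX : Measurable X) (hY : Measurable Y) (hφ : Measurable φ)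
    (hP : ∀ᵐ ω ∂μ, ∀ k, bsPower (φ ω) k ≤ P)
    (hcorr : PowerCorrelationCondition μ L D P Pbar δ γ X Y φ) {t : ℝ} (ht : 0 < t) (hγ : 0 ≤ γ)
    {k l : ℕ} (hk : k ≠ 0) (hl : l ≠ 0) (hkl : k ≠ l) {F : (ℕ → Plane) → ℝ≥0∞} (hF : Measurable F) :
    ∫⁻ ω, ENNReal.ofReal (activity L D (X ω) (Y ω) k * bsPower (φ ω) k) *
        ENNReal.ofReal (activity L D (X ω) (Y ω) l * bsPower (φ ω) l) * F (X ω) ∂μ ≤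
      ∫⁻ ω, correlationBound P Pbar δ γ t (dist (X ω k) (X ω l)) * F (X ω) ∂μ := by
  set A := {ω | IsActive L D (X ω) (Y ω) k ∧ IsActive L D (X ω) (Y ω) l} with hA
  have hAm : MeasurableSet A := (measurableSet_isActive hX hY k).inter (measurableSet_isActive hX hY l)
  set G : Ω → ℝ := fun ω => bsPower (φ ω) k * bsPower (φ ω) l with hG
  have hGm : Measurable G := (measurable_bsPower hφ k).mul (measurable_bsPower hφ l)
  have hG0 : 0 ≤ G := fun ω => mul_nonneg bsPower_nonneg bsPower_nonneg
  have hleft : ∫⁻ ω, ENNReal.ofReal (activity L D (X ω) (Y ω) k * bsPower (φ ω) k) *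
        ENNReal.ofReal (activity L D (X ω) (Y ω) l * bsPower (φ ω) l) * F (X ω) ∂μ =
      ∫⁻ ω in A, ENNReal.ofReal (G ω) * F (X ω) ∂μ := by
    rw [← lintegral_indicator hAm]
    refine lintegral_congr fun ω => ?_
    by_cases h1 : IsActive L D (X ω) (Y ω) k <;> by_cases h2 : IsActive L D (X ω) (Y ω) l <;>
      simp [activity, h1, h2, hA, hG, Set.indicator, ENNReal.ofReal_mul, bsPower_nonneg]
  rw [hleft]
  refine le_trans ?_ (setLIntegral_le_lintegral A _)
  by_cases h0 : μ A = 0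
  · rw [Measure.restrict_eq_zero.2 h0]
    simp
  have hac : cond μ A ≪ μ := cond_absolutelyContinuous
  have : IsProbabilityMeasure (cond μ A) := cond_isProbabilityMeasure h0
  have hGint : Integrable G (cond μ A) := by
    refine Integrable.of_bound hGm.aestronglyMeasurable (P * P) ?_
    filter_upwards [hac.ae_le hP] with ω hω
    rw [Real.norm_of_nonneg (hG0 ω)]
    exact mul_le_mul (hω k) (hω l) bsPower_nonneg (bsPower_nonneg.trans (hω k))
  have hHm : Measurable fun x : ℕ → Plane => correlationBound P Pbar δ γ t (dist (x k) (x l)) :=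
    (measurable_correlationBound _ _ _ _ _).comp ((measurable_pi_apply k).dist (measurable_pi_apply l))
  have h1 := lintegral_mul_le_of_condExp_le (ν := cond μ A) hX hGint hG0 hHm
    (by
      filter_upwards [hcorr k l hk hl hkl] with ω hω
      exact ofReal_le_correlationBound ht hγ hω) hF
  rw [ProbabilityTheory.cond, lintegral_smul_measure, lintegral_smul_measure, smul_eq_mul, smul_eq_mul] at h1
  exact (ENNReal.mul_le_mul_iff_right (ENNReal.inv_ne_zero.2 (measure_ne_top μ A))
    (ENNReal.inv_ne_top.2 h0)).1 h1

theorem tsum_sq_eq_add_offDiag (u : ℕ → ℝ≥0∞) :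
    (∑' k, u k) ^ 2 = ∑' k, u k ^ 2 + ∑' p : ℕ × ℕ, (if p.1 = p.2 then 0 else u p.1 * u p.2) := by
  have h1 : (∑' k, u k) ^ 2 = ∑' p : ℕ × ℕ, u p.1 * u p.2 := by
    rw [sq, ENNReal.tsum_prod (f := fun k l => u k * u l), ← ENNReal.tsum_mul_right]
    exact tsum_congr fun k => ENNReal.tsum_mul_left.symm
  have h2 : ∑' k, u k ^ 2 = ∑' p : ℕ × ℕ, (if p.2 = p.1 then u p.1 ^ 2 else 0) := by
    rw [ENNReal.tsum_prod (f := fun k l => if l = k then u k ^ 2 else 0)]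
    exact tsum_congr fun k => (tsum_ite_eq k fun _ => u k ^ 2).symm
  rw [h1, h2, ← ENNReal.tsum_add]
  refine tsum_congr fun p => ?_
  by_cases hp : p.1 = p.2
  · rw [if_pos hp, if_pos hp.symm, add_zero, hp, sq]
  · rw [if_neg hp, if_neg (Ne.symm hp), zero_add]

/-- For far pairs the integral factorises. For pairs closer than `t` the second path loss is at most
`D^(-α)` and the second point ranges over a disc of area `π t²`. -/
theorem lintegral_lintegral_correlation_le (hα : 2 < α) (hD : 0 < D) {t : ℝ} (ht : 0 < t) :
    ∫⁻ z : Plane, ∫⁻ z' : Plane, correlationBound P Pbar δ γ t (dist z z') *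
        (ENNReal.ofReal (pathLoss α D (dist 0 z)) * ENNReal.ofReal (pathLoss α D (dist 0 z'))) ≤
      ENNReal.ofReal (2 * Real.pi * D ^ (2 - α) / (α - 2)) *
        (ENNReal.ofReal (Pbar ^ 2 + |δ| * t ^ (-γ)) *
          ENNReal.ofReal (2 * Real.pi * D ^ (2 - α) / (α - 2)) +
        ENNReal.ofReal (P ^ 2 * D ^ (-α) * (Real.pi * t ^ 2))) := by
  have hfm : Measurable fun z : Plane => ENNReal.ofReal (pathLoss α D (dist 0 z)) :=
    ((measurable_pathLoss α D).comp (measurable_const.dist measurable_id)).ennreal_ofReal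
  rw [← lintegral_pathLoss hα hD, ← lintegral_mul_const _ hfm]
  refine lintegral_mono fun z => ?_
  calc ∫⁻ z' : Plane, correlationBound P Pbar δ γ t (dist z z') *
        (ENNReal.ofReal (pathLoss α D (dist 0 z)) * ENNReal.ofReal (pathLoss α D (dist 0 z')))
      ≤ ∫⁻ z' : Plane, ENNReal.ofReal (pathLoss α D (dist 0 z)) *
          (ENNReal.ofReal (Pbar ^ 2 + |δ| * t ^ (-γ)) *
            ENNReal.ofReal (pathLoss α D (dist 0 z')) +
          ENNReal.ofReal (P ^ 2 * D ^ (-α)) * (Metric.ball z t).indicator 1 z') := by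
        refine lintegral_mono fun z' => ?_
        rw [correlationBound, mul_left_comm]
        refine mul_le_mul_right ?_ _
        rw [add_mul]
        refine add_le_add le_rfl ?_
        by_cases hz : dist z z' < t
        · rw [Set.indicator_of_mem (Set.mem_Iio.2 hz),
            Set.indicator_of_mem (show z' ∈ Metric.ball z t by rwa [Metric.mem_ball']),
            ENNReal.ofReal_mul (by positivity), Pi.one_apply, mul_one]
          exact mul_le_mul_right (ENNReal.ofReal_le_ofReal (pathLoss_le (by linarith) hD)) _
        · rw [Set.indicator_of_notMem (by simpa using hz)]
          simp
    _ = _ := by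
        have hb : Measurable fun z' => ENNReal.ofReal (P ^ 2 * D ^ (-α)) *
            (Metric.ball z t).indicator 1 z' :=
          (measurable_one.indicator measurableSet_ball).const_mul _
        have hDa := Real.rpow_nonneg hD.le (-α)
        rw [lintegral_const_mul' _ _ ENNReal.ofReal_ne_top, lintegral_add_right _ hb,
          lintegral_const_mul' _ _ ENNReal.ofReal_ne_top,
          lintegral_const_mul' _ _ ENNReal.ofReal_ne_top,
          lintegral_indicator_one measurableSet_ball, EuclideanSpace.volume_ball_fin_two,
          ENNReal.ofReal_mul (p := P ^ 2 * D ^ (-α)) (by positivity),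
          ENNReal.ofReal_mul (p := Real.pi) Real.pi_pos.le, ENNReal.ofReal_pow ht.le,
          mul_comm (ENNReal.ofReal Real.pi)]

/-- The square of the sum splits into a diagonal, where the squared path loss has exponent `2α`, and
pairs of distinct BSs. For the pairs the fading is averaged out, the powers are replaced by the
correlation bound, and the factorial moment measure does the rest. -/
theorem IsRepresentation.lintegral_farInterference_sq_le
    (h : IsRepresentation μ D X Y g φ τ x y Ψ) (hg : IsRayleighFading μ g)
    (hnet : IsCellularNetwork μ lam R X Y) (hP : ∀ᵐ ω ∂μ, ∀ k, bsPower (φ ω) k ≤ P)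
    (hcorr : PowerCorrelationCondition μ L D P Pbar δ γ X Y φ)
    (hlam : 0 ≤ lam) (hα : 2 < α) (hD : 0 < D) (hγ : 0 ≤ γ) {t : ℝ} (ht : 0 < t) :
    ∫⁻ ω, farInterference α D (X ω) (Y ω) (φ ω) (g ω) ^ 2 ∂μ ≤
      ENNReal.ofReal (P ^ 2) * (ENNReal.ofReal lam *
        ENNReal.ofReal (2 * Real.pi * D ^ (2 - 2 * α) / (2 * α - 2))) * (M * (M * 2)) +
      ENNReal.ofReal lam ^ 2 * (ENNReal.ofReal (2 * Real.pi * D ^ (2 - α) / (α - 2)) *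
        (ENNReal.ofReal (Pbar ^ 2 + |δ| * t ^ (-γ)) *
          ENNReal.ofReal (2 * Real.pi * D ^ (2 - α) / (α - 2)) +
        ENNReal.ofReal (P ^ 2 * D ^ (-α) * (Real.pi * t ^ 2)))) := by
  have hX := h.measurable_X
  have hY := h.measurable_Y
  have hφ := h.measurable_phi hg
  set u : ℕ → Ω → ℝ≥0∞ := fun k ω => farIndicator D (X ω) (Y ω) (k + 1) *
      bsInterference α D (X ω) (Y ω) (φ ω) (g ω) (k + 1) with hu
  have hum : ∀ k, Measurable (u k) := fun k =>
    (measurable_farIndicator hX hY (k + 1)).mul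
      (measurable_bsInterference hX hY hφ hg.measurable (k + 1))
  have hm1 : ∀ k, Measurable fun ω => u k ω ^ 2 := fun k => (hum k).pow_const 2
  have hm2 : ∀ p : ℕ × ℕ, Measurable fun ω => if p.1 = p.2 then 0 else u p.1 ω * u p.2 ω := by
    intro p
    split_ifs
    · exact measurable_const
    · exact (hum _).mul (hum _)
  have hs : Measurable fun ω => ∑' k, u k ω ^ 2 := Measurable.tsum hm1
  have e1 : ∀ ω, farInterference α D (X ω) (Y ω) (φ ω) (g ω) ^ 2 = ∑' k, u k ω ^ 2 +
      ∑' p : ℕ × ℕ, (if p.1 = p.2 then 0 else u p.1 ω * u p.2 ω) := fun ω =>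
    tsum_sq_eq_add_offDiag fun k => u k ω
  rw [lintegral_congr e1, lintegral_add_left hs, lintegral_tsum fun k => (hm1 k).aemeasurable,
    lintegral_tsum fun p => (hm2 p).aemeasurable]
  refine add_le_add ?_ ?_
  · have hmp : ∀ k, Measurable fun ω =>
        ENNReal.ofReal (pathLoss (2 * α) D (dist 0 (X ω (k + 1)))) := fun k =>
      measurable_ofReal_pathLoss hX (2 * α) D (k + 1)
    rw [← hnet.lintegral_tsum_pathLoss hlam (by linarith) hD, lintegral_tsum fun k =>
      (hmp k).aemeasurable, ← ENNReal.tsum_mul_left, ← ENNReal.tsum_mul_right]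
    refine ENNReal.tsum_le_tsum fun k => ?_
    refine (h.lintegral_bsInterference_sq_le hg hP k.succ_ne_zero).trans ?_
    refine mul_le_mul_left (le_of_eq ?_) _
    rw [← lintegral_const_mul' _ _ ENNReal.ofReal_ne_top]
    refine lintegral_congr_ae ?_
    filter_upwards [hnet.typical_at_origin] with ω hω
    rw [← farIndicator_mul_ofReal hω (sq_nonneg P) (2 * α) (k + 1)]
    rw [show -(2 * α) = -α * (2 : ℕ) by push_cast; ring, Real.rpow_mul_natCast dist_nonneg]
  · set F : Plane × Plane → ℝ≥0∞ := fun p => correlationBound P Pbar δ γ t (dist p.1 p.2) *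
      (ENNReal.ofReal (pathLoss α D (dist 0 p.1)) * ENNReal.ofReal (pathLoss α D (dist 0 p.2)))
      with hF
    have hfm : Measurable fun z : Plane => ENNReal.ofReal (pathLoss α D (dist 0 z)) :=
      ((measurable_pathLoss α D).comp (measurable_const.dist measurable_id)).ennreal_ofReal
    have hFm : Measurable F :=
      ((measurable_correlationBound P Pbar δ γ t).comp (measurable_fst.dist measurable_snd)).mul
        ((hfm.comp measurable_fst).mul (hfm.comp measurable_snd))
    have h3 := hnet.poisson.tsum_pairs hlam (measurable_shift hX) hFm
    refine le_trans ?_ (h3.le.trans (mul_le_mul_right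
      (lintegral_lintegral_correlation_le hα hD ht) _))
    refine ENNReal.tsum_le_tsum fun p => ?_
    by_cases hp : p.1 = p.2
    · simp [hp]
    simp only [if_neg hp]
    have hp' : p.1 + 1 ≠ p.2 + 1 := fun h => hp (Nat.succ_injective h)
    rw [h.lintegral_bsInterference_mul hg (α := α) p.1.succ_ne_zero p.2.succ_ne_zero hp']
    have h4 := lintegral_active_power_mul_le hX hY hφ hP hcorr ht hγ p.1.succ_ne_zero
      p.2.succ_ne_zero hp' (F := fun x => ENNReal.ofReal (pathLoss α D (dist 0 (x (p.1 + 1)))) *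
        ENNReal.ofReal (pathLoss α D (dist 0 (x (p.2 + 1)))))
      ((measurable_ofReal_pathLoss measurable_id α D _).mul
        (measurable_ofReal_pathLoss measurable_id α D _))
    refine le_trans (le_of_eq ?_) h4
    refine lintegral_congr_ae ?_
    filter_upwards [hnet.typical_at_origin] with ω hω
    rw [farIndicator_mul_bsMeanInterference hω, farIndicator_mul_bsMeanInterference hω]
    ring

end SecondMoment

/-! ### Convergence in probability: continuous maps, squeezing, moment criteria. -/

section InMeasure

variable {Ω ι : Type*} [MeasurableSpace Ω] {μ : Measure Ω} {l : Filter ι}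

/-- Because the limits are constants, continuity at the single point `(a, b)` suffices. This admits
quotients whose limiting denominator is nonzero. -/
theorem MeasureTheory.TendstoInMeasure.comp_continuousAt {E F G : Type*} [PseudoMetricSpace E]
    [PseudoMetricSpace F] [PseudoMetricSpace G] {u : ι → Ω → E} {v : ι → Ω → F} {a : E} {b : F}
    (hu : TendstoInMeasure μ u l fun _ => a) (hv : TendstoInMeasure μ v l fun _ => b)
    {h : E × F → G} (hh : ContinuousAt h (a, b)) :
    TendstoInMeasure μ (fun i ω => h (u i ω, v i ω)) l fun _ => h (a, b) := by
  rw [tendstoInMeasure_iff_dist] at hu hv ⊢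
  intro ε hε
  obtain ⟨η, hη, hlt⟩ := Metric.continuousAt_iff.1 hh ε hε
  have h0 := (hu η hη).add (hv η hη)
  rw [add_zero] at h0
  refine tendsto_of_tendsto_of_tendsto_of_le_of_le tendsto_const_nhds h0 (fun _ => zero_le)
    fun i => ?_
  refine (measure_mono fun ω hω => ?_).trans (measure_union_le _ _)
  by_contra hc
  simp only [Set.mem_union, Set.mem_ofPred_eq, not_or, not_le] at hc hω
  have := hlt (x := (u i ω, v i ω)) (by rw [Prod.dist_eq]; exact max_lt hc.1 hc.2)
  linarith

theorem tendstoInMeasure_const_of_tendsto {E : Type*} [PseudoMetricSpace E] {a : ι → E} {b : E}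
    (h : Tendsto a l (𝓝 b)) : TendstoInMeasure μ (fun i _ => a i) l fun _ => b := by
  rw [tendstoInMeasure_iff_dist]
  intro ε hε
  refine tendsto_const_nhds.congr' ?_
  filter_upwards [h (Metric.ball_mem_nhds b hε)] with i hi
  have : {x : Ω | ε ≤ dist (a i) b} = ∅ := by
    ext ω
    simpa using hi
  rw [this, measure_empty]

theorem MeasureTheory.TendstoInMeasure.of_le_of_le {u v w : ι → Ω → ℝ} {a : ℝ}
    (hu : TendstoInMeasure μ u l fun _ => a) (hw : TendstoInMeasure μ w l fun _ => a)
    (huv : ∀ᶠ i in l, ∀ᵐ ω ∂μ, u i ω ≤ v i ω) (hvw : ∀ᶠ i in l, ∀ᵐ ω ∂μ, v i ω ≤ w i ω) :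
    TendstoInMeasure μ v l fun _ => a := by
  rw [tendstoInMeasure_iff_dist] at hu hw ⊢
  intro ε hε
  have h0 := (hu ε hε).add (hw ε hε)
  rw [add_zero] at h0
  refine tendsto_of_tendsto_of_tendsto_of_le_of_le' tendsto_const_nhds h0 (.of_forall fun _ => zero_le)
    ?_
  filter_upwards [huv, hvw] with i h1 h2
  refine (measure_mono_ae ?_).trans (measure_union_le _ _)
  filter_upwards [h1, h2] with ω h3 h4 hω
  have hω' : ε ≤ dist (v i ω) a := hω
  rw [Real.dist_eq, le_abs] at hω'
  rcases hω' with h | h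
  · exact Or.inr ((show ε ≤ w i ω - a by linarith).trans (le_abs_self _))
  · refine Or.inl ((show ε ≤ -(u i ω - a) by linarith).trans (neg_le_abs _))

/-- A product of a bounded factor and one that tends to zero. -/
theorem MeasureTheory.TendstoInMeasure.bdd_mul [IsFiniteMeasure μ] {z w : ι → Ω → ℝ} {V : Ω → ℝ}
    (hV : Measurable V) (hz : TendstoInMeasure μ z l fun _ => 0)
    (hw : ∀ i, ∀ᵐ ω ∂μ, |w i ω| ≤ V ω) :
    TendstoInMeasure μ (fun i ω => w i ω * z i ω) l fun _ => 0 := by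
  rw [tendstoInMeasure_iff_norm] at hz ⊢
  intro ε hε
  rw [ENNReal.tendsto_nhds_zero]
  intro η hη
  have hη2 : 0 < η / 2 := ENNReal.half_pos hη.ne'
  -- A finite random variable is tight: the events that `V` exceeds `n + 1` decrease to the empty
  -- set.
  have hK : Tendsto (fun n : ℕ => μ {ω | (n : ℝ) + 1 ≤ V ω}) atTop (𝓝 0) := by
    have h1 : ⋂ n : ℕ, {ω | (n : ℝ) + 1 ≤ V ω} = ∅ := by
      ext ω
      simp only [Set.mem_iInter, Set.mem_ofPred_eq, Set.mem_empty_iff_false, iff_false, not_forall,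
        not_le]
      obtain ⟨n, hn⟩ := exists_nat_gt (V ω)
      exact ⟨n, by linarith⟩
    have h2 := tendsto_measure_iInter_atTop (μ := μ) (s := fun n : ℕ => {ω | (n : ℝ) + 1 ≤ V ω})
      (fun n => (measurableSet_le measurable_const hV).nullMeasurableSet)
      (fun m n hmn ω hω => by
        have h3 : (n : ℝ) + 1 ≤ V ω := hω
        have h4 : (m : ℝ) ≤ n := by exact_mod_cast hmn
        change (m : ℝ) + 1 ≤ V ω
        linarith) ⟨0, measure_ne_top _ _⟩
    rwa [h1, measure_empty] at h2
  obtain ⟨K, hK⟩ := ((ENNReal.tendsto_nhds_zero.1 hK) _ hη2).exists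
  have hK0 : (0 : ℝ) < K + 1 := by positivity
  filter_upwards [(ENNReal.tendsto_nhds_zero.1 (hz (ε / (K + 1)) (by positivity))) _ hη2] with i hi
  calc μ {ω | ε ≤ ‖w i ω * z i ω - 0‖}
      ≤ μ ({ω | (K : ℝ) + 1 ≤ V ω} ∪ {ω | ε / (K + 1) ≤ ‖z i ω - 0‖}) := by
        refine measure_mono_ae ?_
        filter_upwards [hw i] with ω h1 hω
        by_contra hc
        have hω' : ε ≤ ‖w i ω * z i ω - 0‖ := hω
        have hc1 : ¬ (K : ℝ) + 1 ≤ V ω := fun h => hc (Or.inl h)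
        have hc2 : ¬ ε / (K + 1) ≤ ‖z i ω - 0‖ := fun h => hc (Or.inr h)
        rw [not_le] at hc1 hc2
        rw [sub_zero, lt_div_iff₀ hK0] at hc2
        rw [sub_zero, norm_mul, Real.norm_eq_abs] at hω'
        have := mul_le_mul_of_nonneg_right (h1.trans hc1.le) (norm_nonneg (z i ω))
        linarith
    _ ≤ η / 2 + η / 2 := (measure_union_le _ _).trans (add_le_add hK hi)
    _ = η := ENNReal.add_halves η

theorem tendstoInMeasure_zero_of_lintegral {f : ι → Ω → ℝ≥0∞} (hf : ∀ i, Measurable (f i))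
    (h : Tendsto (fun i => ∫⁻ ω, f i ω ∂μ) l (𝓝 0)) :
    TendstoInMeasure μ (fun i ω => (f i ω).toReal) l fun _ => 0 := by
  rw [tendstoInMeasure_iff_norm]
  intro ε hε
  have h0 : Tendsto (fun i => (∫⁻ ω, f i ω ∂μ) / ENNReal.ofReal ε) l (𝓝 0) := by
    have := ENNReal.Tendsto.div_const h (b := ENNReal.ofReal ε) (Or.inr (by simpa using hε))
    simpa using this
  refine tendsto_of_tendsto_of_tendsto_of_le_of_le tendsto_const_nhds h0 (fun _ => zero_le)
    fun i => ?_
  rw [ENNReal.le_div_iff_mul_le (Or.inl (by simpa using hε)) (Or.inl ENNReal.ofReal_ne_top), mul_comm]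
  refine le_trans ?_ (mul_meas_ge_le_lintegral (hf i) (ENNReal.ofReal ε))
  refine mul_le_mul_right (measure_mono fun ω hω => ?_) _
  have hω' : ε ≤ ‖(f i ω).toReal - 0‖ := hω
  rw [sub_zero, Real.norm_of_nonneg ENNReal.toReal_nonneg] at hω'
  exact ENNReal.ofReal_le_of_le_toReal hω'

theorem tendstoInMeasure_of_lintegral_sub_sq {f : ι → Ω → ℝ} {c : ℝ} (hf : ∀ i, Measurable (f i))
    (h : Tendsto (fun i => ∫⁻ ω, ENNReal.ofReal ((f i ω - c) ^ 2) ∂μ) l (𝓝 0)) :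
    TendstoInMeasure μ f l fun _ => c := by
  have h1 := tendstoInMeasure_zero_of_lintegral
    (fun i => (((hf i).sub_const c).pow_const 2).ennreal_ofReal) h
  rw [tendstoInMeasure_iff_norm] at h1 ⊢
  intro ε hε
  refine tendsto_of_tendsto_of_tendsto_of_le_of_le tendsto_const_nhds (h1 (ε ^ 2) (by positivity))
    (fun _ => zero_le) fun i => measure_mono fun ω hω => ?_
  have hω' : ε ≤ ‖f i ω - c‖ := hω
  change ε ^ 2 ≤ ‖(ENNReal.ofReal ((f i ω - c) ^ 2)).toReal - 0‖
  rw [ENNReal.toReal_ofReal (sq_nonneg _), sub_zero, norm_pow]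
  exact pow_le_pow_left₀ hε.le hω' 2

/-- Convergence in probability from the first two moments. -/
theorem tendstoInMeasure_of_moments [IsProbabilityMeasure μ] {f : ι → Ω → ℝ≥0∞}
    (hf : ∀ i, Measurable (f i)) {a b : ι → ℝ} {c : ℝ} (hc : 0 ≤ c)
    (ha : Tendsto a l (𝓝 c)) (hb : Tendsto b l (𝓝 (c ^ 2)))
    (h1 : ∀ᶠ i in l, ENNReal.ofReal (a i) ≤ ∫⁻ ω, f i ω ∂μ)
    (h2 : ∀ᶠ i in l, ∫⁻ ω, f i ω ^ 2 ∂μ ≤ ENNReal.ofReal (b i)) :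
    TendstoInMeasure μ (fun i ω => (f i ω).toReal) l fun _ => c := by
  refine tendstoInMeasure_of_lintegral_sub_sq (fun i => (hf i).ennreal_toReal) ?_
  -- `E (f - c)² = E f² + c² - 2 c E f`, so with `c ≥ 0` an upper bound on the second moment and a
  -- lower bound on the mean suffice. The maximum with `0` keeps `ofReal` additive.
  have hlim : Tendsto (fun i => ENNReal.ofReal (max (b i) 0 + c ^ 2 - 2 * c * a i)) l (𝓝 0) := by
    have := ((hb.max (tendsto_const_nhds (x := (0 : ℝ)))).add_const (c ^ 2)).sub (ha.const_mul (2 * c))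
    rw [max_eq_left (sq_nonneg c), show c ^ 2 + c ^ 2 - 2 * c * c = 0 by ring] at this
    simpa using ENNReal.tendsto_ofReal this
  refine tendsto_of_tendsto_of_tendsto_of_le_of_le' tendsto_const_nhds hlim
    (.of_forall fun _ => zero_le) ?_
  filter_upwards [h1, h2] with i hi1 hi2
  have hb' : ∫⁻ ω, f i ω ^ 2 ∂μ ≤ ENNReal.ofReal (max (b i) 0) := by
    simpa [ENNReal.ofReal_max] using hi2
  have hfin : ∀ᵐ ω ∂μ, f i ω ^ 2 < ∞ :=
    ae_lt_top ((hf i).pow_const 2) (ne_top_of_le_ne_top ENNReal.ofReal_ne_top hi2)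
  have e1 : ∀ᵐ ω ∂μ, ENNReal.ofReal (((f i ω).toReal - c) ^ 2) + ENNReal.ofReal (2 * c) * f i ω =
      f i ω ^ 2 + ENNReal.ofReal (c ^ 2) := by
    filter_upwards [hfin] with ω hω
    have hne : f i ω ≠ ∞ := by
      intro h
      simp [h] at hω
    obtain ⟨r, hr⟩ := WithTop.ne_top_iff_exists.1 hne
    change (r : ℝ≥0∞) = f i ω at hr
    rw [← hr, ENNReal.coe_toReal, ← ENNReal.ofReal_coe_nnreal,
      ← ENNReal.ofReal_mul (by positivity), ← ENNReal.ofReal_add (by positivity) (by positivity),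
      ← ENNReal.ofReal_pow (by positivity), ← ENNReal.ofReal_add (by positivity) (by positivity)]
    congr 1
    ring
  have e2 := lintegral_congr_ae e1
  have hm1 : Measurable fun ω => ENNReal.ofReal (2 * c) * f i ω := (hf i).const_mul _
  rw [lintegral_add_right _ hm1, lintegral_const_mul _ (hf i),
    lintegral_add_right _ measurable_const, lintegral_const, measure_univ, mul_one] at e2
  have e3 : ∫⁻ ω, ENNReal.ofReal (((f i ω).toReal - c) ^ 2) ∂μ + ENNReal.ofReal (2 * c * a i) ≤
      ENNReal.ofReal (max (b i) 0 + c ^ 2) := by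
    rw [ENNReal.ofReal_add (le_max_right _ _) (sq_nonneg c), ENNReal.ofReal_mul (by positivity)]
    exact (add_le_add_right (mul_le_mul_right hi1 _) _).trans (e2.le.trans (add_le_add_left hb' _))
  refine (ENNReal.le_sub_of_add_le_right ENNReal.ofReal_ne_top e3).trans ?_
  rw [tsub_le_iff_right]
  refine le_trans (le_of_eq (congrArg _ ?_)) ENNReal.ofReal_add_le
  ring

end InMeasure

/-! ### Limits of the number of nulled mobiles, of the activity and of the gain. -/

section Counts

set_option linter.unusedSectionVars false

variable {M : ℕ} [NeZero M] {Ω : Type*} [MeasurableSpace Ω] {μ : Measure Ω}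
  [IsProbabilityMeasure μ] {lam R : ℝ} {X : Ω → ℕ → Plane} {Y : Ω → Mobile M → Plane}

theorem tendsto_add_const_div_sqrt {D : ℕ → ℝ} {d : ℝ}
    (hD : Tendsto (fun L : ℕ => D L / √(L : ℝ)) atTop (𝓝 d)) (c : ℝ) :
    Tendsto (fun L : ℕ => (D L + c) / √(L : ℝ)) atTop (𝓝 d) := by
  have h1 : Tendsto (fun L : ℕ => c / √(L : ℝ)) atTop (𝓝 0) :=
    tendsto_const_nhds.div_atTop (Real.tendsto_sqrt_atTop.comp tendsto_natCast_atTop_atTop)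
  simpa [add_div] using hD.add h1

theorem sq_div_natCast (r : ℝ) (L : ℕ) : r ^ 2 / L = (r / √(L : ℝ)) ^ 2 := by
  rw [div_pow, Real.sq_sqrt (Nat.cast_nonneg L)]

theorem IsHomogeneousPoisson.tendstoInMeasure_pointCount {W : Ω → ℕ → Plane} (hlam : 0 ≤ lam)
    (h : IsHomogeneousPoisson μ lam W) (hW : Measurable W) (z : Plane) {ρ : ℕ → ℝ}
    (hρ : ∀ L, 0 ≤ ρ L) {d : ℝ} (hd : Tendsto (fun L : ℕ => ρ L / √(L : ℝ)) atTop (𝓝 d)) :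
    TendstoInMeasure μ (fun (L : ℕ) ω => (pointCount (W ω) (Metric.ball z (ρ L))).toReal / L)
      atTop fun _ => lam * (Real.pi * d ^ 2) := by
  have hpi := Real.pi_pos
  have hmean : Tendsto (fun L : ℕ => lam * (Real.pi * ρ L ^ 2) / L) atTop
      (𝓝 (lam * (Real.pi * d ^ 2))) := by
    have := ((hd.pow 2).const_mul Real.pi).const_mul lam
    refine this.congr fun L => ?_
    rw [← sq_div_natCast]
    ring
  have h1 : TendstoInMeasure μ (fun (L : ℕ) ω =>
      (pointCount (W ω) (Metric.ball z (ρ L))).toReal / L - lam * (Real.pi * ρ L ^ 2) / L)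
      atTop fun _ => 0 := by
    refine tendstoInMeasure_of_lintegral_sub_sq (fun L =>
      (((measurable_pointCount hW measurableSet_ball).ennreal_toReal).div_const _).sub_const _) ?_
    have e : ∀ L : ℕ, ∫⁻ ω, ENNReal.ofReal (((pointCount (W ω) (Metric.ball z (ρ L))).toReal / L -
        lam * (Real.pi * ρ L ^ 2) / L - 0) ^ 2) ∂μ =
        ENNReal.ofReal (lam * (Real.pi * ρ L ^ 2) / L * (L : ℝ)⁻¹) := by
      intro L
      rw [show lam * (Real.pi * ρ L ^ 2) / L * (L : ℝ)⁻¹ =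
        ((L : ℝ) ^ 2)⁻¹ * (lam * (Real.pi * ρ L ^ 2)) by ring, ENNReal.ofReal_mul (by positivity),
        ← h.lintegral_ball_sub_sq hlam hW z (hρ L), ← lintegral_const_mul' _ _ ENNReal.ofReal_ne_top]
      refine lintegral_congr fun ω => ?_
      rw [← ENNReal.ofReal_mul (by positivity)]
      congr 1
      ring
    simp_rw [e]
    have := ENNReal.tendsto_ofReal (hmean.mul (tendsto_inv_atTop_nhds_zero_nat (𝕜 := ℝ)))
    simpa using this
  have h2 := h1.comp_continuousAt (tendstoInMeasure_const_of_tendsto (μ := μ) hmean)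
    (h := fun p => p.1 + p.2) (by fun_prop)
  simpa using h2

/-- BS `0` is within `R` of the origin, so its random position can be replaced by the origin at the
price of a second `R` in the radius. The maximum with `0` makes the radii nonnegative; a disc of
radius `0` is empty and the lower bound trivial. -/
theorem nearMobiles_zero_bounds {D : ℝ} {x : ℕ → Plane} {y : Mobile M → Plane}
    (hR : ∀ i : Mobile M, dist (y i) (x i.1) ≤ R) (h0 : y (0, 0) = 0)
    (hfin : pointCount (fun l => x (l + 1)) (Metric.ball 0 (max (D + 2 * R) 0)) ≠ ∞) :
    (nearMobiles D x y 0).Finite ∧ ((nearMobiles D x y 0).ncard : ℝ) ≤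
      M * ((pointCount (fun l => x (l + 1)) (Metric.ball 0 (max (D + 2 * R) 0))).toReal + 1) ∧
    M * (pointCount (fun l => x (l + 1)) (Metric.ball 0 (max (D - 2 * R) 0))).toReal ≤
      (nearMobiles D x y 0).ncard := by
  have hx : dist 0 (x 0) ≤ R := by simpa [h0] using hR (0, 0)
  have hu := encard_nearMobiles_le (D := D) hR 0
  have hl := le_encard_nearMobiles (D := D) hR 0
  have hsub : Metric.ball (x 0) (D + R) ⊆ Metric.ball 0 (max (D + 2 * R) 0) := by
    refine (Metric.ball_subset_ball' (ε₂ := D + 2 * R) ?_).trans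
      (Metric.ball_subset_ball (le_max_left _ _))
    rw [dist_comm]; linarith
  have hsub2 : Metric.ball 0 (max (D - 2 * R) 0) ⊆ Metric.ball (x 0) (D - R) := by
    rcases le_total (D - 2 * R) 0 with h | h
    · rw [max_eq_right h, Metric.ball_zero]; exact Set.empty_subset _
    · rw [max_eq_left h]
      exact Metric.ball_subset_ball' (by linarith)
  have hu2 := hu.trans (mul_le_mul_right (add_le_add_left
    (pointCount_mono (w := fun l => x (l + 1)) hsub) 1) (M : ℝ≥0∞))
  have hl2 := (mul_le_mul_right (pointCount_mono (w := fun l => x (l + 1)) hsub2)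
    (M : ℝ≥0∞)).trans hl
  have hne : (M : ℝ≥0∞) *
      (pointCount (fun l => x (l + 1)) (Metric.ball 0 (max (D + 2 * R) 0)) + 1) ≠ ∞ := by
    finiteness
  have hF : (nearMobiles D x y 0).Finite := by
    rw [← Set.encard_ne_top_iff]
    intro h
    rw [h] at hu2
    exact hne (top_le_iff.1 (by simpa using hu2))
  have hcard : ((nearMobiles D x y 0).encard : ℝ≥0∞) = (nearMobiles D x y 0).ncard := by
    rw [← hF.cast_ncard_eq]; simp
  rw [hcard] at hu2 hl2
  refine ⟨hF, ?_, ?_⟩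
  · have := ENNReal.toReal_mono hne hu2
    rwa [ENNReal.toReal_natCast, ENNReal.toReal_mul, ENNReal.toReal_natCast,
      ENNReal.toReal_add hfin ENNReal.one_ne_top, ENNReal.toReal_one] at this
  · have := ENNReal.toReal_mono (ENNReal.natCast_ne_top _) hl2
    rwa [ENNReal.toReal_natCast, ENNReal.toReal_mul, ENNReal.toReal_natCast] at this

theorem IsCellularNetwork.ae_nearMobiles_zero_bounds (hnet : IsCellularNetwork μ lam R X Y)
    (hlam : 0 ≤ lam) (D : ℝ) :
    ∀ᵐ ω ∂μ, (nearMobiles D (X ω) (Y ω) 0).Finite ∧ ((nearMobiles D (X ω) (Y ω) 0).ncard : ℝ) ≤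
      M * ((pointCount (fun l => X ω (l + 1)) (Metric.ball 0 (max (D + 2 * R) 0))).toReal + 1) ∧
    M * (pointCount (fun l => X ω (l + 1)) (Metric.ball 0 (max (D - 2 * R) 0))).toReal ≤
      (nearMobiles D (X ω) (Y ω) 0).ncard := by
  have hW := measurable_shift hnet.measurable_bs
  have hfin : ∀ᵐ ω ∂μ, pointCount (fun l => X ω (l + 1)) (Metric.ball 0 (max (D + 2 * R) 0)) < ∞ := by
    refine ae_lt_top (measurable_pointCount hW measurableSet_ball) ?_
    rw [hnet.poisson.lintegral_pointCount hlam hW measurableSet_ball measure_ball_lt_top.ne]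
    exact ENNReal.mul_ne_top ENNReal.ofReal_ne_top measure_ball_lt_top.ne
  filter_upwards [hnet.dist_serving_le, hnet.typical_at_origin, hfin] with ω h1 h2 h3
  exact nearMobiles_zero_bounds h1 h2 h3.ne

theorem IsCellularNetwork.tendstoInMeasure_ncard (hnet : IsCellularNetwork μ lam R X Y)
    (hlam : 0 ≤ lam) {D : ℕ → ℝ} {d : ℝ} (hd0 : 0 ≤ d)
    (hD : Tendsto (fun L : ℕ => D L / √(L : ℝ)) atTop (𝓝 d)) :
    TendstoInMeasure μ (fun (L : ℕ) ω => ((nearMobiles (D L) (X ω) (Y ω) 0).ncard : ℝ) / L)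
      atTop fun _ => d ^ 2 * Real.pi * lam * M := by
  have hW := measurable_shift hnet.measurable_bs
  have hbd : ∀ c, Tendsto (fun L : ℕ => max (D L + c) 0 / √(L : ℝ)) atTop (𝓝 d) := by
    intro c
    have := (tendsto_add_const_div_sqrt hD c).max (tendsto_const_nhds (x := (0 : ℝ)))
    rw [max_eq_left hd0] at this
    refine this.congr fun L => ?_
    rw [max_div_div_right (Real.sqrt_nonneg _) (D L + c) 0 |>.symm, zero_div]
  have hcount := fun c => hnet.poisson.tendstoInMeasure_pointCount hlam hW 0
    (ρ := fun L => max (D L + c) 0) (fun L => le_max_right _ _) (hbd c)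
  have hinv : TendstoInMeasure μ (fun (L : ℕ) (_ : Ω) => (L : ℝ)⁻¹) atTop fun _ => (0 : ℝ) :=
    tendstoInMeasure_const_of_tendsto tendsto_inv_atTop_nhds_zero_nat
  have hup := (hcount (2 * R)).comp_continuousAt hinv
    (h := fun p : ℝ × ℝ => (M : ℝ) * (p.1 + p.2)) (by fun_prop)
  have hlo := (hcount (-(2 * R))).comp_continuousAt hinv
    (h := fun p : ℝ × ℝ => (M : ℝ) * p.1) (by fun_prop)
  have ev : (M : ℝ) * (lam * (Real.pi * d ^ 2)) = d ^ 2 * Real.pi * lam * M := by ring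
  simp only [add_zero, ev] at hup hlo
  refine TendstoInMeasure.of_le_of_le hlo hup (.of_forall fun L => ?_) (.of_forall fun L => ?_)
  · filter_upwards [hnet.ae_nearMobiles_zero_bounds hlam (D L)] with ω hω
    rw [← mul_div_assoc]
    exact div_le_div_of_nonneg_right hω.2.2 (Nat.cast_nonneg L)
  · filter_upwards [hnet.ae_nearMobiles_zero_bounds hlam (D L)] with ω hω
    rw [← one_div, ← add_div, ← mul_div_assoc]
    exact div_le_div_of_nonneg_right hω.2.1 (Nat.cast_nonneg L)

/-- An inactive BS `0` has at least `L` mobiles in `𝒟₀`, so that `|𝒟₀| / L` exceeds its limit, which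
is less than `1`, by a fixed amount. -/
theorem IsCellularNetwork.tendstoInMeasure_activity (hnet : IsCellularNetwork μ lam R X Y)
    (hlam : 0 ≤ lam) {D : ℕ → ℝ} {d : ℝ} (hd0 : 0 ≤ d)
    (hD : Tendsto (fun L : ℕ => D L / √(L : ℝ)) atTop (𝓝 d)) (hd : d ^ 2 * Real.pi * lam * M < 1) :
    TendstoInMeasure μ (fun (L : ℕ) ω => activity L (D L) (X ω) (Y ω) 0) atTop
      fun _ => (1 : ℝ) := by
  have h1 := hnet.tendstoInMeasure_ncard hlam hd0 hD
  rw [tendstoInMeasure_iff_dist] at h1 ⊢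
  intro ε hε
  refine tendsto_of_tendsto_of_tendsto_of_le_of_le' tendsto_const_nhds
    (h1 (1 - d ^ 2 * Real.pi * lam * M) (by linarith)) (.of_forall fun _ => zero_le) ?_
  filter_upwards [eventually_gt_atTop 0] with L hL
  have hL' : (0 : ℝ) < L := by exact_mod_cast hL
  refine measure_mono_ae ?_
  filter_upwards [hnet.ae_nearMobiles_zero_bounds hlam (D L)] with ω hω hε'
  have hε'' : ε ≤ dist (activity L (D L) (X ω) (Y ω) 0) 1 := hε'
  have hna : ¬ IsActive L (D L) (X ω) (Y ω) 0 := by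
    intro ha
    rw [activity, if_pos ha, dist_self] at hε''
    linarith
  have h2 : ¬ (nearMobiles (D L) (X ω) (Y ω) 0).encard < L := fun h => hna (Or.inl h)
  rw [← hω.1.cast_ncard_eq, Nat.cast_lt, not_lt] at h2
  have h3 : (1 : ℝ) ≤ ((nearMobiles (D L) (X ω) (Y ω) 0).ncard : ℝ) / L := by
    rw [one_le_div hL']
    exact_mod_cast h2
  change 1 - d ^ 2 * Real.pi * lam * M ≤ dist (((nearMobiles (D L) (X ω) (Y ω) 0).ncard : ℝ) / L) _
  rw [Real.dist_eq]
  exact (by linarith : _ ≤ _).trans (le_abs_self _)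

/-- The mean square deviation `L` from the rank becomes `1 / L` after normalisation. What remains is
`a₀ (1 - |𝒟₀ \ {0}| / L)`, and removing one mobile changes the ratio by at most `1 / L`. -/
theorem IsCellularNetwork.tendstoInMeasure_signalGain (hnet : IsCellularNetwork μ lam R X Y)
    (hlam : 0 ≤ lam) {D : ℕ → ℝ} {d : ℝ} (hd0 : 0 ≤ d)
    (hD : Tendsto (fun L : ℕ => D L / √(L : ℝ)) atTop (𝓝 d)) (hd : d ^ 2 * Real.pi * lam * M < 1)
    {g : (L : ℕ) → Ω → Mobile M → ℕ → Fin L → ℂ} (hg : ∀ L, Measurable (g L))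
    (hsig : ∀ L : ℕ, ∫⁻ ω, ENNReal.ofReal (activity L (D L) (X ω) (Y ω) 0 *
      (signalGain (D L) (X ω) (Y ω) (g L ω) -
        (L - (nearMobiles (D L) (X ω) (Y ω) 0 \ {(0, 0)}).ncard)) ^ 2) ∂μ ≤ L) :
    TendstoInMeasure μ (fun (L : ℕ) ω => activity L (D L) (X ω) (Y ω) 0 *
      signalGain (D L) (X ω) (Y ω) (g L ω) / L) atTop
      fun _ => 1 - d ^ 2 * Real.pi * lam * M := by
  have hX := hnet.measurable_bs
  have hY := hnet.measurable_mobile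
  have hinv : TendstoInMeasure μ (fun (L : ℕ) (_ : Ω) => (L : ℝ)⁻¹) atTop fun _ => (0 : ℝ) :=
    tendstoInMeasure_const_of_tendsto tendsto_inv_atTop_nhds_zero_nat
  have hN := hnet.tendstoInMeasure_ncard hlam hd0 hD
  have hN' : TendstoInMeasure μ (fun (L : ℕ) ω =>
      ((nearMobiles (D L) (X ω) (Y ω) 0 \ {(0, 0)}).ncard : ℝ) / L) atTop
      fun _ => d ^ 2 * Real.pi * lam * M := by
    have hlo := hN.comp_continuousAt hinv (h := fun p : ℝ × ℝ => p.1 - p.2) (by fun_prop)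
    simp only [sub_zero] at hlo
    refine TendstoInMeasure.of_le_of_le hlo hN (.of_forall fun L => ?_) (.of_forall fun L => ?_)
    · filter_upwards [hnet.ae_nearMobiles_zero_bounds hlam (D L)] with ω hω
      rw [← one_div, ← sub_div]
      refine div_le_div_of_nonneg_right ?_ (Nat.cast_nonneg L)
      have h1 := Set.pred_ncard_le_ncard_sdiff_singleton (nearMobiles (D L) (X ω) (Y ω) 0) (0, 0)
      have h2 : (nearMobiles (D L) (X ω) (Y ω) 0).ncard ≤
        (nearMobiles (D L) (X ω) (Y ω) 0 \ {(0, 0)}).ncard + 1 := by omega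
      have h3 : ((nearMobiles (D L) (X ω) (Y ω) 0).ncard : ℝ) ≤
        (nearMobiles (D L) (X ω) (Y ω) 0 \ {(0, 0)}).ncard + 1 := by exact_mod_cast h2
      linarith
    · filter_upwards [hnet.ae_nearMobiles_zero_bounds hlam (D L)] with ω hω
      refine div_le_div_of_nonneg_right ?_ (Nat.cast_nonneg L)
      exact_mod_cast Set.ncard_le_ncard Set.sdiff_subset hω.1
  have hdev : TendstoInMeasure μ (fun (L : ℕ) ω => activity L (D L) (X ω) (Y ω) 0 *
      (signalGain (D L) (X ω) (Y ω) (g L ω) -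
        (L - (nearMobiles (D L) (X ω) (Y ω) 0 \ {(0, 0)}).ncard)) / L) atTop
      fun _ => 0 := by
    refine tendstoInMeasure_of_lintegral_sub_sq (fun L =>
      ((measurable_activity hX hY 0).mul ((measurable_signalGain hX hY (hg L)).sub
        (measurable_const.sub (measurable_ncard_nearMobiles_diff hX hY _ 0)))).div_const _) ?_
    have hlim : Tendsto (fun L : ℕ => ENNReal.ofReal ((L : ℝ)⁻¹)) atTop (𝓝 0) := by
      simpa using ENNReal.tendsto_ofReal (tendsto_inv_atTop_nhds_zero_nat (𝕜 := ℝ))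
    refine tendsto_of_tendsto_of_tendsto_of_le_of_le' tendsto_const_nhds hlim
      (.of_forall fun _ => zero_le) ?_
    filter_upwards [eventually_gt_atTop 0] with L hL
    have hL' : (0 : ℝ) < L := by exact_mod_cast hL
    have e : ∀ ω, ENNReal.ofReal ((activity L (D L) (X ω) (Y ω) 0 *
      (signalGain (D L) (X ω) (Y ω) (g L ω) -
        (L - (nearMobiles (D L) (X ω) (Y ω) 0 \ {(0, 0)}).ncard)) / L - 0) ^ 2) =
        ENNReal.ofReal (((L : ℝ) ^ 2)⁻¹) * ENNReal.ofReal (activity L (D L) (X ω) (Y ω) 0 *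
      (signalGain (D L) (X ω) (Y ω) (g L ω) -
        (L - (nearMobiles (D L) (X ω) (Y ω) 0 \ {(0, 0)}).ncard)) ^ 2) := by
      intro ω
      rw [← ENNReal.ofReal_mul (by positivity)]
      congr 1
      have ha : activity L (D L) (X ω) (Y ω) 0 ^ 2 = activity L (D L) (X ω) (Y ω) 0 := by
        unfold activity; split_ifs <;> simp
      rw [sub_zero, div_pow, mul_pow, ha, div_eq_inv_mul]
    rw [lintegral_congr e, lintegral_const_mul' _ _ ENNReal.ofReal_ne_top]
    refine (mul_le_mul_right (hsig L) _).trans (le_of_eq ?_)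
    rw [← ENNReal.ofReal_natCast, ← ENNReal.ofReal_mul (by positivity)]
    congr 1
    field_simp
  have hA := hnet.tendstoInMeasure_activity hlam hd0 hD hd
  have h1 := hA.comp_continuousAt hN' (h := fun p : ℝ × ℝ => p.1 * (1 - p.2)) (by fun_prop)
  have h2 := hdev.comp_continuousAt h1 (h := fun p : ℝ × ℝ => p.1 + p.2) (by fun_prop)
  simp only [one_mul, zero_add] at h2
  refine h2.congr' ?_ (.of_forall fun _ => rfl)
  filter_upwards [eventually_gt_atTop 0] with L hL
  have hL' : (L : ℝ) ≠ 0 := by exact_mod_cast hL.ne'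
  refine .of_forall fun ω => ?_
  field_simp
  ring

end Counts

/-! ### Splitting the interference into BS `0` and the remaining BSs. -/

section Decomposition

set_option linter.unusedSectionVars false

variable {M L : ℕ} [NeZero M] {α D : ℝ}

theorem tsum_receivedPower_eq {x : ℕ → Plane} {y : Mobile M → Plane} {φ : Mobile M → ℝ}
    {γ : Mobile M → ℕ → Fin L → ℂ} :
    ∑' i : {i : Mobile M // i ≠ (0, 0)}, ENNReal.ofReal (receivedPower α D x y φ γ (0, 0) i) =
      ownInterference α D x y φ γ + ∑' k, bsInterference α D x y φ γ (k + 1) := by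
  classical
  refine (tsum_subtype {i : Mobile M | i ≠ (0, 0)}
    (fun i => ENNReal.ofReal (receivedPower α D x y φ γ (0, 0) i))).trans ?_
  rw [ENNReal.tsum_prod (f := fun k m => Set.indicator {i : Mobile M | i ≠ (0, 0)}
      (fun i => ENNReal.ofReal (receivedPower α D x y φ γ (0, 0) i)) (k, m)),
    tsum_eq_zero_add' ENNReal.summable]
  congr 1
  · rw [tsum_fintype, ownInterference, ← Finset.add_sum_erase _ _ (Finset.mem_univ (0 : Fin M)),
      Set.indicator_of_notMem (by simp), zero_add]
    refine Finset.sum_congr rfl fun m hm => ?_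
    rw [Set.indicator_of_mem]
    simpa using Finset.ne_of_mem_erase hm
  · refine tsum_congr fun k => ?_
    rw [tsum_fintype, bsInterference]
    refine Finset.sum_congr rfl fun m _ => ?_
    rw [Set.indicator_of_mem]
    simp

/-- Only the BSs that do not null the typical mobile contribute to the interference. -/
theorem tsum_receivedPower_eq_far {x : ℕ → Plane} {y : Mobile M → Plane} {φ : Mobile M → ℝ}
    {γ : Mobile M → ℕ → Fin L → ℂ}
    (hγ : ∀ k, ∀ S : Set (Mobile M), S.Finite → S.ncard ≤ L → IndepColumns γ k S) :
    ∑' i : {i : Mobile M // i ≠ (0, 0)}, ENNReal.ofReal (receivedPower α D x y φ γ (0, 0) i) =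
      farIndicator D x y 0 * ownInterference α D x y φ γ + farInterference α D x y φ γ := by
  rw [tsum_receivedPower_eq, farInterference]
  congr 1
  · by_cases h : ((0, 0) : Mobile M) ∈ nearMobiles D x y 0
    · rw [farIndicator, if_pos h, zero_mul, ownInterference]
      refine Finset.sum_eq_zero fun m hm => ?_
      rw [receivedPower_eq_zero (j := (0, m)) h (fun h' => Finset.ne_of_mem_erase hm
        (by simpa using (congrArg Prod.snd h').symm)) hγ, ENNReal.ofReal_zero]
    · rw [farIndicator, if_neg h, one_mul]
  · refine tsum_congr fun k => ?_
    by_cases h : ((0, 0) : Mobile M) ∈ nearMobiles D x y (k + 1)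
    · rw [farIndicator, if_pos h, zero_mul, bsInterference]
      refine Finset.sum_eq_zero fun m _ => ?_
      rw [receivedPower_eq_zero (j := (k + 1, m)) h (fun h' =>
        k.succ_ne_zero (by simpa using (congrArg Prod.fst h').symm)) hγ, ENNReal.ofReal_zero]
    · rw [farIndicator, if_neg h, one_mul]

theorem measurable_ownInterference {A : Type*} [MeasurableSpace A] {x : A → ℕ → Plane}
    {y : A → Mobile M → Plane} {γ : A → Mobile M → ℕ → Fin L → ℂ} {φ : A → Mobile M → ℝ}
    (hx : Measurable x) (hy : Measurable y) (hφ : Measurable φ) (hγ : Measurable γ) :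
    Measurable fun a => ownInterference α D (x a) (y a) (φ a) (γ a) :=
  Finset.measurable_fun_sum _ fun m _ =>
    (measurable_receivedPower α hx hy hφ hγ (0, 0) (0, m)).ennreal_ofReal

end Decomposition

/-! ### Deterministic asymptotics in `L`. -/

section Asymptotics

set_option linter.unusedSectionVars false

variable {s β κ p : ℝ}

theorem rpow_mul_radius_rpow (hs : 0 < s) {L : ℕ} (hL : 0 < L) (ρ β p : ℝ) :
    (L : ℝ) ^ ρ * (s * (L : ℝ) ^ β) ^ p = s ^ p * (L : ℝ) ^ (ρ + β * p) := by
  have hL' : (0 : ℝ) < L := by exact_mod_cast hL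
  rw [Real.mul_rpow hs.le (Real.rpow_nonneg hL'.le _), ← Real.rpow_mul hL'.le, Real.rpow_add hL']
  ring

theorem tendsto_rpow_mul_radius_rpow (hs : 0 < s) {ρ β p : ℝ} (h : ρ + β * p < 0) :
    Tendsto (fun L : ℕ => (L : ℝ) ^ ρ * (s * (L : ℝ) ^ β) ^ p) atTop (𝓝 0) := by
  have h1 : Tendsto (fun L : ℕ => s ^ p * (L : ℝ) ^ (ρ + β * p)) atTop (𝓝 0) := by
    have := ((tendsto_rpow_neg_atTop (y := -(ρ + β * p)) (by linarith)).comp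
      tendsto_natCast_atTop_atTop).const_mul (s ^ p)
    simpa using this
  refine h1.congr' ?_
  filter_upwards [eventually_gt_atTop 0] with L hL
  exact (rpow_mul_radius_rpow hs hL ρ β p).symm

theorem tendsto_radius_div_sqrt (hβ : β ≤ 1 / 2) :
    Tendsto (fun L : ℕ => s * (L : ℝ) ^ β / √(L : ℝ)) atTop (𝓝 (if β = 1 / 2 then s else 0)) := by
  have h1 : ∀ᶠ L : ℕ in atTop, s * (L : ℝ) ^ (β - 1 / 2) = s * (L : ℝ) ^ β / √(L : ℝ) := by
    filter_upwards [eventually_gt_atTop 0] with L hL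
    have hL' : (0 : ℝ) < L := by exact_mod_cast hL
    rw [Real.rpow_sub hL', Real.sqrt_eq_rpow, mul_div_assoc]
  refine Tendsto.congr' h1 ?_
  split_ifs with h
  · subst h
    simp
  · have hlt : β < 1 / 2 := lt_of_le_of_ne hβ h
    have := ((tendsto_rpow_neg_atTop (y := -(β - 1 / 2)) (by linarith)).comp
      tendsto_natCast_atTop_atTop).const_mul s
    simpa using this

theorem tendsto_radius_atTop (hs : 0 < s) (hβ : 0 < β) :
    Tendsto (fun L : ℕ => s * (L : ℝ) ^ β) atTop atTop :=
  ((tendsto_rpow_atTop hβ).comp tendsto_natCast_atTop_atTop).const_mul_atTop hs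

/-- By `d² π λ M < 1` the mean number of BSs in the large disc stays below `L / M` by a margin
linear in `L`. The variance is at most of order `L`, so the Chebyshev ratio is of order `1 / L`. -/
theorem tendsto_inactive_factor {lam R d : ℝ} {M : ℕ} [NeZero M] {D : ℕ → ℝ}
    (hD : Tendsto (fun L : ℕ => D L / √(L : ℝ)) atTop (𝓝 d)) (hd : d ^ 2 * Real.pi * lam * M < 1) :
    (∀ᶠ L : ℕ in atTop, lam * (Real.pi * (D L + R + 1) ^ 2) < L / M - 1) ∧
    Tendsto (fun L : ℕ => lam * (Real.pi * (D L + R + 1) ^ 2) /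
      (L / M - 1 - lam * (Real.pi * (D L + R + 1) ^ 2)) ^ 2) atTop (𝓝 0) := by
  have hM : (0 : ℝ) < M := by exact_mod_cast NeZero.pos M
  have h1 : Tendsto (fun L : ℕ => lam * (Real.pi * (D L + R + 1) ^ 2) / L) atTop
      (𝓝 (lam * (Real.pi * d ^ 2))) := by
    have := (((tendsto_add_const_div_sqrt hD (R + 1)).pow 2).const_mul Real.pi).const_mul lam
    refine this.congr fun L => ?_
    rw [← sq_div_natCast, add_assoc]
    ring
  have h2 : Tendsto (fun L : ℕ => 1 / (M : ℝ) - (L : ℝ)⁻¹ -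
      lam * (Real.pi * (D L + R + 1) ^ 2) / L) atTop (𝓝 (1 / M - lam * (Real.pi * d ^ 2))) := by
    have := ((tendsto_inv_atTop_nhds_zero_nat (𝕜 := ℝ)).const_sub (1 / (M : ℝ))).sub h1
    simpa using this
  have hpos : 0 < 1 / (M : ℝ) - lam * (Real.pi * d ^ 2) := by
    rw [sub_pos, lt_div_iff₀ hM]
    linarith
  constructor
  · filter_upwards [h2.eventually (lt_mem_nhds hpos), eventually_gt_atTop 0] with L hL hL0
    have hL' : (0 : ℝ) < L := by exact_mod_cast hL0
    have := mul_pos hL hL'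
    field_simp at this ⊢
    nlinarith
  · have h3 := (h1.div (h2.pow 2) (by positivity)).mul (tendsto_inv_atTop_nhds_zero_nat (𝕜 := ℝ))
    rw [mul_zero] at h3
    refine h3.congr' ?_
    filter_upwards [eventually_gt_atTop 0] with L hL0
    have hL' : (L : ℝ) ≠ 0 := by exact_mod_cast hL0.ne'
    have e : (L : ℝ) / M - 1 - lam * (Real.pi * (D L + R + 1) ^ 2) =
        L * (1 / M - (L : ℝ)⁻¹ - lam * (Real.pi * (D L + R + 1) ^ 2) / L) := by
      field_simp
    simp only [Pi.div_apply]
    rw [e, mul_pow, sq (L : ℝ)]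
    rw [div_div, ← div_eq_mul_inv, div_div]
    congr 1
    ring

end Asymptotics

/-! ### Limits in probability of the scaled interference. -/

section Limits

set_option linter.unusedSectionVars false

variable {Ω : Type*} [MeasurableSpace Ω] {μ : Measure Ω} [IsProbabilityMeasure μ]
  {M : ℕ} [NeZero M] {lam R P Pbar α s β ν ζ δ γ : ℝ}
  {X : Ω → ℕ → Plane} {Y : Ω → Mobile M → Plane}
  {g : (L : ℕ) → Ω → Mobile M → ℕ → Fin L → ℂ} {φ : ℕ → Ω → Mobile M → ℝ}

theorem IsPowerAllocation.exists_representation_type.{u} {Ω : Type u} [MeasurableSpace Ω]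
    {μ : Measure Ω} {L : ℕ} {D : ℝ}
    {X : Ω → ℕ → Plane} {Y : Ω → Mobile M → Plane} {g : Ω → Mobile M → ℕ → Fin L → ℂ}
    {φ : Ω → Mobile M → ℝ} (h : IsPowerAllocation μ D P X Y g φ) :
    ∃ (T : Type u) (_ : MeasurableSpace T) (τ : Ω → T) (x : T → ℕ → Plane)
      (y : T → Mobile M → Plane) (Ψ : T → (Mobile M → ℕ → Fin L → ℂ) → Mobile M → ℝ),
      IsRepresentation μ D X Y g φ τ x y Ψ := by
  obtain ⟨𝓖, Ψ, h⟩ := h.exists_representation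
  exact ⟨Ω, 𝓖, id, X, Y, Ψ, h⟩

theorem IsPowerAllocation.measurable_phi {L : ℕ} {D : ℝ} {g : Ω → Mobile M → ℕ → Fin L → ℂ}
    {φ : Ω → Mobile M → ℝ} (h : IsPowerAllocation μ D P X Y g φ) (hg : IsRayleighFading μ g) :
    Measurable φ := by
  obtain ⟨T, _, τ, x, y, Ψ, h⟩ := h.exists_representation_type
  exact h.measurable_phi hg

theorem IsPowerAllocation.power_nonneg {L : ℕ} {D : ℝ} {g : Ω → Mobile M → ℕ → Fin L → ℂ}
    {φ : Ω → Mobile M → ℝ} (h : IsPowerAllocation μ D P X Y g φ) : 0 ≤ P := by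
  obtain ⟨ω, hω⟩ := h.power_le.exists
  exact bsPower_nonneg.trans (hω 0)

theorem radius_pos (hs : 0 < s) {L : ℕ} (hL : 0 < L) : 0 < s * (L : ℝ) ^ β :=
  mul_pos hs (Real.rpow_pos_of_pos (by exact_mod_cast hL) _)

theorem tendstoInMeasure_ownInterference (hα : 0 < α) (hs : 0 < s)
    (hg : ∀ L : ℕ, IsRayleighFading μ (g L))
    (hφ : ∀ L : ℕ, IsPowerAllocation μ (s * (L : ℝ) ^ β) P X Y (g L) (φ L))
    (hnet : IsCellularNetwork μ lam R X Y) {ρ : ℝ} (hρ : ρ + β * (-α) < 0) :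
    TendstoInMeasure μ (fun (L : ℕ) ω => (ENNReal.ofReal ((L : ℝ) ^ ρ) *
      (farIndicator (s * (L : ℝ) ^ β) (X ω) (Y ω) 0 *
        ownInterference α (s * (L : ℝ) ^ β) (X ω) (Y ω) (φ L ω) (g L ω))).toReal) atTop
      fun _ => (0 : ℝ) := by
  have hX := hnet.measurable_bs
  have hY := hnet.measurable_mobile
  refine tendstoInMeasure_zero_of_lintegral (fun L => ((measurable_farIndicator hX hY 0).mul
    (measurable_ownInterference hX hY ((hφ L).measurable_phi (hg L))
      (hg L).measurable)).const_mul _) ?_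
  have hlim : Tendsto (fun L : ℕ => (M : ℝ≥0∞) * ENNReal.ofReal (P * ((L : ℝ) ^ ρ *
      (s * (L : ℝ) ^ β) ^ (-α)))) atTop (𝓝 0) := by
    have h1 := ENNReal.tendsto_ofReal ((tendsto_rpow_mul_radius_rpow hs hρ).const_mul P)
    rw [mul_zero, ENNReal.ofReal_zero] at h1
    simpa using ENNReal.Tendsto.const_mul h1 (a := (M : ℝ≥0∞)) (Or.inr (ENNReal.natCast_ne_top M))
  refine tendsto_of_tendsto_of_tendsto_of_le_of_le' tendsto_const_nhds hlim
    (.of_forall fun _ => zero_le) ?_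
  filter_upwards [eventually_gt_atTop 0] with L hL
  obtain ⟨T, _, τ, x, y, Ψ, h⟩ := (hφ L).exists_representation_type
  rw [lintegral_const_mul' _ _ ENNReal.ofReal_ne_top]
  refine (mul_le_mul_right (h.lintegral_ownInterference_le (α := α) (hg L) (hφ L).power_le
    (radius_pos hs hL) hα) _).trans (le_of_eq ?_)
  rw [mul_left_comm, ← ENNReal.ofReal_mul (by positivity)]
  congr 2
  ring

theorem tendstoInMeasure_farInterference_zero (hlam : 0 ≤ lam) (hα : 2 < α) (hs : 0 < s)
    (hg : ∀ L : ℕ, IsRayleighFading μ (g L))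
    (hφ : ∀ L : ℕ, IsPowerAllocation μ (s * (L : ℝ) ^ β) P X Y (g L) (φ L))
    (hnet : IsCellularNetwork μ lam R X Y) {ρ : ℝ} (hρ : ρ + β * (2 - α) < 0) :
    TendstoInMeasure μ (fun (L : ℕ) ω => (ENNReal.ofReal ((L : ℝ) ^ ρ) *
      farInterference α (s * (L : ℝ) ^ β) (X ω) (Y ω) (φ L ω) (g L ω)).toReal) atTop
      fun _ => (0 : ℝ) := by
  have hX := hnet.measurable_bs
  have hY := hnet.measurable_mobile
  refine tendstoInMeasure_zero_of_lintegral (fun L => (measurable_farInterference hX hY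
    ((hφ L).measurable_phi (hg L)) (hg L).measurable).const_mul _) ?_
  have hlim : Tendsto (fun L : ℕ => ENNReal.ofReal (P * lam * (2 * Real.pi) / (α - 2) *
      ((L : ℝ) ^ ρ * (s * (L : ℝ) ^ β) ^ (2 - α)))) atTop (𝓝 0) := by
    have h1 := ENNReal.tendsto_ofReal ((tendsto_rpow_mul_radius_rpow hs hρ).const_mul
      (P * lam * (2 * Real.pi) / (α - 2)))
    rwa [mul_zero, ENNReal.ofReal_zero] at h1
  refine tendsto_of_tendsto_of_tendsto_of_le_of_le' tendsto_const_nhds hlim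
    (.of_forall fun _ => zero_le) ?_
  filter_upwards [eventually_gt_atTop 0] with L hL
  obtain ⟨T, _, τ, x, y, Ψ, h⟩ := (hφ L).exists_representation_type
  rw [lintegral_const_mul' _ _ ENNReal.ofReal_ne_top]
  refine (mul_le_mul_right (h.lintegral_farInterference_le (hg L) hnet (hφ L).power_le hlam hα
    (radius_pos hs hL)) _).trans (le_of_eq ?_)
  have hP := (hφ L).power_nonneg
  rw [← ENNReal.ofReal_mul hlam, ← ENNReal.ofReal_mul hP, ← ENNReal.ofReal_mul (by positivity)]
  congr 1
  ring

theorem secondMoment_ofReal {p l j₂ j q r : ℝ} (hp : 0 ≤ p) (hl : 0 ≤ l) (hj₂ : 0 ≤ j₂)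
    (hj : 0 ≤ j) (hq : 0 ≤ q) (hr : 0 ≤ r) (M : ℕ) :
    ENNReal.ofReal p * (ENNReal.ofReal l * ENNReal.ofReal j₂) * (M * (M * 2)) +
      ENNReal.ofReal l ^ 2 * (ENNReal.ofReal j * (ENNReal.ofReal q * ENNReal.ofReal j +
        ENNReal.ofReal r)) =
      ENNReal.ofReal (p * (l * j₂) * (M * (M * 2)) + l ^ 2 * (j * (q * j + r))) := by
  lift p to ℝ≥0 using hp
  lift l to ℝ≥0 using hl
  lift j₂ to ℝ≥0 using hj₂
  lift j to ℝ≥0 using hj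
  lift q to ℝ≥0 using hq
  lift r to ℝ≥0 using hr
  have : ((p : ℝ) * (l * j₂) * (M * (M * 2)) + l ^ 2 * (j * (q * j + r))) =
    ((p * (l * j₂) * (M * (M * 2)) + l ^ 2 * (j * (q * j + r)) : ℝ≥0) : ℝ) := by push_cast; ring
  rw [this]
  simp only [ENNReal.ofReal_coe_nnreal]
  push_cast
  ring

/-- The bounds on mean and second moment are evaluated with `t = √D`. Then `t^(-γ)` vanishes, and
the close pairs contribute `D^(-α) t² = D^(1-α)`, smaller by a factor `D` than the main order
`D^(2-α)`. The diagonal is smaller by `D²`. -/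
theorem tendstoInMeasure_farInterference (hlam : 0 ≤ lam) (hPbar : 0 ≤ Pbar) (hα : 2 < α)
    (hs : 0 < s) (hγ : 0 < γ) (hβ0 : 0 < β) (hβ : β ≤ 1 / 2) (hR : 0 ≤ R)
    (hd : (if β = 1 / 2 then s else 0) ^ 2 * Real.pi * lam * M < 1)
    (hnet : IsCellularNetwork μ lam R X Y)
    (hg : ∀ L : ℕ, IsRayleighFading μ (g L))
    (hφ : ∀ L : ℕ, IsPowerAllocation μ (s * (L : ℝ) ^ β) P X Y (g L) (φ L))
    (hmean : ∀ L : ℕ, MeanPowerCondition μ L (s * (L : ℝ) ^ β) Pbar δ γ X Y (φ L))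
    (hcorr : ∀ L : ℕ, PowerCorrelationCondition μ L (s * (L : ℝ) ^ β) P Pbar δ γ X Y (φ L)) :
    TendstoInMeasure μ (fun (L : ℕ) ω => (ENNReal.ofReal ((L : ℝ) ^ (β * (α - 2))) *
      farInterference α (s * (L : ℝ) ^ β) (X ω) (Y ω) (φ L ω) (g L ω)).toReal) atTop
      fun _ => s ^ (2 - α) * (2 * Real.pi * Pbar * lam / (α - 2)) := by
  have hX := hnet.measurable_bs
  have hY := hnet.measurable_mobile
  have hpi := Real.pi_pos
  have hα2 : 0 < α - 2 := by linarith
  have hw : 0 < s ^ (2 - α) := Real.rpow_pos_of_pos hs _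
  have hDtop := tendsto_radius_atTop hs hβ0
  obtain ⟨hev, hratio⟩ := tendsto_inactive_factor (R := R) (M := M) (tendsto_radius_div_sqrt hβ) hd
  have hDw : ∀ᶠ L : ℕ in atTop,
      (L : ℝ) ^ (β * (α - 2)) * (s * (L : ℝ) ^ β) ^ (2 - α) = s ^ (2 - α) := by
    filter_upwards [eventually_gt_atTop 0] with L hL
    rw [rpow_mul_radius_rpow hs hL, show β * (α - 2) + β * (2 - α) = 0 by ring, Real.rpow_zero,
      mul_one]
  set K := ((lam * Real.pi) ^ 2 + lam * Real.pi) ^ (1 / 2 : ℝ) with hK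
  -- The lower bound on the scaled mean: the contribution of all BSs minus that of the inactive
  -- ones.
  set a : ℕ → ℝ := fun L => (L : ℝ) ^ (β * (α - 2)) * ((Pbar - |δ| * (s * (L : ℝ) ^ β) ^ (-γ)) *
      (lam * (2 * Real.pi * (s * (L : ℝ) ^ β) ^ (2 - α) / (α - 2)))) -
    (L : ℝ) ^ (β * (α - 2)) * (Pbar * (Real.pi⁻¹ *
      (2 ^ α * (2 * Real.pi * ((s * (L : ℝ) ^ β) / 2) ^ (2 - α) / (α - 2))) *
        (K * (lam * (Real.pi * (s * (L : ℝ) ^ β + R + 1) ^ 2) /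
          (L / M - 1 - lam * (Real.pi * (s * (L : ℝ) ^ β + R + 1) ^ 2)) ^ 2) ^ (1 / 2 : ℝ)))) with ha
  -- The upper bound on the scaled second moment, with correlation cut `t = √D`.
  set b : ℕ → ℝ := fun L => ((L : ℝ) ^ (β * (α - 2))) ^ 2 * (P ^ 2 *
      (lam * (2 * Real.pi * (s * (L : ℝ) ^ β) ^ (2 - 2 * α) / (2 * α - 2))) * (M * (M * 2)) +
      lam ^ 2 * ((2 * Real.pi * (s * (L : ℝ) ^ β) ^ (2 - α) / (α - 2)) *
        ((Pbar ^ 2 + |δ| * √(s * (L : ℝ) ^ β) ^ (-γ)) *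
          (2 * Real.pi * (s * (L : ℝ) ^ β) ^ (2 - α) / (α - 2)) +
        P ^ 2 * (s * (L : ℝ) ^ β) ^ (-α) * (Real.pi * √(s * (L : ℝ) ^ β) ^ 2)))) with hb
  have hDγ : Tendsto (fun L : ℕ => (s * (L : ℝ) ^ β) ^ (-γ)) atTop (𝓝 0) :=
    (tendsto_rpow_neg_atTop hγ).comp hDtop
  have hDγ2 : Tendsto (fun L : ℕ => √(s * (L : ℝ) ^ β) ^ (-γ)) atTop (𝓝 0) :=
    (tendsto_rpow_neg_atTop hγ).comp (Real.tendsto_sqrt_atTop.comp hDtop)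
  have hDinv : Tendsto (fun L : ℕ => (s * (L : ℝ) ^ β)⁻¹) atTop (𝓝 0) :=
    tendsto_inv_atTop_zero.comp hDtop
  have halim : Tendsto a atTop (𝓝 (s ^ (2 - α) * (2 * Real.pi * Pbar * lam / (α - 2)))) := by
    have h1 : Tendsto (fun L : ℕ => (Pbar - |δ| * (s * (L : ℝ) ^ β) ^ (-γ)) *
        (lam * (2 * Real.pi * s ^ (2 - α) / (α - 2))) -
        Pbar * (Real.pi⁻¹ * (2 ^ α * (2 * Real.pi * (s ^ (2 - α) / 2 ^ (2 - α)) / (α - 2))) *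
        (K * (lam * (Real.pi * (s * (L : ℝ) ^ β + R + 1) ^ 2) /
          (L / M - 1 - lam * (Real.pi * (s * (L : ℝ) ^ β + R + 1) ^ 2)) ^ 2) ^ (1 / 2 : ℝ)))) atTop
        (𝓝 ((Pbar - |δ| * 0) * (lam * (2 * Real.pi * s ^ (2 - α) / (α - 2))) -
        Pbar * (Real.pi⁻¹ * (2 ^ α * (2 * Real.pi * (s ^ (2 - α) / 2 ^ (2 - α)) / (α - 2))) *
        (K * (0 : ℝ) ^ (1 / 2 : ℝ))))) :=
      (((hDγ.const_mul _).const_sub _).mul_const _).sub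
        ((((hratio.rpow_const (Or.inr (by norm_num))).const_mul _).const_mul _).const_mul _)
    rw [Real.zero_rpow (by norm_num)] at h1
    have e : (Pbar - |δ| * 0) * (lam * (2 * Real.pi * s ^ (2 - α) / (α - 2))) -
        Pbar * (Real.pi⁻¹ * (2 ^ α * (2 * Real.pi * (s ^ (2 - α) / 2 ^ (2 - α)) / (α - 2))) *
        (K * 0)) = s ^ (2 - α) * (2 * Real.pi * Pbar * lam / (α - 2)) := by ring
    rw [e] at h1
    refine h1.congr' ?_
    filter_upwards [hDw, eventually_gt_atTop 0] with L hL hL0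
    have hD := radius_pos (β := β) hs hL0
    rw [ha]
    beta_reduce
    rw [← hL, Real.div_rpow hD.le (by norm_num)]
    ring
  have hblim : Tendsto b atTop (𝓝 ((s ^ (2 - α) * (2 * Real.pi * Pbar * lam / (α - 2))) ^ 2)) := by
    have h1 : Tendsto (fun L : ℕ => P ^ 2 *
        (lam * (2 * Real.pi * ((s ^ (2 - α)) ^ 2 * ((s * (L : ℝ) ^ β)⁻¹) ^ 2) / (2 * α - 2))) *
          (M * (M * 2)) +
        lam ^ 2 * ((2 * Real.pi * s ^ (2 - α) / (α - 2)) *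
        ((Pbar ^ 2 + |δ| * √(s * (L : ℝ) ^ β) ^ (-γ)) *
          (2 * Real.pi * s ^ (2 - α) / (α - 2)) +
        P ^ 2 * (s ^ (2 - α) * (s * (L : ℝ) ^ β)⁻¹) * Real.pi))) atTop
        (𝓝 (P ^ 2 * (lam * (2 * Real.pi * ((s ^ (2 - α)) ^ 2 * 0 ^ 2) / (2 * α - 2))) *
          (M * (M * 2)) +
        lam ^ 2 * ((2 * Real.pi * s ^ (2 - α) / (α - 2)) *
        ((Pbar ^ 2 + |δ| * 0) * (2 * Real.pi * s ^ (2 - α) / (α - 2)) +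
        P ^ 2 * (s ^ (2 - α) * 0) * Real.pi)))) :=
      ((((((((hDinv.pow 2).const_mul _).const_mul _).div_const _).const_mul _).const_mul _).mul_const
        _)).add ((((((hDγ2.const_mul _).const_add _).mul_const _).add
          (((hDinv.const_mul _).const_mul _).mul_const _)).const_mul _).const_mul _)
    have e : P ^ 2 * (lam * (2 * Real.pi * ((s ^ (2 - α)) ^ 2 * 0 ^ 2) / (2 * α - 2))) *
          (M * (M * 2)) +
        lam ^ 2 * ((2 * Real.pi * s ^ (2 - α) / (α - 2)) *
        ((Pbar ^ 2 + |δ| * 0) * (2 * Real.pi * s ^ (2 - α) / (α - 2)) +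
        P ^ 2 * (s ^ (2 - α) * 0) * Real.pi)) =
        (s ^ (2 - α) * (2 * Real.pi * Pbar * lam / (α - 2))) ^ 2 := by ring
    rw [e] at h1
    refine h1.congr' ?_
    filter_upwards [hDw, eventually_gt_atTop 0] with L hL hL0
    have hD := radius_pos (β := β) hs hL0
    rw [hb]
    beta_reduce
    have e1 : (s * (L : ℝ) ^ β) ^ (2 - 2 * α) =
        ((s * (L : ℝ) ^ β) ^ (2 - α)) ^ 2 * ((s * (L : ℝ) ^ β)⁻¹) ^ 2 := by
      rw [← Real.rpow_mul_natCast hD.le, inv_pow, ← Real.rpow_natCast (s * (L : ℝ) ^ β) 2,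
        ← Real.rpow_neg hD.le, ← Real.rpow_add hD]
      congr 1
      push_cast
      ring
    have e2 : (s * (L : ℝ) ^ β) ^ (-α) * √(s * (L : ℝ) ^ β) ^ 2 =
        (s * (L : ℝ) ^ β) ^ (2 - α) * (s * (L : ℝ) ^ β)⁻¹ := by
      rw [Real.sq_sqrt hD.le, ← Real.rpow_neg_one (s * (L : ℝ) ^ β), ← Real.rpow_add hD]
      nth_rewrite 2 [← Real.rpow_one (s * (L : ℝ) ^ β)]
      rw [← Real.rpow_add hD]
      congr 1
      ring
    have e3 : P ^ 2 * (s * (L : ℝ) ^ β) ^ (-α) * (Real.pi * √(s * (L : ℝ) ^ β) ^ 2) =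
        P ^ 2 * ((s * (L : ℝ) ^ β) ^ (2 - α) * (s * (L : ℝ) ^ β)⁻¹) * Real.pi := by
      rw [← e2]; ring
    rw [e3, e1, ← hL]
    ring
  refine tendstoInMeasure_of_moments (fun L => (measurable_farInterference hX hY
    ((hφ L).measurable_phi (hg L)) (hg L).measurable).const_mul _) (by positivity) halim hblim ?_ ?_
  · filter_upwards [hev, hDtop.eventually_ge_atTop 2, eventually_gt_atTop 0] with L hL hD2 hL0
    have hD := radius_pos (β := β) hs hL0
    obtain ⟨T, _, τ, x, y, Ψ, h⟩ := (hφ L).exists_representation_type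
    have h1 := h.le_lintegral_farInterference (hg L) hnet (hmean L) hlam hα hD hγ.le
    have h2 := h1.trans (add_le_add_right (mul_le_mul_right
      (hnet.inactivePathLoss_le (L := L) hlam hα hD2 hR hL) _) _)
    rw [← ENNReal.ofReal_mul hlam, ← ENNReal.ofReal_mul' (by positivity),
      ← ENNReal.ofReal_mul hPbar] at h2
    have h3 := mul_le_mul_right h2 (ENNReal.ofReal ((L : ℝ) ^ (β * (α - 2))))
    have hLk : 0 ≤ (L : ℝ) ^ (β * (α - 2)) := by positivity
    rw [mul_add, ← ENNReal.ofReal_mul hLk, ← ENNReal.ofReal_mul hLk] at h3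
    rw [lintegral_const_mul' _ _ ENNReal.ofReal_ne_top, ha]
    beta_reduce
    have hD2' : 0 < s * (L : ℝ) ^ β / 2 := by linarith
    rw [ENNReal.ofReal_sub _ (by positivity), tsub_le_iff_right]
    exact h3
  · filter_upwards [eventually_gt_atTop 0] with L hL0
    have hD := radius_pos (β := β) hs hL0
    obtain ⟨T, _, τ, x, y, Ψ, h⟩ := (hφ L).exists_representation_type
    simp_rw [mul_pow]
    rw [lintegral_const_mul' _ _ (by finiteness)]
    refine (mul_le_mul_right (h.lintegral_farInterference_sq_le (hg L) hnet (hφ L).power_le (hcorr L)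
      hlam hα hD hγ.le (Real.sqrt_pos.2 hD)) _).trans (le_of_eq ?_)
    have h2α : 0 < 2 * α - 2 := by linarith
    rw [secondMoment_ofReal (by positivity) hlam (by positivity) (by positivity) (by positivity)
      (by positivity), ← ENNReal.ofReal_pow (by positivity), ← ENNReal.ofReal_mul (by positivity)]

end Limits

/-! ### The scaled SINR as a prefactor times a convergent quotient. -/

section ScaledSinr

set_option linter.unusedSectionVars false

variable {Ω : Type*} [MeasurableSpace Ω] {μ : Measure Ω} [IsProbabilityMeasure μ]
  {M : ℕ} [NeZero M] {lam R P α s β ν ζ : ℝ}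
  {X : Ω → ℕ → Plane} {Y : Ω → Mobile M → Plane}
  {g : (L : ℕ) → Ω → Mobile M → ℕ → Fin L → ℂ} {φ : ℕ → Ω → Mobile M → ℝ}

theorem scaled_sinr_eq {L : ℕ} (hL : 0 < L) {D : ℝ} {x : ℕ → Plane} {y : Mobile M → Plane}
    {p : Mobile M → ℝ} {γ : Mobile M → ℕ → Fin L → ℂ} (hν : 0 ≤ ν) (ρ : ℝ)
    (hγ : ∀ k, ∀ S : Set (Mobile M), S.Finite → S.ncard ≤ L → IndepColumns γ k S)
    (hown : farIndicator D x y 0 * ownInterference α D x y p γ ≠ ∞)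
    (hfar : farInterference α D x y p γ ≠ ∞) :
    (L : ℝ) ^ (-1 - ρ) * (sinr α D (ν * (L : ℝ) ^ (-ζ)) x y p γ (0, 0)).toReal =
      p (0, 0) ^ 2 * dist (y (0, 0)) (x 0) ^ (-α) *
        (activity L D x y 0 * signalGain D x y γ / L /
          ((ENNReal.ofReal ((L : ℝ) ^ ρ) *
              (farIndicator D x y 0 * ownInterference α D x y p γ)).toReal +
            (ENNReal.ofReal ((L : ℝ) ^ ρ) * farInterference α D x y p γ).toReal +
            ν * (L : ℝ) ^ (ρ - ζ))) := by
  have hL' : (0 : ℝ) < L := by exact_mod_cast hL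
  have hρ : 0 ≤ (L : ℝ) ^ ρ := by positivity
  have hσ : 0 ≤ ν * (L : ℝ) ^ (-ζ) := by positivity
  rw [sinr, tsum_receivedPower_eq_far hγ, ENNReal.toReal_div,
    ENNReal.toReal_add (by finiteness) ENNReal.ofReal_ne_top, ENNReal.toReal_add hown hfar,
    ENNReal.toReal_ofReal receivedPower_nonneg, ENNReal.toReal_ofReal hσ, receivedPower_eq,
    ENNReal.toReal_mul (a := ENNReal.ofReal ((L : ℝ) ^ ρ)),
    ENNReal.toReal_mul (a := ENNReal.ofReal ((L : ℝ) ^ ρ)), ENNReal.toReal_ofReal hρ]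
  set o := (farIndicator D x y 0 * ownInterference α D x y p γ).toReal
  set f := (farInterference α D x y p γ).toReal
  have e1 : (L : ℝ) ^ (-1 - ρ) = (L : ℝ)⁻¹ * ((L : ℝ) ^ ρ)⁻¹ := by
    rw [sub_eq_add_neg, Real.rpow_add hL', Real.rpow_neg_one, Real.rpow_neg hL'.le]
  have e2 : (L : ℝ) ^ ρ * o + (L : ℝ) ^ ρ * f + ν * (L : ℝ) ^ (ρ - ζ) =
      (L : ℝ) ^ ρ * (o + f + ν * (L : ℝ) ^ (-ζ)) := by
    rw [sub_eq_add_neg, Real.rpow_add hL']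
    ring
  rw [e1, e2]
  simp only [div_eq_mul_inv, mul_inv, signalGain]
  ring

/-- The quotient of normalised gain and scaled interference plus noise tends to `q / (c + n)`. The
prefactor may vary with `L`, but is dominated by `P r₀₀^(-α)`; hence the difference, rather than the
SINR itself, is shown to converge. -/
theorem tendstoInMeasure_scaled_sinr (hν : 0 ≤ ν) (hlam : 0 ≤ lam) (hα : 2 < α) (hs : 0 < s)
    (hnet : IsCellularNetwork μ lam R X Y)
    (hg : ∀ L : ℕ, IsRayleighFading μ (g L))
    (hφ : ∀ L : ℕ, IsPowerAllocation μ (s * (L : ℝ) ^ β) P X Y (g L) (φ L))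
    {ρ c n q : ℝ} (hcn : 0 < c + n)
    (hown : TendstoInMeasure μ (fun (L : ℕ) ω => (ENNReal.ofReal ((L : ℝ) ^ ρ) *
      (farIndicator (s * (L : ℝ) ^ β) (X ω) (Y ω) 0 *
        ownInterference α (s * (L : ℝ) ^ β) (X ω) (Y ω) (φ L ω) (g L ω))).toReal) atTop
      fun _ => (0 : ℝ))
    (hfar : TendstoInMeasure μ (fun (L : ℕ) ω => (ENNReal.ofReal ((L : ℝ) ^ ρ) *
      farInterference α (s * (L : ℝ) ^ β) (X ω) (Y ω) (φ L ω) (g L ω)).toReal) atTop fun _ => c)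
    (hsig : TendstoInMeasure μ (fun (L : ℕ) ω => activity L (s * (L : ℝ) ^ β) (X ω) (Y ω) 0 *
      signalGain (s * (L : ℝ) ^ β) (X ω) (Y ω) (g L ω) / L) atTop fun _ => q)
    (hn : Tendsto (fun L : ℕ => ν * (L : ℝ) ^ (ρ - ζ)) atTop (𝓝 n)) :
    TendstoInMeasure μ (fun (L : ℕ) ω => (L : ℝ) ^ (-1 - ρ) *
        (sinr α (s * (L : ℝ) ^ β) (ν * (L : ℝ) ^ (-ζ)) (X ω) (Y ω) (φ L ω) (g L ω) (0, 0)).toReal -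
      q * (φ L ω (0, 0) ^ 2 * dist (Y ω (0, 0)) (X ω 0) ^ (-α)) / (c + n)) atTop
      fun _ => (0 : ℝ) := by
  have hX := hnet.measurable_bs
  have hY := hnet.measurable_mobile
  have hI := (hown.comp_continuousAt hfar (h := fun p : ℝ × ℝ => p.1 + p.2)
    (by fun_prop)).comp_continuousAt (tendstoInMeasure_const_of_tendsto (μ := μ) hn)
    (h := fun p : ℝ × ℝ => p.1 + p.2) (by fun_prop)
  simp only [zero_add] at hI
  have hZ := hsig.comp_continuousAt hI (h := fun p : ℝ × ℝ => p.1 / p.2 - q / (c + n))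
    ((continuousAt_fst.div continuousAt_snd hcn.ne').sub continuousAt_const)
  simp only [sub_self] at hZ
  have hW := hZ.bdd_mul (w := fun L ω => φ L ω (0, 0) ^ 2 * dist (Y ω (0, 0)) (X ω 0) ^ (-α))
    (V := fun ω => P * dist (Y ω (0, 0)) (X ω 0) ^ (-α))
    (((measurable_dist_mobile hX hY _ 0).pow_const _).const_mul _) (fun L => by
      filter_upwards [(hφ L).power_le] with ω hω
      have h1 := Real.rpow_nonneg (dist_nonneg (x := Y ω (0, 0)) (y := X ω 0)) (-α)
      rw [abs_of_nonneg (mul_nonneg (sq_nonneg _) h1)]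
      exact mul_le_mul_of_nonneg_right (sq_le_of_bsPower_le (hω 0) 0) h1)
  refine hW.congr' ?_ (.of_forall fun _ => rfl)
  filter_upwards [eventually_gt_atTop 0] with L hL
  obtain ⟨T, _, τ, x, y, Ψ, h⟩ := (hφ L).exists_representation_type
  have hD := radius_pos (β := β) hs hL
  -- Finite means make both interference terms almost surely finite; since `toReal` sends `∞` to
  -- `0`, this is needed before `toReal` can be distributed over their sum.
  have hfin1 := ae_lt_top ((measurable_farIndicator hX hY 0).mul
    (measurable_ownInterference hX hY (h.measurable_phi (hg L)) (hg L).measurable))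
    (ne_top_of_le_ne_top (by finiteness)
      (h.lintegral_ownInterference_le (α := α) (hg L) (hφ L).power_le hD (by linarith)))
  have hfin2 := ae_lt_top
    (measurable_farInterference hX hY (h.measurable_phi (hg L)) (hg L).measurable)
    (ne_top_of_le_ne_top (by finiteness)
      (h.lintegral_farInterference_le (hg L) hnet (hφ L).power_le hlam hα hD))
  filter_upwards [hfin1, hfin2, (hg L).ae_indepColumns] with ω h1 h2 h3
  rw [scaled_sinr_eq hL hν ρ h3 h1.ne h2.ne]
  ring

end ScaledSinr

/-! ### The two regimes. -/

theorem theorem2 {Ω : Type*} [MeasurableSpace Ω] (μ : Measure Ω) [IsProbabilityMeasure μ]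
    (M : ℕ) [NeZero M] (lam R P Pbar α s β ν ζ δ γ : ℝ)
    (hlam : 0 < lam) (hPbar : 0 < Pbar) (hα : 2 < α) (hs : 0 < s) (hν : 0 ≤ ν) (hγ : 0 < γ)
    (hβ0 : 0 ≤ β) (hβ : β < 1 / 2 ∨ (β = 1 / 2 ∧ s ^ 2 * Real.pi * lam * M < 1))
    (X : Ω → ℕ → Plane) (Y : Ω → Mobile M → Plane)
    (g : (L : ℕ) → Ω → Mobile M → ℕ → Fin L → ℂ) (φ : ℕ → Ω → Mobile M → ℝ)
    (hnet : IsCellularNetwork μ lam R X Y)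
    (hg : ∀ L : ℕ, IsRayleighFading μ (g L))
    (hφ : ∀ L : ℕ, IsPowerAllocation μ (s * (L : ℝ) ^ β) P X Y (g L) (φ L))
    (hmean : ∀ L : ℕ, MeanPowerCondition μ L (s * (L : ℝ) ^ β) Pbar δ γ X Y (φ L))
    (hcorr : ∀ L : ℕ, PowerCorrelationCondition μ L (s * (L : ℝ) ^ β) P Pbar δ γ X Y (φ L)) :
    (0 < ν → ζ < β * (α - 2) →
      TendstoInMeasure μ
        (fun (L : ℕ) ω =>
          (L : ℝ) ^ (-1 - ζ) *
              (sinr α (s * (L : ℝ) ^ β) (ν * (L : ℝ) ^ (-ζ))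
                (X ω) (Y ω) (φ L ω) (g L ω) (0, 0)).toReal -
            (1 - (if β = 1 / 2 then s else 0) ^ 2 * Real.pi * lam * M) *
              (φ L ω (0, 0) ^ 2 * dist (Y ω (0, 0)) (X ω 0) ^ (-α)) / ν)
        atTop (fun _ => (0 : ℝ))) ∧
    (0 < β → β * (α - 2) ≤ ζ →
      TendstoInMeasure μ
        (fun (L : ℕ) ω =>
          (L : ℝ) ^ (-1 - β * (α - 2)) *
              (sinr α (s * (L : ℝ) ^ β) (ν * (L : ℝ) ^ (-ζ))
                (X ω) (Y ω) (φ L ω) (g L ω) (0, 0)).toReal -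
            (1 - (if β = 1 / 2 then s else 0) ^ 2 * Real.pi * lam * M) *
              (φ L ω (0, 0) ^ 2 * dist (Y ω (0, 0)) (X ω 0) ^ (-α)) /
              (s ^ (2 - α) * (2 * Real.pi * Pbar * lam / (α - 2)) +
                (if ζ = β * (α - 2) then ν else 0)))
        atTop (fun _ => (0 : ℝ))) := by
  have hpi := Real.pi_pos
  have hα2 : 0 < α - 2 := by linarith
  have hβle : β ≤ 1 / 2 := by rcases hβ with h | h <;> linarith
  have hd0 : 0 ≤ (if β = 1 / 2 then s else 0) := by split_ifs <;> linarith
  have hd : (if β = 1 / 2 then s else 0) ^ 2 * Real.pi * lam * M < 1 := by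
    rcases hβ with h | ⟨h, h'⟩
    · rw [if_neg h.ne]; norm_num
    · rwa [if_pos h]
  have hR : 0 ≤ R := by
    obtain ⟨ω, hω⟩ := hnet.dist_serving_le.exists
    exact dist_nonneg.trans (hω (0, 0))
  have hsig := hnet.tendstoInMeasure_signalGain hlam.le hd0 (tendsto_radius_div_sqrt hβle) hd
    (fun L => (hg L).measurable) (fun L => by
      obtain ⟨T, _, τ, x, y, Ψ, h⟩ := (hφ L).exists_representation_type
      exact h.lintegral_signalGain_sub_sq_le (hg L))
  refine ⟨fun hν0 hζ => ?_, fun hβpos hζ => ?_⟩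
  -- Noise dominates: with `ρ = ζ` the scaled noise is the constant `ν`, while `ζ < β (α - 2)` makes
  -- all interference vanish.
  · have h1 := tendstoInMeasure_scaled_sinr (ζ := ζ) (ρ := ζ) (c := 0) (n := ν) hν hlam.le hα hs hnet hg hφ
      (by linarith) (tendstoInMeasure_ownInterference (by linarith) hs hg hφ hnet (by nlinarith))
      (tendstoInMeasure_farInterference_zero hlam.le hα hs hg hφ hnet (by nlinarith)) hsig
    rw [zero_add] at h1
    exact h1 (by simp)
  -- Here `ρ = β (α - 2)`. The interference from BS `0` has exponent `ρ - β α = -2 β < 0`, and the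
  -- noise survives in the limit only when `ζ = ρ`.
  · refine tendstoInMeasure_scaled_sinr hν hlam.le hα hs hnet hg hφ ?_
      (tendstoInMeasure_ownInterference (by linarith) hs hg hφ hnet (by nlinarith))
      (tendstoInMeasure_farInterference hlam.le hPbar.le hα hs hγ hβpos hβle hR hd hnet hg hφ hmean
        hcorr) hsig ?_
    · have h1 : 0 < s ^ (2 - α) * (2 * Real.pi * Pbar * lam / (α - 2)) := by positivity
      split_ifs <;> linarith
    · split_ifs with h
      · simp [h]
      · have h2 : β * (α - 2) < ζ := lt_of_le_of_ne hζ (Ne.symm h)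
        have := ((tendsto_rpow_neg_atTop (y := -(β * (α - 2) - ζ)) (by linarith)).comp
          tendsto_natCast_atTop_atTop).const_mul ν
        simpa using this
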